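/- Let $d\ge 1$, let $I_\pm=\{\pm1,\dots,\pm d\}$ index the canonical basis $(|\tau\rangle)_{\tau\in I_\pm}$ of $\mathbb C^{2d}$, and let $r:I_\pm\to\mathbb Z^d$ be any function, with mean $\overline r=\frac1{2d}\sum_{\tau}r(\tau)\in\mathbb R^d$. Let $C(\omega)$ be a random unitary matrix in $M_{2d}(\mathbb C)$ on a probability space $(\Omega,\mu)$, and let $C_k=C(\omega_k)$, $k\ge1$, be i.i.d. copies on the product space $(\Omega^{\mathbb N^*},\mu^{\otimes\mathbb N^*})$, with expectation $\mathbb E$. On $\mathbb C^{2d}\otimes\ell^2(\mathbb Z^d)$ let $$S=\sum_{x\in\mathbb Z^d}\sum_{\tau\in I_\pm}|\tau\rangle\langle\tau|\otimes|x+r(\tau)\rangle\langle x|,\qquad U_k=S\,(C_k\otimes\mathbb I),\qquad U(n,0)=U_n\cdots U_1 .$$ For a unit vector $\varphi_0\in\mathbb C^{2d}$ and $\psi_0=\varphi_0\otimes|0\rangle$ put $$w_k(n)=\mathbb E\,\langle\psi_0|U(n,0)^*(\mathbb I\otimes|k\rangle\langle k|)U(n,0)\psi_0\rangle\quad(k\in\mathbb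 Z^d),$$ $$\Phi_n(y)=\sum_{k}w_k(n)e^{iy\cdot k}\quad(y\in\mathbb C^d),\qquad \langle f(X)\rangle(n)=\sum_k f(k)\,w_k(n)$$ (all these sums are finite). Products such as $y\cdot k$ and $\langle y,Ay\rangle=\sum_{i,j}y_iA_{ij}y_j$ are bilinear, without complex conjugation, for $y\in\mathbb C^d$. Let $\mathbb T^d=[0,2\pi)^d$ and $d\tilde v=dv/(2\pi)^d$. On $\mathbb C^{2d}\otimes\mathbb C^{2d}$ let $$\mathcal M(y,y')=D(y,y')\,\mathbb E[C\otimes\overline C],\qquad D(y,y')\,|\tau\otimes\tau'\rangle=e^{i(y\cdot r(\tau)+y'\cdot r(\tau'))}|\tau\otimes\tau'\rangle .$$ **Assumption S.** For every $v\in\mathbb T^d$, $1$ is the only eigenvalue of $\mathcal M(-v,v)$ on the unit circle, and it is simple (algebraic multiplicity one). Let $P=|\Psi_0\rangle\langle\Psi_0|$ with $\Psi_0=(2d)^{-1/2}\sum_\tau|\tau\otimes\tau\rangle$. Under Assumption S this is the spectral projector of $\mathcal M(-v,v)$ for the eigenvalue $1$. Let $S_v(1)$ be the corresponding reduced resolvent,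 i.e. the value at $z=1$ of the analytic extension of $(\mathcal M(-v,v)-z)^{-1}-\frac{P}{1-z}$. Define the symmetric matrix $\mathbb D(v)$ by $$\mathbb D_{ij}(v)=\overline r_i\overline r_j-\frac1{2d}\sum_{\tau}r_i(\tau)r_j(\tau)-\frac1{2d}\sum_{\tau,\tau'}\bigl(r_i(\tau)r_j(\tau')+r_j(\tau)r_i(\tau')\bigr)\langle\tau\otimes\tau|S_v(1)\,\tau'\otimes\tau'\rangle .$$ **Theorem.** Suppose Assumption S holds. Then, jointly uniformly for $y$ in compact subsets of $\mathbb C^d$ and $t$ in compact subsets of $(0,\infty)$, $$\lim_{n\to\infty}\Phi_{[tn]}(y/n)=e^{it\,y\cdot\overline r},\qquad \lim_{n\to\infty}e^{-i[tn]\,\overline r\cdot y/\sqrt n}\,\Phi_{[tn]}(y/\sqrt n)=\int_{\mathbb T^d}e^{-\frac t2\langle y,\mathbb D(v)y\rangle}\,d\tilde v ,$$ and the last integral is an analytic function of $(t,y)\in\mathbb C\times\mathbb C^d$. Moreover, for all $i,j\in\{1,\dots,d\}$, $$\lim_{n\to\infty}\frac{\langle X_i\rangle(n)}n=\overline r_i,\qquad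 \lim_{n\to\infty}\frac{\langle(X-n\overline r)_i(X-n\overline r)_j\rangle(n)}n=\int_{\mathbb T^d}\mathbb D_{ij}(v)\,d\tilde v ,$$ and for every $s=(s_1,\dots,s_d)\in\mathbb N^d$, with $|s|=s_1+\dots+s_d$, $$\lim_{n\to\infty}\frac{\langle X_1^{s_1}\cdots X_d^{s_d}\rangle(n)}{n^{|s|}}=\overline r_1^{\,s_1}\cdots\overline r_d^{\,s_d},$$ $$\lim_{n\to\infty}\frac{\langle(X-n\overline r)_1^{s_1}\cdots(X-n\overline r)_d^{s_d}\rangle(n)}{n^{|s|/2}}=(-i)^{|s|}\int_{\mathbb T^d}\Bigl(\partial_{y_1}^{s_1}\cdots\partial_{y_d}^{s_d}\,e^{-\frac12\langle y,\mathbb D(v)y\rangle}\Bigr)\Big|_{y=0}\,d\tilde v .$$ -/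

import Mathlib

open MeasureTheory Filter Topology
open scoped Matrix Kronecker BigOperators

namespace RandomQW

noncomputable section

/-- The set `I_± = {±1, …, ±d}` of labels of the coin states: the pair `(j, ε)` stands for the
label `ε (j + 1)`. It has `2 d` elements. -/
abbrev CoinIdx (d : ℕ) : Type := Fin d × ℤˣ

/-- The coin space `ℂ^{2d}`, with its canonical (orthonormal) basis indexed by `I_±`. -/
abbrev CoinSpace (d : ℕ) : Type := EuclideanSpace ℂ (CoinIdx d)

/-- The Hilbert space `ℂ^{2d} ⊗ ℓ²(ℤ^d)` of the walker, realised as `ℓ²(ℤ^d; ℂ^{2d})`. -/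
abbrev WalkerSpace (d : ℕ) : Type := lp (fun _ : Fin d → ℤ => CoinSpace d) 2

theorem memlp_two_iff {d : ℕ} (f : (Fin d → ℤ) → CoinSpace d) :
    Memℓp f 2 ↔ Summable fun x => ‖f x‖ ^ 2 := by
  rw [memℓp_gen_iff (by norm_num)]
  simp

theorem memlp_coin {d : ℕ} (C : Matrix (CoinIdx d) (CoinIdx d) ℂ) (ψ : WalkerSpace d) :
    Memℓp (fun x => Matrix.toEuclideanLin C (ψ x)) 2 := by
  have h := (memlp_two_iff _).1 ψ.2
  rw [memlp_two_iff]
  let L := LinearMap.toContinuousLinearMap (Matrix.toEuclideanLin C)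
  refine Summable.of_nonneg_of_le (fun _ => by positivity) (fun x => ?_) (h.mul_left (‖L‖ ^ 2))
  rw [← mul_pow]
  exact pow_le_pow_left₀ (norm_nonneg _) (L.le_opNorm (ψ x)) 2

/-- The operator `C ⊗ 𝕀` acting on the internal degree of freedom. -/
def coinOp {d : ℕ} (C : Matrix (CoinIdx d) (CoinIdx d) ℂ) :
    WalkerSpace d →ₗ[ℂ] WalkerSpace d where
  toFun ψ := ⟨fun x => Matrix.toEuclideanLin C (ψ x), memlp_coin C ψ⟩
  map_add' ψ χ := by ext x : 2; exact (Matrix.toEuclideanLin C).map_add (ψ x) (χ x)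
  map_smul' c ψ := by ext x : 2; exact (Matrix.toEuclideanLin C).map_smul c (ψ x)

theorem memlp_shift {d : ℕ} (r : CoinIdx d → Fin d → ℤ) (ψ : WalkerSpace d) :
    Memℓp (fun x => (WithLp.toLp 2 fun τ => ψ (x - r τ) τ : CoinSpace d)) 2 := by
  have h := (memlp_two_iff _).1 ψ.2
  rw [memlp_two_iff]
  simp only [EuclideanSpace.norm_sq_eq]
  refine summable_sum fun τ _ => ?_
  have h2 : Summable fun x : Fin d → ℤ => ‖ψ (x - r τ)‖ ^ 2 :=
    h.comp_injective (i := fun x : Fin d → ℤ => x - r τ) (sub_left_injective)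
  refine Summable.of_nonneg_of_le (fun _ => by positivity) (fun x => ?_) h2
  exact pow_le_pow_left₀ (norm_nonneg _) (PiLp.norm_apply_le (ψ (x - r τ)) τ) 2

/-- The conditional shift `S = ∑ₓ ∑_τ P_τ ⊗ |x + r(τ)⟩⟨x|` with jump function `r`. -/
def shiftOp {d : ℕ} (r : CoinIdx d → Fin d → ℤ) : WalkerSpace d →ₗ[ℂ] WalkerSpace d where
  toFun ψ := ⟨fun x => WithLp.toLp 2 fun τ => ψ (x - r τ) τ, memlp_shift r ψ⟩
  map_add' ψ χ := by ext x : 2; rfl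
  map_smul' c ψ := by ext x : 2; rfl

/-- The evolution `U(n,0) = U_n ⋯ U_1` with `U_k = S (C_k ⊗ 𝕀)`; the coin matrix `C_k` is the
entry of index `k - 1` of the sequence `C`. -/
def evolution {d : ℕ} (r : CoinIdx d → Fin d → ℤ)
    (C : ℕ → Matrix (CoinIdx d) (CoinIdx d) ℂ) : ℕ → WalkerSpace d →ₗ[ℂ] WalkerSpace d
  | 0 => LinearMap.id
  | n + 1 => (shiftOp r ∘ₗ coinOp (C n)) ∘ₗ evolution r C n

/-- `W_k(n) = ⟨U(n,0) ψ₀, (𝕀 ⊗ |k⟩⟨k|) U(n,0) ψ₀⟩` for the initial state `ψ₀ = φ₀ ⊗ |0⟩`. -/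
def prob {d : ℕ} (r : CoinIdx d → Fin d → ℤ) (C : ℕ → Matrix (CoinIdx d) (CoinIdx d) ℂ)
    (φ₀ : CoinSpace d) (n : ℕ) (k : Fin d → ℤ) : ℝ :=
  ‖evolution r C n (lp.single 2 (0 : Fin d → ℤ) φ₀) k‖ ^ 2

/-- After `n` steps the walker lives in a finite set that does not depend on the coins, so that
every sum over `ℤ^d` below is in fact a finite sum. -/
theorem exists_finset_prob_eq_zero {d : ℕ} (r : CoinIdx d → Fin d → ℤ) (φ₀ : CoinSpace d)
    (n : ℕ) : ∃ F : Finset (Fin d → ℤ), ∀ (C : ℕ → Matrix (CoinIdx d) (CoinIdx d) ℂ),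
      ∀ k ∉ F, prob r C φ₀ n k = 0 := by
  suffices h : ∃ F : Finset (Fin d → ℤ), ∀ (C : ℕ → Matrix (CoinIdx d) (CoinIdx d) ℂ),
      ∀ k ∉ F, evolution r C n (lp.single 2 (0 : Fin d → ℤ) φ₀) k = 0 by
    obtain ⟨F, hF⟩ := h
    exact ⟨F, fun C k hk => by simp [prob, hF C k hk]⟩
  classical
  induction n with
  | zero =>
    refine ⟨{0}, fun C k hk => ?_⟩
    have hk' : k ≠ 0 := by simpa using hk
    simp [evolution, hk']
  | succ n ih =>
    obtain ⟨F, hF⟩ := ih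
    refine ⟨Finset.univ.biUnion fun τ => F.image fun x => x + r τ, fun C k hk => ?_⟩
    ext τ
    have hk' : k - r τ ∉ F := fun hmem => hk (by
      simp only [Finset.mem_biUnion, Finset.mem_univ, true_and, Finset.mem_image]
      exact ⟨τ, _, hmem, by simp⟩)
    simp [evolution, shiftOp, coinOp, hF C _ hk']

/-- The averaged distribution `w_k(n) = 𝔼 (W_k^ω(n))`, for i.i.d. random coin matrices
`C(ω₁), C(ω₂), …`, the expectation being taken with respect to the product measure. -/
def avgProb {d : ℕ} {Ω : Type*} [MeasurableSpace Ω] (μ : Measure Ω) [IsProbabilityMeasure μ]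
    (r : CoinIdx d → Fin d → ℤ) (C : Ω → Matrix (CoinIdx d) (CoinIdx d) ℂ)
    (φ₀ : CoinSpace d) (n : ℕ) (k : Fin d → ℤ) : ℝ :=
  ∫ ω : ℕ → Ω, prob r (fun s => C (ω s)) φ₀ n k ∂(Measure.infinitePi fun _ : ℕ => μ)

/-- The averaged expectation `⟨f(X)⟩(n) = ∑ₖ f(k) w_k(n)`. -/
def avgExp {d : ℕ} {Ω : Type*} [MeasurableSpace Ω] (μ : Measure Ω) [IsProbabilityMeasure μ]
    (r : CoinIdx d → Fin d → ℤ) (C : Ω → Matrix (CoinIdx d) (CoinIdx d) ℂ)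
    (φ₀ : CoinSpace d) (n : ℕ) (f : (Fin d → ℤ) → ℝ) : ℝ :=
  ∑' k : Fin d → ℤ, f k * avgProb μ r C φ₀ n k

/-- The averaged characteristic function `Φ_n(y) = ∑ₖ w_k(n) e^{i y·k}`, for `y ∈ ℂ^d`. -/
def charFn {d : ℕ} {Ω : Type*} [MeasurableSpace Ω] (μ : Measure Ω) [IsProbabilityMeasure μ]
    (r : CoinIdx d → Fin d → ℤ) (C : Ω → Matrix (CoinIdx d) (CoinIdx d) ℂ)
    (φ₀ : CoinSpace d) (n : ℕ) (y : Fin d → ℂ) : ℂ :=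
  ∑' k : Fin d → ℤ,
    (avgProb μ r C φ₀ n k : ℂ) * Complex.exp (Complex.I * ∑ j, y j * (k j : ℂ))

/-- The averaged matrix `𝔼 (C ⊗ C̄)` on `ℂ^{2d} ⊗ ℂ^{2d}`. -/
def avgCoin {d : ℕ} {Ω : Type*} [MeasurableSpace Ω] (μ : Measure Ω)
    (C : Ω → Matrix (CoinIdx d) (CoinIdx d) ℂ) :
    Matrix (CoinIdx d × CoinIdx d) (CoinIdx d × CoinIdx d) ℂ :=
  Matrix.of fun S T => ∫ ω, (C ω ⊗ₖ (C ω).map star) S T ∂μ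

/-- The diagonal matrix `D(y, y')` with entries `e^{i (y·r(τ) + y'·r(τ'))}`. -/
def phase {d : ℕ} (r : CoinIdx d → Fin d → ℤ) (y y' : Fin d → ℝ) :
    Matrix (CoinIdx d × CoinIdx d) (CoinIdx d × CoinIdx d) ℂ :=
  Matrix.diagonal fun T => Complex.exp (Complex.I *
    ((∑ j, (y j * (r T.1 j : ℝ) + y' j * (r T.2 j : ℝ)) : ℝ) : ℂ))

/-- The averaged matrix `M(y, y') = D(y, y') 𝔼 (C ⊗ C̄)`. -/
def avgMatrix {d : ℕ} {Ω : Type*} [MeasurableSpace Ω] (μ : Measure Ω)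
    (r : CoinIdx d → Fin d → ℤ) (C : Ω → Matrix (CoinIdx d) (CoinIdx d) ℂ)
    (y y' : Fin d → ℝ) : Matrix (CoinIdx d × CoinIdx d) (CoinIdx d × CoinIdx d) ℂ :=
  phase r y y' * avgCoin μ C

/-- The torus `𝕋^d = [0, 2π)^d`. -/
def torus (d : ℕ) : Set (Fin d → ℝ) := Set.univ.pi fun _ => Set.Ico 0 (2 * Real.pi)

/-- The integral `∫_{𝕋^d} f(v) dṽ` for the normalised measure `dṽ = dv / (2π)^d`. -/
def torusInt {d : ℕ} (f : (Fin d → ℝ) → ℂ) : ℂ :=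
  (((2 * Real.pi) ^ d : ℝ) : ℂ)⁻¹ * ∫ v in torus d, f v

/-- Assumption S: for every `v ∈ 𝕋^d`, the number `1` is the only eigenvalue of `M(-v, v)` on the
unit circle, and it is a simple eigenvalue (of algebraic multiplicity one). -/
def AssumptionS {d : ℕ} {Ω : Type*} [MeasurableSpace Ω] (μ : Measure Ω)
    (r : CoinIdx d → Fin d → ℤ) (C : Ω → Matrix (CoinIdx d) (CoinIdx d) ℂ) : Prop :=
  ∀ v ∈ torus d,
    spectrum ℂ (avgMatrix μ r C (-v) v) ∩ Metric.sphere (0 : ℂ) 1 = {1} ∧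
    (avgMatrix μ r C (-v) v).charpoly.rootMultiplicity 1 = 1

/-- The mean `r̄ = (1 / 2d) ∑_τ r(τ)` of the jump function. -/
def meanJump {d : ℕ} (r : CoinIdx d → Fin d → ℤ) (j : Fin d) : ℝ :=
  (1 / (2 * d : ℝ)) * ∑ τ, (r τ j : ℝ)

/-- The projection `P = |Ψ₀⟩⟨Ψ₀|` with `Ψ₀ = (2d)^{-1/2} ∑_τ |τ ⊗ τ⟩`. -/
def projPsi (d : ℕ) : Matrix (CoinIdx d × CoinIdx d) (CoinIdx d × CoinIdx d) ℂ :=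
  Matrix.of fun S T => if S.1 = S.2 ∧ T.1 = T.2 then 1 / (2 * d : ℂ) else 0

/-- The reduced resolvent `S(z)` of a matrix `M` at its eigenvalue `1` with spectral projection
`P`, defined by `(M - z)⁻¹ = P / (1 - z) + S(z)` for `z` close to `1`, `z ≠ 1`, and by analytic
continuation at `z = 1`. In closed form `S(z) = (M - P - z)⁻¹ (1 - P)`; see
`resolvent_eq_add_reducedResolvent`. -/
def reducedResolvent {ι : Type*} [Fintype ι] [DecidableEq ι] (M P : Matrix ι ι ℂ) (z : ℂ) :
    Matrix ι ι ℂ :=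
  (M - P - z • (1 : Matrix ι ι ℂ))⁻¹ * (1 - P)

theorem resolvent_eq_add_reducedResolvent {ι : Type*} [Fintype ι] [DecidableEq ι]
    (M P : Matrix ι ι ℂ) (hP : P * P = P) (hMP : M * P = P) (hPM : P * M = P) (z : ℂ)
    (hz : z ≠ 1) (hu : IsUnit (M - P - z • (1 : Matrix ι ι ℂ)).det) :
    (M - z • (1 : Matrix ι ι ℂ))⁻¹ = (1 - z)⁻¹ • P + reducedResolvent M P z := by
  have hz' : (1 - z) ≠ 0 := sub_ne_zero.2 hz.symm
  set N := M - P - z • (1 : Matrix ι ι ℂ) with hN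
  have hcomm : P * N = N * P := by
    simp [hN, mul_sub, sub_mul, hP, hMP, hPM]
  have hcomm' : P * N⁻¹ = N⁻¹ * P := by
    calc P * N⁻¹ = N⁻¹ * N * P * N⁻¹ := by rw [Matrix.nonsing_inv_mul _ hu, one_mul]
      _ = N⁻¹ * (P * N) * N⁻¹ := by rw [hcomm, mul_assoc N⁻¹ N P]
      _ = N⁻¹ * P := by
        rw [← mul_assoc, mul_assoc _ N, Matrix.mul_nonsing_inv _ hu, mul_one]
  have hM : M - z • (1 : Matrix ι ι ℂ) = N + P := by rw [hN]; abel
  have hMP' : (M - z • (1 : Matrix ι ι ℂ)) * P = (1 - z) • P := by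
    rw [sub_mul, hMP, smul_mul_assoc, one_mul, sub_smul, one_smul]
  refine Matrix.inv_eq_right_inv ?_
  rw [mul_add, mul_smul_comm, hMP', smul_smul, inv_mul_cancel₀ hz', one_smul, reducedResolvent,
    ← hN, hM, add_mul, ← mul_assoc, ← mul_assoc, Matrix.mul_nonsing_inv _ hu, one_mul, hcomm',
    mul_assoc, mul_sub, mul_one, hP, sub_self, mul_zero, add_zero]
  abel

/-- The diffusion matrix
`𝔻(v) = |r̄⟩⟨r̄| - (1/2d) ∑_τ |r(τ)⟩⟨r(τ)|
  - (1/d) Sym (∑_{τ,τ'} |r(τ)⟩ ⟨τ ⊗ τ, S_v(1) τ' ⊗ τ'⟩ ⟨r(τ')|)`,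
where `Sym A = (A + Aᵀ) / 2` and `S_v` is the reduced resolvent of `M(-v, v)` at the eigenvalue `1`.
It is the symmetric matrix for which the eigenvalue of `M(y - v, v)` close to `1` is
`exp (i y·r̄ - ⟨y, 𝔻(v) y⟩ / 2 + O(‖y‖³))` as `y → 0`. -/
def diffusionMatrix {d : ℕ} {Ω : Type*} [MeasurableSpace Ω] (μ : Measure Ω)
    (r : CoinIdx d → Fin d → ℤ) (C : Ω → Matrix (CoinIdx d) (CoinIdx d) ℂ)
    (v : Fin d → ℝ) : Matrix (Fin d) (Fin d) ℂ :=
  Matrix.of fun i j =>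
    (meanJump r i : ℂ) * (meanJump r j : ℂ)
      - (1 / (2 * d : ℂ)) * ∑ τ, (r τ i : ℂ) * (r τ j : ℂ)
      - (1 / (d : ℂ)) * ∑ τ, ∑ τ', (((r τ i : ℂ) * (r τ' j : ℂ) + (r τ j : ℂ) * (r τ' i : ℂ)) / 2)
          * reducedResolvent (avgMatrix μ r C (-v) v) (projPsi d) 1 (τ, τ) (τ', τ')

/-- The bilinear form `⟨y, A y⟩ = ∑_{i,j} y_i A_{ij} y_j` on `ℂ^d` (no complex conjugation). -/
def quadForm {d : ℕ} (A : Matrix (Fin d) (Fin d) ℂ) (y : Fin d → ℂ) : ℂ := y ⬝ᵥ (A *ᵥ y)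

/-- The partial derivative `∂g/∂y_j`. -/
def partialDeriv {d : ℕ} (j : Fin d) (g : (Fin d → ℂ) → ℂ) : (Fin d → ℂ) → ℂ :=
  fun y => fderiv ℂ g y (Pi.single j 1)

/-- The mixed partial derivative `(∂/∂y_1)^{s_1} ⋯ (∂/∂y_d)^{s_d} g`. -/
def mixedDeriv {d : ℕ} (s : Fin d → ℕ) (g : (Fin d → ℂ) → ℂ) : (Fin d → ℂ) → ℂ :=
  (List.finRange d).foldr (fun j h => (partialDeriv j)^[s j] h) g

end

end RandomQW

namespace RandomQW

/-! ### Powers of a perturbed projector in a normed algebra -/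

section Abstract

variable {A : Type*} [NormedRing A]

/-! In Fourier variables one averaged step is a linear map. Pair the Fourier transform of the state
at `y - v` with the conjugate of the one at the real momentum `-v`, and average: independence of the
coins turns `n` steps into the `n`-th power of `e^{i y·r} M(-v, v)` (`avgFourier_eq_pow`), and
orthogonality of the characters recovers `Φ_n(y)` as the average over `v` of a trace of the result
(`charFn_eq_torusInt`). The theorem is thus perturbation theory of `M = M(-v, v)` near `y = 0`,
uniform in `v`.

Unitarity of the coins gives `MP = PM = P` and `‖M‖ ≤ 1`, so `M = P + Q` with `PQ = QP = 0`.
Assumption S puts the spectrum of `Q` inside the open unit disc, and periodicity and compactness in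
`v` give one power of `Q` with norm at most `1/2` for every `v`
(`exists_forall_norm_restMatrix_pow_le`).

Once the mean drift is removed, the phase at `z` is `D = 1 + W + W²/2 + O(‖z‖³)` with `PWP = 0`.
Instead of following an eigenvalue, one writes down an explicit approximate left eigenvector `L`
near `P`, satisfying `L D (P + Q) = e^c L` up to `O(‖z‖³)`, where `c` is the second order
coefficient (`left_eigenvector_remainder`). Over `m` steps with `m ‖z‖²` bounded these errors add up
to `O(‖z‖)` (`norm_proj_mul_pow_sub_le`), and `c = -⟨z, 𝔻(v) z⟩ / 2`
(`sum_second_order_eq_quadForm`). Controlling `P (D M)^m` is enough, because the trace form is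
unchanged by left multiplication by `P` (`traceForm_projPsi_mul`).

Taking `z = y / √n` gives the Gaussian average; taking `z = y / n` leaves only the drift, the
Gaussian factor tending to `1`. Since `y` is complex throughout, the moments follow by Cauchy's
estimate: the rescaled characteristic functions are entire and converge locally uniformly, hence so
do their derivatives (`EntireTendsto.partialDeriv`). The limit is an exponential in the Banach
algebra of bounded continuous functions of `v`, composed with a continuous linear form; this gives
analyticity and differentiation under the integral together. -/

theorem exists_adapted_norm (N : ℕ) (hN : N ≠ 0) :
    ∃ q κ : ℝ, 0 ≤ q ∧ q < 1 ∧ 0 ≤ κ ∧ ∀ Q : A, ‖Q‖ ≤ 1 → ‖Q ^ N‖ ≤ 1 / 2 →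
      ∃ ν : A → ℝ, (∀ X, ‖X‖ ≤ ν X) ∧ (∀ X, ν X ≤ κ * ‖X‖) ∧
        (∀ X Y, ν (X + Y) ≤ ν X + ν Y) ∧ ∀ X, ν (Q * X) ≤ q * ν X := by
  -- The norm is `ν X = ∑_{k < N} θ^k ‖Q^k X‖` with `θ^N = 2`. Shifting the index gives `θ ν(QX) = ν
  -- X - ‖X‖ + 2 ‖Q^N X‖ ≤ ν X`, a contraction by `q = θ⁻¹`. Both `q` and `κ` depend on `N` alone,
  -- which is what makes later bounds uniform in `v`.
  set θ : ℝ := (2 : ℝ) ^ ((N : ℝ)⁻¹) with hθ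
  have hN' : (0 : ℝ) < N := by exact_mod_cast Nat.pos_of_ne_zero hN
  have hθ1 : 1 < θ := Real.one_lt_rpow (by norm_num) (by positivity)
  have hθ0 : 0 < θ := by linarith
  have hθN : θ ^ N = 2 := Real.rpow_inv_natCast_pow (by norm_num) hN
  refine ⟨θ⁻¹, ∑ k ∈ Finset.range N, θ ^ k, by positivity, inv_lt_one_of_one_lt₀ hθ1,
    by positivity, fun Q hQ hQN => ⟨fun X => ∑ k ∈ Finset.range N, θ ^ k * ‖Q ^ k * X‖,
      fun X => ?_, fun X => ?_, fun X Y => ?_, fun X => ?_⟩⟩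
  · have h := Finset.single_le_sum (f := fun k => θ ^ k * ‖Q ^ k * X‖)
      (fun k _ => by positivity) (Finset.mem_range.2 (Nat.pos_of_ne_zero hN))
    simpa using h
  · rw [Finset.sum_mul]
    suffices h : ∀ k, ‖Q ^ k * X‖ ≤ ‖X‖ from
      Finset.sum_le_sum fun k _ => mul_le_mul_of_nonneg_left (h k) (by positivity)
    intro k
    induction k with
    | zero => simp
    | succ k ih =>
      rw [pow_succ', mul_assoc]
      calc ‖Q * (Q ^ k * X)‖ ≤ ‖Q‖ * ‖Q ^ k * X‖ := norm_mul_le _ _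
        _ ≤ 1 * ‖Q ^ k * X‖ := by gcongr
        _ ≤ ‖X‖ := by rw [one_mul]; exact ih
  · rw [← Finset.sum_add_distrib]
    refine Finset.sum_le_sum fun k _ => ?_
    rw [← mul_add, mul_add (Q ^ k)]
    gcongr
    exact norm_add_le _ _
  · rw [← mul_le_mul_iff_right₀ hθ0, ← mul_assoc, mul_inv_cancel₀ hθ0.ne', one_mul, Finset.mul_sum]
    have h1 : ∑ k ∈ Finset.range N, θ * (θ ^ k * ‖Q ^ k * (Q * X)‖) + ‖X‖
        = ∑ k ∈ Finset.range N, θ ^ k * ‖Q ^ k * X‖ + θ ^ N * ‖Q ^ N * X‖ := by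
      rw [← Finset.sum_range_succ (fun k => θ ^ k * ‖Q ^ k * X‖), Finset.sum_range_succ']
      simp only [pow_succ, pow_zero, one_mul, mul_assoc]
      congr 1
      refine Finset.sum_congr rfl fun k _ => by ring
    have h2 : ‖Q ^ N * X‖ ≤ 1 / 2 * ‖X‖ := (norm_mul_le _ _).trans (by gcongr)
    rw [hθN] at h1
    linarith

/-- Powers of a small perturbation `B` of `P + Q`, where the powers of `Q` decay, for which `L` is
a left eigenvector up to an error of order three. -/
theorem norm_proj_mul_pow_sub_le [NormedAlgebra ℂ A] {q κ c : ℝ} (hq0 : 0 ≤ q) (hq : q < 1)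
    (hκ : 0 ≤ κ) (hc : 0 ≤ c) :
    ∃ δ > 0, ∀ T : ℝ, 0 ≤ T → ∃ K : ℝ, 0 ≤ K ∧ ∀ (P Q L B : A) (l : ℂ) (ν : A → ℝ) (ε : ℝ) (m : ℕ),
      (∀ X, ‖X‖ ≤ ν X) → (∀ X, ν X ≤ κ * ‖X‖) → (∀ X Y, ν (X + Y) ≤ ν X + ν Y) →
      (∀ X, ν (Q * X) ≤ q * ν X) → P * P = P → P * Q = 0 → Q * P = 0 → ‖P‖ ≤ 1 →
      ‖(1 : A)‖ ≤ 1 → 0 ≤ ε → ε ≤ δ → m * ε ^ 2 ≤ T →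
      ‖L - P‖ ≤ c * ε → ‖B - (P + Q)‖ ≤ c * ε → ‖l‖ ≤ 1 + c * ε ^ 2 →
      ‖L * B - l • L‖ ≤ c * ε ^ 3 → ‖P * B ^ m - l ^ m • P‖ ≤ K * ε := by
  -- The three bounds give `c ε ≤ 1/2`, `ε ≤ 1` and `q + 8 κ c ε ≤ 1`. None involves `T`, so only
  -- `K` depends on the time horizon.
  set δ : ℝ := min (1 / (2 * c + 1)) (min 1 ((1 - q) / (8 * κ * c + 1))) with hδ
  have hδ0 : 0 < δ := by
    have : 0 < 1 - q := by linarith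
    positivity
  refine ⟨δ, hδ0, fun T hT => ?_⟩
  set S : ℝ := 2 + c + 2 * κ with hS
  set F : ℝ := Real.exp (5 * c * T) with hF
  refine ⟨T * F * c * (4 * S * F) + c * (4 * S * F) + F * c, by positivity, ?_⟩
  intro P Q L B l ν ε m hν1 hν2 hν3 hν4 hPP hPQ hQP hP h1 hε0 hεδ hmT hL hB hl hLB
  have hε1 : c * ε ≤ 1 / 2 := by
    have : ε ≤ 1 / (2 * c + 1) := hεδ.trans (min_le_left _ _)
    rw [le_div_iff₀ (by positivity)] at this
    nlinarith
  have hε2 : ε ≤ 1 := hεδ.trans ((min_le_right _ _).trans (min_le_left _ _))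
  have hε3 : q + 8 * κ * c * ε ≤ 1 := by
    have : ε ≤ (1 - q) / (8 * κ * c + 1) :=
      hεδ.trans ((min_le_right _ _).trans (min_le_right _ _))
    rw [le_div_iff₀ (by positivity)] at this
    nlinarith
  have hν0 : ∀ X, 0 ≤ ν X := fun X => (norm_nonneg X).trans (hν1 X)
  have hQ1 : ‖(1 : A) - P‖ ≤ 2 := (norm_sub_le _ _).trans (by linarith)
  -- As `L` is close to `P`, the pair `L X`, `(1 - P) X` controls `X`; the first is nearly
  -- multiplied by `l` at each step, the second is contracted in `ν`.
  have hBn : ∀ X : A, ‖X‖ ≤ 2 * (‖L * X‖ + ν ((1 - P) * X)) := by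
    intro X
    have e : X = L * X - (L - P) * X + (1 - P) * X := by noncomm_ring
    have h2 : ‖X‖ ≤ ‖L * X‖ + c * ε * ‖X‖ + ν ((1 - P) * X) := by
      calc ‖X‖ = ‖L * X - (L - P) * X + (1 - P) * X‖ := by rw [← e]
        _ ≤ ‖L * X‖ + ‖(L - P) * X‖ + ‖(1 - P) * X‖ :=
          (norm_add_le _ _).trans (by gcongr; exact norm_sub_le _ _)
        _ ≤ ‖L * X‖ + c * ε * ‖X‖ + ν ((1 - P) * X) := by
          gcongr
          · exact (norm_mul_le _ _).trans (by gcongr)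
          · exact hν1 _
    nlinarith [norm_nonneg X]
  -- The `5` is `1 + 4`: `c ε²` comes from `‖l‖`, and `4 c ε³ ≤ 4 c ε²` from the eigenvector defect
  -- times `‖B ^ j‖ ≤ 4 S g ^ j`.
  set g : ℝ := 1 + 5 * c * ε ^ 2 with hg
  have hg1 : 1 ≤ g := by rw [hg]; nlinarith [mul_nonneg hc (sq_nonneg ε)]
  have hmain : ∀ j : ℕ, ‖L * B ^ j‖ ≤ S * g ^ j ∧ ν ((1 - P) * B ^ j) ≤ S * g ^ j := by
    intro j
    induction j with
    | zero =>
      simp only [pow_zero, mul_one]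
      constructor
      · calc ‖L‖ = ‖(L - P) + P‖ := by rw [sub_add_cancel]
          _ ≤ c * ε + 1 := (norm_add_le _ _).trans (by gcongr)
          _ ≤ S := by rw [hS]; nlinarith
      · calc ν (1 - P) ≤ κ * ‖1 - P‖ := hν2 _
          _ ≤ κ * 2 := by gcongr
          _ ≤ S := by rw [hS]; nlinarith
    | succ j ih =>
      obtain ⟨ih1, ih2⟩ := ih
      have hBj : ‖B ^ j‖ ≤ 4 * (S * g ^ j) := (hBn _).trans (by linarith)
      have hSg : 0 ≤ S * g ^ j := by positivity
      constructor
      · have e : L * B ^ (j + 1) = l • (L * B ^ j) + (L * B - l • L) * B ^ j := by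
          rw [sub_mul, smul_mul_assoc, pow_succ', mul_assoc]; abel
        calc ‖L * B ^ (j + 1)‖ ≤ (1 + c * ε ^ 2) * (S * g ^ j) + c * ε ^ 3 * (4 * (S * g ^ j)) := by
              rw [e]
              refine (norm_add_le _ _).trans ?_
              rw [norm_smul]
              gcongr
              exact (norm_mul_le _ _).trans (by gcongr)
          _ ≤ S * g ^ (j + 1) := by
            have : c * ε ^ 3 ≤ c * ε ^ 2 := by
              gcongr c * ?_
              exact pow_le_pow_of_le_one hε0 hε2 (by norm_num)
            have hS' : S * g ^ (j + 1) = S * g ^ j * (1 + 5 * c * ε ^ 2) := by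
              rw [pow_succ, ← mul_assoc]
            rw [hS']
            nlinarith
      · have e : (1 - P) * B ^ (j + 1) = Q * ((1 - P) * B ^ j) + (1 - P) * (B - (P + Q)) * B ^ j := by
          have : (1 - P) * (P + Q) = Q * (1 - P) := by
            simp only [mul_sub, sub_mul, mul_add, hPP, hPQ, hQP, one_mul, mul_one]; abel
          rw [← mul_assoc, ← this, ← add_mul, ← mul_add, pow_succ', mul_assoc, ← mul_assoc]
          simp [mul_assoc]
        calc ν ((1 - P) * B ^ (j + 1))
            ≤ q * (S * g ^ j) + κ * (2 * (c * ε) * (4 * (S * g ^ j))) := by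
              rw [e]
              refine (hν3 _ _).trans (add_le_add ((hν4 _).trans (by gcongr)) ((hν2 _).trans ?_))
              gcongr
              refine (norm_mul_le _ _).trans ?_
              gcongr
              exact (norm_mul_le _ _).trans (by gcongr)
          _ = (q + 8 * κ * c * ε) * (S * g ^ j) := by ring
          _ ≤ 1 * (S * g ^ j) := by gcongr
          _ ≤ S * g ^ (j + 1) := by
            rw [one_mul, pow_succ]
            nlinarith
  -- Growth per step is `1 + O(ε²)`, so it stays bounded for the `m ≤ T / ε²` steps considered.
  have hgF : ∀ j ≤ m, g ^ j ≤ F := by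
    intro j hj
    calc g ^ j ≤ g ^ m := pow_le_pow_right₀ hg1 hj
      _ ≤ (Real.exp (5 * c * ε ^ 2)) ^ m := by
        gcongr
        rw [hg, add_comm]
        exact Real.add_one_le_exp _
      _ = Real.exp (5 * c * (m * ε ^ 2)) := by rw [← Real.exp_nat_mul]; ring_nf
      _ ≤ F := by rw [hF]; gcongr
  have hlg : ‖l‖ ≤ g := hl.trans (by rw [hg]; nlinarith [mul_nonneg hc (sq_nonneg ε)])
  have hlF : ∀ j ≤ m, ‖l‖ ^ j ≤ F := fun j hj =>
    (pow_le_pow_left₀ (norm_nonneg _) hlg j).trans (hgF j hj)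
  have hBF : ∀ j ≤ m, ‖B ^ j‖ ≤ 4 * S * F := by
    intro j hj
    obtain ⟨h1, h2⟩ := hmain j
    have h3 : S * g ^ j ≤ S * F := by gcongr; exact hgF j hj
    linarith [hBn (B ^ j)]
  -- Telescoping: each step contributes one defect of size `ε³`, so `m` steps cost `m ε³ ≤ T ε`.
  -- This is why the eigenvector equation is needed to third order.
  have htel : ∀ j ≤ m, ‖L * B ^ j - l ^ j • L‖ ≤ j * (F * (c * ε ^ 3) * (4 * S * F)) := by
    have aux : ∀ j, L * B ^ j - l ^ j • L
        = ∑ k ∈ Finset.range j, l ^ (j - 1 - k) • ((L * B - l • L) * B ^ k) := by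
      intro j
      induction j with
      | zero => simp
      | succ j ih =>
        rw [Finset.sum_range_succ]
        have : ∑ k ∈ Finset.range j, l ^ (j + 1 - 1 - k) • ((L * B - l • L) * B ^ k)
            = l • ∑ k ∈ Finset.range j, l ^ (j - 1 - k) • ((L * B - l • L) * B ^ k) := by
          rw [Finset.smul_sum]
          refine Finset.sum_congr rfl fun k hk => ?_
          have hk' := Finset.mem_range.1 hk
          rw [smul_smul, ← pow_succ']
          congr 2
          omega
        rw [this, ← ih]
        simp only [add_tsub_cancel_right, tsub_self, pow_zero, one_smul, smul_sub, sub_mul,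
          smul_mul_assoc, smul_smul, ← pow_succ', mul_assoc, one_mul]
        abel
    intro j hj
    rw [aux]
    refine (norm_sum_le _ _).trans ((Finset.sum_le_card_nsmul _ _ _ fun k hk => ?_).trans
      (by rw [Finset.card_range, nsmul_eq_mul]))
    have hk' := Finset.mem_range.1 hk
    rw [norm_smul, norm_pow, mul_assoc]
    gcongr
    · exact hlF _ (by omega)
    · refine (norm_mul_le _ _).trans ?_
      gcongr
      exact hBF k (by omega)
  have e : P * B ^ m - l ^ m • P
      = (L * B ^ m - l ^ m • L) - (L - P) * B ^ m + l ^ m • (L - P) := by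
    rw [sub_mul, smul_sub]; abel
  rw [e]
  calc _ ≤ m * (F * (c * ε ^ 3) * (4 * S * F)) + c * ε * (4 * S * F) + F * (c * ε) := by
        refine (norm_add_le _ _).trans (add_le_add ((norm_sub_le _ _).trans
          (add_le_add (htel m le_rfl) ((norm_mul_le _ _).trans ?_))) ?_)
        · gcongr
          exact hBF m le_rfl
        · rw [norm_smul, norm_pow]
          gcongr
          exact hlF m le_rfl
    _ = (m * ε ^ 2) * (F * c * (4 * S * F) * ε) + (c * (4 * S * F) + F * c) * ε := by ring
    _ ≤ T * (F * c * (4 * S * F) * ε) + (c * (4 * S * F) + F * c) * ε := by gcongr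
    _ = _ := by ring

end Abstract

/-! ### The approximate left eigenvector and its exponential rate -/

section Abstract

variable {A : Type*} [NormedRing A] [NormedAlgebra ℂ A]

/-- The third order error of the approximate left eigenvector `P + P W Q G + Y Q G`. -/
theorem left_eigenvector_remainder (P Q G W E : A) (c l : ℂ) (hPP : P * P = P) (hPQ : P * Q = 0)
    (hQP : Q * P = 0) (hG : G * (1 - Q) = 1) (hW : P * W * P = 0)
    (hc : P * (W * Q * G * W + (1 / 2 : ℂ) • (W * W)) * P = c • P) :
    (P + P * W * Q * G + (P * W * Q * G * W + (1 / 2 : ℂ) • (P * W * W)) * Q * G)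
        * ((1 + W + (1 / 2 : ℂ) • (W * W) + E) * (P + Q))
      - l • (P + P * W * Q * G + (P * W * Q * G * W + (1 / 2 : ℂ) • (P * W * W)) * Q * G)
    = (P * W * Q * G * ((1 / 2 : ℂ) • (W * W))
        + (P * W * Q * G * W + (1 / 2 : ℂ) • (P * W * W)) * Q * G * W
        + (P * W * Q * G * W + (1 / 2 : ℂ) • (P * W * W)) * Q * G * ((1 / 2 : ℂ) • (W * W))
        + (P + P * W * Q * G + (P * W * Q * G * W + (1 / 2 : ℂ) • (P * W * W)) * Q * G) * E)
          * (P + Q)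
      - c • (P * W * Q * G + (P * W * Q * G * W + (1 / 2 : ℂ) • (P * W * W)) * Q * G)
      - (l - 1 - c) • (P + P * W * Q * G
          + (P * W * Q * G * W + (1 / 2 : ℂ) • (P * W * W)) * Q * G) := by
  have hGP : G * P = P := by
    calc G * P = G * ((1 - Q) * P) := by rw [sub_mul, hQP, one_mul, sub_zero]
      _ = P := by rw [← mul_assoc, hG, one_mul]
  have hGQ : G * Q = G - 1 := by
    rw [mul_sub, mul_one] at hG
    rw [← hG]; abel
  have hQGP : ∀ X : A, X * Q * G * P = 0 := fun X => by
    rw [mul_assoc, hGP, mul_assoc, hQP, mul_zero]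
  have hQGQ : ∀ X : A, X * Q * G * Q = X * Q * G - X * Q := fun X => by
    rw [mul_assoc, hGQ, mul_sub, mul_one]
  set Y := P * W * Q * G * W + (1 / 2 : ℂ) • (P * W * W) with hY
  have hYP : Y * P = c • P := by
    rw [← hc, hY]
    simp only [mul_add, mul_assoc, mul_smul_comm]
  set L1 := P * W * Q * G with hL1
  set L2 := Y * Q * G with hL2
  have h0 : P * (P + Q) = P := by rw [mul_add, hPP, hPQ, add_zero]
  -- The order one equation; it has no eigenvalue term because `P W P = 0`.
  have h1 : L1 * (P + Q) + P * W * (P + Q) = L1 := by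
    rw [mul_add, mul_add, hW, hL1, hQGP, hQGQ]; abel
  -- The order two equation: `Y P = c P` supplies the eigenvalue correction, and `G`, inverting `1 -
  -- Q`, solves for the part along `Q`.
  have h2 : L2 * (P + Q) + Y * (P + Q) = L2 + c • P := by
    rw [mul_add, mul_add, hYP, hL2, hQGP, hQGQ]; abel
  have h3 : Y = L1 * W + P * ((1 / 2 : ℂ) • (W * W)) := by
    rw [hY, mul_smul_comm, mul_assoc P W W]
  set V := (1 / 2 : ℂ) • (W * W)
  have key : (P + L1 + L2) * ((1 + W + V + E) * (P + Q))
      = P * (P + Q) + (L1 * (P + Q) + P * W * (P + Q)) + (L2 * (P + Q) + Y * (P + Q))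
        + (L1 * V + L2 * W + L2 * V + (P + L1 + L2) * E) * (P + Q) := by
    rw [h3]; noncomm_ring
  rw [key, h0, h1, h2]
  simp only [sub_smul, one_smul, smul_add]
  abel

set_option maxHeartbeats 1000000 in
-- Feeds the explicit `L = P + L1 + L2` into `norm_proj_mul_pow_sub_le` with `l = exp c`. Since `c =
-- O(ε²)`, replacing `1 + c` by `exp c` costs `O(ε⁴)`, and `l ^ m` becomes exactly `exp (m c)`.
theorem exists_norm_proj_mul_pow_sub_exp_le {q κ r g : ℝ} (hq0 : 0 ≤ q) (hq : q < 1)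
    (hκ : 0 ≤ κ) (hr : 0 ≤ r) (hg : 0 ≤ g) :
    ∃ δ > 0, ∀ T : ℝ, 0 ≤ T → ∃ K : ℝ, 0 ≤ K ∧
      ∀ (P Q G W D : A) (c : ℂ) (ν : A → ℝ) (ε : ℝ) (m : ℕ),
      (∀ X, ‖X‖ ≤ ν X) → (∀ X, ν X ≤ κ * ‖X‖) → (∀ X Y, ν (X + Y) ≤ ν X + ν Y) →
      (∀ X, ν (Q * X) ≤ q * ν X) → P * P = P → P * Q = 0 → Q * P = 0 → ‖P‖ = 1 →
      ‖(1 : A)‖ ≤ 1 → ‖Q‖ ≤ 1 → G * (1 - Q) = 1 → ‖G‖ ≤ g →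
      P * W * P = 0 → P * (W * Q * G * W + (1 / 2 : ℂ) • (W * W)) * P = c • P →
      ‖W‖ ≤ r * ε → ‖D - (1 + W + (1 / 2 : ℂ) • (W * W))‖ ≤ r * ε ^ 3 →
      0 ≤ ε → ε ≤ δ → m * ε ^ 2 ≤ T →
      ‖P * (D * (P + Q)) ^ m - Complex.exp (m * c) • P‖ ≤ K * ε := by
  -- A single `a ≥ 1` dominates all constants, so every coefficient is at most a multiple of `a ^
  -- 10`; the multiples in the final third order bound add up to `37`, below the chosen `40`.
  set a : ℝ := 1 + r + g with ha
  have ha1 : 1 ≤ a := by linarith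
  have ha0 : 0 ≤ a := by linarith
  have hra : r ≤ a := by linarith
  have hga : g ≤ a := by linarith
  obtain ⟨δ, hδ, H⟩ := norm_proj_mul_pow_sub_le (A := A) (c := 40 * a ^ 10) hq0 hq hκ
    (by positivity)
  -- The second bound ensures `‖c‖ ≤ 1`, as the exponential estimates require.
  refine ⟨min δ (1 / (2 * a ^ 3)), by positivity, fun T hT => ?_⟩
  obtain ⟨K, hK, H⟩ := H T hT
  refine ⟨K, hK, ?_⟩
  intro P Q G W D c ν ε m hν1 hν2 hν3 hν4 hPP hPQ hQP hP h1 hQ hG hGg hW hc hWr hD hε0 hεδ hmT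
  have hε : ε ≤ 1 / (2 * a ^ 3) := hεδ.trans (min_le_right _ _)
  rw [le_div_iff₀ (by positivity)] at hε
  have ha3 : 1 ≤ a ^ 3 := one_le_pow₀ ha1
  have hε1 : ε ≤ 1 := by nlinarith
  set E := D - (1 + W + (1 / 2 : ℂ) • (W * W)) with hE
  have hDE : D = 1 + W + (1 / 2 : ℂ) • (W * W) + E := by rw [hE]; abel
  replace hWr : ‖W‖ ≤ a * ε := hWr.trans (by gcongr)
  replace hGg : ‖G‖ ≤ a := hGg.trans hga
  replace hD : ‖E‖ ≤ a * ε ^ 3 := hD.trans (by gcongr)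
  have hhalf : ‖(1 / 2 : ℂ)‖ = 1 / 2 := by norm_num
  have hV : ‖(1 / 2 : ℂ) • (W * W)‖ ≤ a ^ 2 * ε ^ 2 / 2 := by
    rw [norm_smul, hhalf]
    have := norm_mul_le_of_le hWr hWr
    linarith
  have hL1 : ‖P * W * Q * G‖ ≤ a ^ 2 * ε :=
    (norm_mul_le_of_le (norm_mul_le_of_le (norm_mul_le_of_le hP.le hWr) hQ) hGg).trans_eq (by ring)
  have hY : ‖P * W * Q * G * W + (1 / 2 : ℂ) • (P * W * W)‖ ≤ 2 * a ^ 3 * ε ^ 2 := by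
    refine (norm_add_le_of_le (norm_mul_le_of_le hL1 hWr) (?_ : _ ≤ a ^ 2 * ε ^ 2 / 2)).trans ?_
    · rw [mul_assoc, ← mul_smul_comm]
      exact (norm_mul_le_of_le hP.le hV).trans_eq (one_mul _)
    · have : a ^ 2 ≤ a ^ 3 := pow_le_pow_right₀ ha1 (by norm_num)
      have h2 := mul_le_mul_of_nonneg_right this (sq_nonneg ε)
      have h3 := mul_nonneg (sq_nonneg a) (sq_nonneg ε)
      linarith
  have hL2 : ‖(P * W * Q * G * W + (1 / 2 : ℂ) • (P * W * W)) * Q * G‖ ≤ 2 * a ^ 4 * ε ^ 2 :=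
    (norm_mul_le_of_le (norm_mul_le_of_le hY hQ) hGg).trans_eq (by ring)
  have hcn : ‖c‖ ≤ 2 * a ^ 3 * ε ^ 2 := by
    have e : P * (W * Q * G * W + (1 / 2 : ℂ) • (W * W)) * P
        = (P * W * Q * G * W + (1 / 2 : ℂ) • (P * W * W)) * P := by
      simp only [mul_add, mul_assoc, mul_smul_comm]
    have h2 := norm_mul_le_of_le hY hP.le
    rw [← e, hc, norm_smul, hP] at h2
    linarith
  have hεε : ε ^ 2 ≤ ε := by nlinarith
  have hc1 : ‖c‖ ≤ 1 := hcn.trans (by nlinarith)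
  have hl1 := Complex.norm_exp_sub_one_le hc1
  have hl2 := Complex.norm_exp_sub_one_sub_id_le hc1
  set L1 := P * W * Q * G with hL1d
  set Y := L1 * W + (1 / 2 : ℂ) • (P * W * W) with hYd
  have hp : ∀ k ≤ 10, a ^ k ≤ a ^ 10 := fun k hk => pow_le_pow_right₀ ha1 hk
  have h10 : 0 ≤ a ^ 10 := by positivity
  have hLL : ‖L1 + Y * Q * G‖ ≤ 3 * a ^ 4 * ε := by
    refine (norm_add_le_of_le hL1 hL2).trans ?_
    have h2 : a ^ 2 * ε ≤ a ^ 4 * ε :=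
      mul_le_mul_of_nonneg_right (pow_le_pow_right₀ ha1 (by norm_num)) hε0
    have h3 : 2 * a ^ 4 * ε ^ 2 ≤ 2 * a ^ 4 * ε := mul_le_mul_of_nonneg_left hεε (by positivity)
    linarith
  have hLn : ‖P + L1 + Y * Q * G‖ ≤ 4 * a ^ 4 := by
    rw [add_assoc]
    refine (norm_add_le_of_le hP.le hLL).trans ?_
    have h4 : 1 ≤ a ^ 4 := one_le_pow₀ ha1
    have h5 : a ^ 4 * ε ≤ a ^ 4 := mul_le_of_le_one_right (by positivity) hε1
    linarith
  have hM : ‖P + Q‖ ≤ 2 := (norm_add_le_of_le hP.le hQ).trans_eq (by norm_num)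
  rw [Complex.exp_nat_mul]
  refine H P Q (P + L1 + Y * Q * G) (D * (P + Q)) (Complex.exp c) ν ε m hν1 hν2 hν3 hν4 hPP hPQ hQP
    hP.le h1 hε0 (hεδ.trans (min_le_left _ _)) hmT ?_ ?_ ?_ ?_
  · rw [add_assoc, add_sub_cancel_left]
    refine hLL.trans ?_
    have := hp 4 (by norm_num)
    gcongr
    linarith
  · have e : D * (P + Q) - (P + Q) = (W + (1 / 2 : ℂ) • (W * W) + E) * (P + Q) := by
      rw [hDE]; noncomm_ring
    rw [e]
    refine (norm_mul_le_of_le (norm_add_le_of_le (norm_add_le_of_le hWr hV) hD) hM).trans ?_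
    have ha10 : a ≤ a ^ 10 := by simpa using hp 1 (by norm_num)
    have h2 : a * ε ≤ a ^ 10 * ε := mul_le_mul_of_nonneg_right ha10 hε0
    have h3 : a ^ 2 * ε ^ 2 ≤ a ^ 10 * ε :=
      mul_le_mul (hp 2 (by norm_num)) hεε (by positivity) h10
    have h4 : a * ε ^ 3 ≤ a ^ 10 * ε := mul_le_mul ha10
      ((pow_le_pow_of_le_one hε0 hε1 (by norm_num : 1 ≤ 3)).trans_eq (pow_one ε)) (by positivity) h10
    have h5 := mul_nonneg h10 hε0
    linarith
  · have e : Complex.exp c = (Complex.exp c - 1) + 1 := by ring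
    rw [e]
    refine (norm_add_le _ _).trans ?_
    rw [norm_one]
    have := mul_le_mul_of_nonneg_right (hp 3 (by norm_num)) (sq_nonneg ε)
    have h5 := mul_nonneg h10 (sq_nonneg ε)
    linarith
  · have e := left_eigenvector_remainder P Q G W E c (Complex.exp c) hPP hPQ hQP hG hW hc
    rw [← hDE, ← hL1d, ← hYd] at e
    rw [e]
    have b1 : ‖c • (L1 + Y * Q * G)‖ ≤ 2 * a ^ 3 * ε ^ 2 * (3 * a ^ 4 * ε) := by
      rw [norm_smul]; gcongr
    have b2 : ‖(Complex.exp c - 1 - c) • (P + L1 + Y * Q * G)‖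
        ≤ (2 * a ^ 3 * ε ^ 2) ^ 2 * (4 * a ^ 4) := by
      rw [norm_smul]; gcongr
      exact hl2.trans (by gcongr)
    refine (norm_sub_le_of_le (norm_sub_le_of_le (norm_mul_le_of_le (norm_add_le_of_le
      (norm_add_le_of_le (norm_add_le_of_le (norm_mul_le_of_le hL1 hV) (norm_mul_le_of_le hL2 hWr))
        (norm_mul_le_of_le hL2 hV)) (norm_mul_le_of_le hLn hD)) hM) b1) b2).trans ?_
    have h43 : ε ^ 4 ≤ ε ^ 3 := pow_le_pow_of_le_one hε0 hε1 (by norm_num)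
    have t (x y : ℝ) (k : ℕ) (hk : k ≤ 10) (hx0 : 0 ≤ x) (hx : x ≤ ε ^ 3) (hy : y = a ^ k * x) :
        y ≤ a ^ 10 * ε ^ 3 := by
      rw [hy]
      exact mul_le_mul (hp k hk) hx hx0 h10
    have t1 := t (ε ^ 3) _ 4 (by norm_num) (by positivity) le_rfl rfl
    have t2 := t (ε ^ 3) _ 5 (by norm_num) (by positivity) le_rfl rfl
    have t3 := t (ε ^ 4) _ 6 (by norm_num) (by positivity) h43 rfl
    have t4 := t (ε ^ 3) _ 7 (by norm_num) (by positivity) le_rfl rfl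
    have t5 := t (ε ^ 4) _ 10 (by norm_num) (by positivity) h43 rfl
    have t6 : 0 ≤ a ^ 10 * ε ^ 3 := by positivity
    calc _ = a ^ 4 * ε ^ 3 + 12 * (a ^ 5 * ε ^ 3) + 2 * (a ^ 6 * ε ^ 4) + 6 * (a ^ 7 * ε ^ 3)
          + 16 * (a ^ 10 * ε ^ 4) := by ring
      _ ≤ _ := by linarith

end Abstract

/-! ### The projector `P` and the averaged coin -/

variable {d : ℕ}

theorem sum_ite_diag {ι : Type*} [Fintype ι] [DecidableEq ι] (f : ι × ι → ℂ) :
    ∑ U : ι × ι, (if U.1 = U.2 then f U else 0) = ∑ τ, f (τ, τ) := by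
  rw [Fintype.sum_prod_type]
  simp

theorem projPsi_mul_apply (X : Matrix (CoinIdx d × CoinIdx d) (CoinIdx d × CoinIdx d) ℂ)
    (S T : CoinIdx d × CoinIdx d) :
    (projPsi d * X) S T = if S.1 = S.2 then (1 / (2 * d : ℂ)) * ∑ τ, X (τ, τ) T else 0 := by
  rw [Matrix.mul_apply, Finset.mul_sum,
    ← sum_ite_diag fun U : CoinIdx d × CoinIdx d => (1 / (2 * d : ℂ)) * X U T]
  by_cases h : S.1 = S.2 <;> simp only [projPsi, Matrix.of_apply, h, true_and, false_and, if_true,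
    if_false, ite_mul, zero_mul, Finset.sum_const_zero]

theorem mul_projPsi_apply (X : Matrix (CoinIdx d × CoinIdx d) (CoinIdx d × CoinIdx d) ℂ)
    (S T : CoinIdx d × CoinIdx d) :
    (X * projPsi d) S T = if T.1 = T.2 then (1 / (2 * d : ℂ)) * ∑ τ, X S (τ, τ) else 0 := by
  rw [Matrix.mul_apply, Finset.mul_sum,
    ← sum_ite_diag fun U : CoinIdx d × CoinIdx d => (1 / (2 * d : ℂ)) * X S U]
  by_cases h : T.1 = T.2 <;> simp only [projPsi, Matrix.of_apply, h, and_true, and_false, if_true,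
    if_false, mul_ite, mul_zero, Finset.sum_const_zero, mul_comm]

/-- `P` has rank one, so compression by it is a scalar. This turns the abstract conditions on `P W
P` and on `c` into sums over `τ`, `τ'`. -/
theorem projPsi_mul_mul_projPsi (X : Matrix (CoinIdx d × CoinIdx d) (CoinIdx d × CoinIdx d) ℂ) :
    projPsi d * X * projPsi d
      = ((1 / (2 * d : ℂ)) * ∑ τ, ∑ τ', X (τ, τ) (τ', τ')) • projPsi d := by
  ext S T
  rw [mul_projPsi_apply]
  simp only [projPsi_mul_apply]
  rw [Matrix.smul_apply, projPsi, Matrix.of_apply, smul_eq_mul,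
    Finset.sum_comm (f := fun τ τ' => X (τ, τ) (τ', τ'))]
  by_cases hS : S.1 = S.2 <;> by_cases hT : T.1 = T.2 <;>
    simp only [hS, hT, if_true, if_false, ← Finset.mul_sum, and_self, and_true, and_false,
      mul_zero, Finset.sum_const_zero]
  ring

theorem card_coinIdx : Fintype.card (CoinIdx d) = 2 * d := by
  simp [CoinIdx, mul_comm]

theorem projPsi_mul_self (hd : d ≠ 0) : projPsi d * projPsi d = projPsi d := by
  have h : (d : ℂ) ≠ 0 := by exact_mod_cast hd
  have h2 : Fintype.card (Fin d × ℤˣ) = 2 * d := card_coinIdx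
  ext S T
  rw [mul_projPsi_apply]
  simp only [projPsi, Matrix.of_apply, and_true]
  by_cases hS : S.1 = S.2 <;> by_cases hT : T.1 = T.2 <;>
    simp [hS, hT]
  field_simp

theorem projPsi_apply_diag (τ τ' : CoinIdx d) : projPsi d (τ, τ) (τ', τ') = 1 / (2 * d : ℂ) := by
  simp [projPsi]

theorem projPsi_conjTranspose : (projPsi d)ᴴ = projPsi d := by
  ext S T
  simp [projPsi, and_comm, apply_ite (starRingEnd ℂ), map_ofNat]

theorem norm_coin_apply_le {Ω : Type*} {C : Ω → Matrix (CoinIdx d) (CoinIdx d) ℂ}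
    (hC : ∀ ω, C ω ∈ Matrix.unitaryGroup (CoinIdx d) ℂ) (ω : Ω) (σ τ : CoinIdx d) :
    ‖C ω σ τ‖ ≤ 1 :=
  entry_norm_bound_of_unitary (hC ω) σ τ

theorem avgCoin_apply {Ω : Type*} [MeasurableSpace Ω] (μ : Measure Ω)
    (C : Ω → Matrix (CoinIdx d) (CoinIdx d) ℂ) (S T : CoinIdx d × CoinIdx d) :
    avgCoin μ C S T = ∫ ω, C ω S.1 T.1 * star (C ω S.2 T.2) ∂μ := by
  simp [avgCoin, Matrix.kroneckerMap_apply]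

section Coin

variable {Ω : Type*} [MeasurableSpace Ω] (μ : Measure Ω) [IsProbabilityMeasure μ]
    (r : CoinIdx d → Fin d → ℤ) {C : Ω → Matrix (CoinIdx d) (CoinIdx d) ℂ}

theorem integrable_coin_mul (hC : ∀ ω, C ω ∈ Matrix.unitaryGroup (CoinIdx d) ℂ)
    (hm : ∀ σ τ, Measurable fun ω => C ω σ τ) (σ τ σ' τ' : CoinIdx d) :
    Integrable (fun ω => C ω σ τ * star (C ω σ' τ')) μ := by
  refine Integrable.of_bound (C := 1)
    ((hm σ τ).mul (continuous_star.measurable.comp (hm σ' τ'))).aestronglyMeasurable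
    (ae_of_all _ fun ω => ?_)
  rw [norm_mul, norm_star]
  exact mul_le_one₀ (norm_coin_apply_le hC ω σ τ) (norm_nonneg _) (norm_coin_apply_le hC ω σ' τ')

/-- Orthonormality of the rows of `C`: `Ψ₀` is fixed by every `C ⊗ C̄`, before averaging. The
companion on the left uses the columns. -/
theorem avgCoin_mul_projPsi (hC : ∀ ω, C ω ∈ Matrix.unitaryGroup (CoinIdx d) ℂ)
    (hm : ∀ σ τ, Measurable fun ω => C ω σ τ) : avgCoin μ C * projPsi d = projPsi d := by
  ext S T
  rw [mul_projPsi_apply]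
  simp only [avgCoin_apply]
  rw [← integral_finsetSum _ fun τ _ => integrable_coin_mul μ hC hm _ _ _ _]
  have h : ∀ ω, ∑ τ, C ω S.1 τ * star (C ω S.2 τ) = (1 : Matrix _ _ ℂ) S.1 S.2 := fun ω => by
    rw [← (Matrix.mem_unitaryGroup_iff.1 (hC ω)), Matrix.mul_apply]
    simp [Matrix.star_apply]
  simp only [h, integral_const, projPsi, Matrix.of_apply, Matrix.one_apply]
  by_cases hS : S.1 = S.2 <;> by_cases hT : T.1 = T.2 <;> simp [hS, hT]

theorem projPsi_mul_avgCoin (hC : ∀ ω, C ω ∈ Matrix.unitaryGroup (CoinIdx d) ℂ)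
    (hm : ∀ σ τ, Measurable fun ω => C ω σ τ) : projPsi d * avgCoin μ C = projPsi d := by
  ext S T
  rw [projPsi_mul_apply]
  simp only [avgCoin_apply]
  rw [← integral_finsetSum _ fun τ _ => integrable_coin_mul μ hC hm _ _ _ _]
  have h : ∀ ω, ∑ τ, C ω τ T.1 * star (C ω τ T.2) = (1 : Matrix _ _ ℂ) T.2 T.1 := fun ω => by
    rw [← (Matrix.mem_unitaryGroup_iff'.1 (hC ω)), Matrix.mul_apply]
    simp [Matrix.star_apply, mul_comm]
  simp only [h, integral_const, projPsi, Matrix.of_apply, Matrix.one_apply]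
  by_cases hS : S.1 = S.2 <;> by_cases hT : T.1 = T.2 <;> simp [hS, hT, eq_comm]

theorem phase_mul_projPsi (v : Fin d → ℝ) : phase r (-v) v * projPsi d = projPsi d := by
  ext S T
  rw [phase, Matrix.diagonal_mul]
  by_cases hS : S.1 = S.2
  · simp [hS]
  · simp [projPsi, hS]

theorem projPsi_mul_phase (v : Fin d → ℝ) : projPsi d * phase r (-v) v = projPsi d := by
  ext S T
  rw [phase, Matrix.mul_diagonal]
  by_cases hS : T.1 = T.2
  · simp [hS]
  · simp [projPsi, hS]

theorem avgMatrix_mul_projPsi (hC : ∀ ω, C ω ∈ Matrix.unitaryGroup (CoinIdx d) ℂ)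
    (hm : ∀ σ τ, Measurable fun ω => C ω σ τ) (v : Fin d → ℝ) : avgMatrix μ r C (-v) v * projPsi d = projPsi d := by
  rw [avgMatrix, mul_assoc, avgCoin_mul_projPsi μ hC hm, phase_mul_projPsi]

theorem projPsi_mul_avgMatrix (hC : ∀ ω, C ω ∈ Matrix.unitaryGroup (CoinIdx d) ℂ)
    (hm : ∀ σ τ, Measurable fun ω => C ω σ τ) (v : Fin d → ℝ) : projPsi d * avgMatrix μ r C (-v) v = projPsi d := by
  rw [avgMatrix, ← mul_assoc, projPsi_mul_phase, projPsi_mul_avgCoin μ hC hm]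

open scoped Matrix.Norms.L2Operator

/-- An average of unitaries is a contraction in operator norm. Expanding in matrix units turns the
entrywise integral into a matrix-valued one, to which the norm inequality applies. -/
theorem norm_avgCoin_le (hC : ∀ ω, C ω ∈ Matrix.unitaryGroup (CoinIdx d) ℂ)
    (hm : ∀ σ τ, Measurable fun ω => C ω σ τ) : ‖avgCoin μ C‖ ≤ 1 := by
  rcases isEmpty_or_nonempty (CoinIdx d) with hE | hE
  · have : avgCoin μ C = 0 := by ext S; exact hE.elim S.1
    rw [this, norm_zero]; exact zero_le_one
  have h1 : avgCoin μ C = ∫ ω, C ω ⊗ₖ (C ω).map star ∂μ := by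
    have h2 : ∀ ω, C ω ⊗ₖ (C ω).map star = ∑ S, ∑ T, (C ω S.1 T.1 * star (C ω S.2 T.2)) •
        Matrix.single S T (1 : ℂ) := fun ω => by
      conv_lhs => rw [Matrix.matrix_eq_sum_single (C ω ⊗ₖ (C ω).map star)]
      simp [Matrix.kroneckerMap_apply, Matrix.smul_single]
    simp_rw [h2]
    rw [integral_finsetSum _ fun S _ => integrable_finsetSum _ fun T _ =>
      (integrable_coin_mul μ hC hm _ _ _ _).smul_const _]
    simp_rw [integral_finsetSum _ fun T _ =>
      (integrable_coin_mul μ hC hm _ _ _ _).smul_const _, integral_smul_const]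
    conv_lhs => rw [Matrix.matrix_eq_sum_single (avgCoin μ C)]
    simp [avgCoin_apply, Matrix.smul_single]
  rw [h1]
  refine (norm_integral_le_of_norm_le_const (C := 1) (ae_of_all _ fun ω => ?_)).trans (by simp)
  have hU : C ω ⊗ₖ (C ω).map star ∈ Matrix.unitaryGroup (CoinIdx d × CoinIdx d) ℂ := by
    refine Matrix.kronecker_mem_unitary (hC ω) ?_
    have h := hC ω
    rw [Matrix.mem_unitaryGroup_iff] at h ⊢
    have h3 := congrArg (fun X : Matrix (CoinIdx d) (CoinIdx d) ℂ => X.map (starRingEnd ℂ)) h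
    simp only [Matrix.map_mul] at h3
    ext i j
    have h4 := congrFun (congrFun h3 i) j
    simp only [Matrix.mul_apply, Matrix.map_apply, Matrix.star_apply, Matrix.one_apply] at h4 ⊢
    simpa [apply_ite (starRingEnd ℂ)] using h4
  exact (CStarRing.norm_of_mem_unitary hU).le

theorem norm_phase_le (y y' : Fin d → ℝ) : ‖phase r y y'‖ ≤ 1 := by
  rw [phase, Matrix.l2_opNorm_diagonal, pi_norm_le_iff_of_nonneg zero_le_one]
  intro T
  rw [mul_comm, Complex.norm_exp_ofReal_mul_I]

theorem norm_avgMatrix_le (hC : ∀ ω, C ω ∈ Matrix.unitaryGroup (CoinIdx d) ℂ)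
    (hm : ∀ σ τ, Measurable fun ω => C ω σ τ) (y y' : Fin d → ℝ) : ‖avgMatrix μ r C y y'‖ ≤ 1 :=
  (norm_mul_le_of_le (norm_phase_le r y y') (norm_avgCoin_le μ hC hm)).trans (by simp)

/-- The C*-identity for a nonzero self-adjoint idempotent. -/
theorem norm_projPsi (hd : d ≠ 0) : ‖projPsi d‖ = 1 := by
  have h1 : ‖projPsi d‖ * ‖projPsi d‖ = ‖projPsi d‖ := by
    rw [← Matrix.l2_opNorm_conjTranspose_mul_self, projPsi_conjTranspose, projPsi_mul_self hd]
  have h2 : projPsi d ≠ 0 := fun h => by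
    have := congrFun (congrFun h ((⟨0, Nat.pos_of_ne_zero hd⟩, 1), (⟨0, Nat.pos_of_ne_zero hd⟩, 1)))
      ((⟨0, Nat.pos_of_ne_zero hd⟩, 1), (⟨0, Nat.pos_of_ne_zero hd⟩, 1))
    simp [projPsi, hd] at this
  exact mul_right_cancel₀ (norm_ne_zero_iff.2 h2) (h1.trans (one_mul _).symm)

end Coin

/-! ### A spectral gap uniform in `v` -/

section Spectral

variable {Ω : Type*} [MeasurableSpace Ω] (μ : Measure Ω)
    (r : CoinIdx d → Fin d → ℤ) (C : Ω → Matrix (CoinIdx d) (CoinIdx d) ℂ)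

/-- The part `M(-v, v) - P` of the averaged matrix away from the eigenvalue `1`. -/
noncomputable def restMatrix (v : Fin d → ℝ) :
    Matrix (CoinIdx d × CoinIdx d) (CoinIdx d × CoinIdx d) ℂ :=
  avgMatrix μ r C (-v) v - projPsi d

theorem continuous_restMatrix : Continuous (restMatrix μ r C) := by
  unfold restMatrix avgMatrix phase
  refine (Continuous.matrix_mul (Continuous.matrix_diagonal ?_) continuous_const).sub
    continuous_const
  refine continuous_pi fun T => ?_
  simp only [Pi.neg_apply]
  fun_prop

/-- The representative of `v` modulo `2π` in the torus. -/
noncomputable def torusRep (v : Fin d → ℝ) : Fin d → ℝ :=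
  fun j => toIcoMod Real.two_pi_pos 0 (v j)

theorem torusRep_mem (v : Fin d → ℝ) : torusRep v ∈ torus d := fun j _ => by
  have h := toIcoMod_mem_Ico Real.two_pi_pos 0 (v j)
  rwa [zero_add] at h

/-- The jumps are integral, so `M(-v, v)` is `2π`-periodic in each coordinate. Assumption S thereby
extends from the half-open cube to all `v`, and bounds on the compact closed cube become global. -/
theorem avgMatrix_torusRep (v : Fin d → ℝ) :
    avgMatrix μ r C (-torusRep v) (torusRep v) = avgMatrix μ r C (-v) v := by
  unfold avgMatrix phase
  congr 2
  ext T
  rw [Complex.exp_eq_exp_iff_exists_int]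
  refine ⟨∑ j, toIcoDiv Real.two_pi_pos 0 (v j) * (r T.1 j - r T.2 j), ?_⟩
  have h : ∀ j, torusRep v j = v j - toIcoDiv Real.two_pi_pos 0 (v j) * (2 * Real.pi) := fun j => by
    rw [torusRep, toIcoMod, zsmul_eq_mul]
  simp only [Pi.neg_apply, h]
  push_cast
  rw [Finset.sum_mul, Finset.mul_sum, Finset.mul_sum, ← Finset.sum_add_distrib]
  refine Finset.sum_congr rfl fun j _ => by ring

theorem restMatrix_torusRep (v : Fin d → ℝ) :
    restMatrix μ r C (torusRep v) = restMatrix μ r C v := by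
  rw [restMatrix, avgMatrix_torusRep, restMatrix]

variable [IsProbabilityMeasure μ]

variable {C} in
theorem restMatrix_mul_projPsi (hC : ∀ ω, C ω ∈ Matrix.unitaryGroup (CoinIdx d) ℂ)
    (hm : ∀ σ τ, Measurable fun ω => C ω σ τ) (hd : d ≠ 0) (v : Fin d → ℝ) :
    restMatrix μ r C v * projPsi d = 0 := by
  rw [restMatrix, sub_mul, avgMatrix_mul_projPsi μ r hC hm, projPsi_mul_self hd, sub_self]

variable {C} in
theorem projPsi_mul_restMatrix (hC : ∀ ω, C ω ∈ Matrix.unitaryGroup (CoinIdx d) ℂ)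
    (hm : ∀ σ τ, Measurable fun ω => C ω σ τ) (hd : d ≠ 0) (v : Fin d → ℝ) :
    projPsi d * restMatrix μ r C v = 0 := by
  rw [restMatrix, mul_sub, projPsi_mul_avgMatrix μ r hC hm, projPsi_mul_self hd, sub_self]

open scoped Matrix.Norms.L2Operator

variable {C} in
theorem norm_restMatrix_le (hC : ∀ ω, C ω ∈ Matrix.unitaryGroup (CoinIdx d) ℂ)
    (hm : ∀ σ τ, Measurable fun ω => C ω σ τ) (hd : d ≠ 0) (v : Fin d → ℝ) :
    ‖restMatrix μ r C v‖ ≤ 1 := by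
  have h : restMatrix μ r C v = avgMatrix μ r C (-v) v * (1 - projPsi d) := by
    rw [mul_sub, mul_one, avgMatrix_mul_projPsi μ r hC hm, restMatrix]
  have h1 : ‖1 - projPsi d‖ ≤ 1 := by
    have h2 : ‖1 - projPsi d‖ * ‖1 - projPsi d‖ = ‖1 - projPsi d‖ := by
      rw [← Matrix.l2_opNorm_conjTranspose_mul_self, Matrix.conjTranspose_sub,
        projPsi_conjTranspose, Matrix.conjTranspose_one]
      congr 1
      simp only [mul_sub, sub_mul, one_mul, mul_one, projPsi_mul_self hd]
      abel
    by_contra! h3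
    nlinarith
  rw [h]
  exact (norm_mul_le_of_le (norm_avgMatrix_le μ r hC hm _ _) h1).trans (by simp)

variable {C} in
-- An eigenvector `x` of `M - P` with `l ≠ 0` satisfies `P x = 0`, hence `M x = l x`. If `‖l‖ ≥ 1`,
-- contractivity and Assumption S force `l = 1`; the eigenspace of `M` at `1` is then a line
-- containing the range of `P`, which contradicts `P x = 0`.
theorem norm_lt_one_of_mem_spectrum_restMatrix
    (hC : ∀ ω, C ω ∈ Matrix.unitaryGroup (CoinIdx d) ℂ)
    (hm : ∀ σ τ, Measurable fun ω => C ω σ τ) (hd : d ≠ 0) (hS : AssumptionS μ r C)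
    (v : Fin d → ℝ) {l : ℂ} (hl : l ∈ spectrum ℂ (restMatrix μ r C v)) : ‖l‖ < 1 := by
  by_contra! hl1
  obtain ⟨hS1, hS2⟩ := hS _ (torusRep_mem v)
  rw [avgMatrix_torusRep] at hS1 hS2
  set M := avgMatrix μ r C (-v) v with hM
  have hPM : projPsi d * M = projPsi d := projPsi_mul_avgMatrix μ r hC hm v
  have hMP : M * projPsi d = projPsi d := avgMatrix_mul_projPsi μ r hC hm v
  have hl0 : l ≠ 0 := fun h => by norm_num [h] at hl1
  rw [← Matrix.spectrum_toLin', ← Module.End.hasEigenvalue_iff_mem_spectrum] at hl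
  obtain ⟨x, hx⟩ := hl.exists_hasEigenvector
  have hx0 := hx.2
  have hx1 : restMatrix μ r C v *ᵥ x = l • x := by simpa using hx.apply_eq_smul
  have hPx : projPsi d *ᵥ x = 0 := by
    have h : projPsi d *ᵥ (restMatrix μ r C v *ᵥ x) = 0 := by
      rw [Matrix.mulVec_mulVec, projPsi_mul_restMatrix μ r hC hm hd, Matrix.zero_mulVec]
    rw [hx1, Matrix.mulVec_smul] at h
    exact (smul_eq_zero.1 h).resolve_left hl0
  have hMx : M *ᵥ x = l • x := by
    rw [← hx1, restMatrix, Matrix.sub_mulVec, hPx, sub_zero]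
  have hlM : l ∈ spectrum ℂ M := by
    rw [← Matrix.spectrum_toLin', ← Module.End.hasEigenvalue_iff_mem_spectrum]
    exact Module.End.hasEigenvalue_of_hasEigenvector
      ⟨Module.End.mem_eigenspace_iff.2 (by simpa using hMx), hx0⟩
  have : Nonempty (CoinIdx d) := ⟨(⟨0, Nat.pos_of_ne_zero hd⟩, 1)⟩
  have hl2 : ‖l‖ ≤ 1 := (spectrum.norm_le_norm_of_mem hlM).trans (norm_avgMatrix_le μ r hC hm _ _)
  have hl3 : l = 1 := by
    have : l ∈ spectrum ℂ M ∩ Metric.sphere (0 : ℂ) 1 := ⟨hlM, by simp [le_antisymm hl2 hl1]⟩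
    rwa [hS1] at this
  subst hl3
  -- Geometric multiplicity is at most algebraic multiplicity, which is one by Assumption S.
  have hfin : Module.finrank ℂ (Module.End.eigenspace (Matrix.toLin' M) 1) ≤ 1 := by
    refine (LinearMap.finrank_eigenspace_le _ _).trans ?_
    rw [Matrix.charpoly_toLin', hS2]
  obtain ⟨w, hw⟩ := finrank_le_one_iff.1 hfin
  let S₀ : CoinIdx d × CoinIdx d := ((⟨0, Nat.pos_of_ne_zero hd⟩, 1), (⟨0, Nat.pos_of_ne_zero hd⟩, 1))
  set p : CoinIdx d × CoinIdx d → ℂ := projPsi d *ᵥ Pi.single S₀ 1 with hp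
  have hp0 : p ≠ 0 := fun h => by
    have := congrFun h S₀
    simp [hp, projPsi, hd, S₀] at this
  have hPp : projPsi d *ᵥ p = p := by rw [hp, Matrix.mulVec_mulVec, projPsi_mul_self hd]
  have hMp : M *ᵥ p = p := by rw [hp, Matrix.mulVec_mulVec, hMP]
  obtain ⟨a, ha⟩ := hw ⟨p, Module.End.mem_eigenspace_iff.2 (by simpa using hMp)⟩
  obtain ⟨b, hb⟩ := hw ⟨x, Module.End.mem_eigenspace_iff.2 (by simpa using hMx)⟩
  replace ha := congrArg Subtype.val ha
  replace hb := congrArg Subtype.val hb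
  simp only [Submodule.coe_smul] at ha hb
  have hb0 : b ≠ 0 := fun h => hx0 (by rw [← hb, h, zero_smul])
  rw [← hb, Matrix.mulVec_smul] at hPx
  have hPw := (smul_eq_zero.1 hPx).resolve_left hb0
  refine hp0 ?_
  rw [← hPp, ← ha, Matrix.mulVec_smul, hPw, smul_zero]

variable {C} in
-- Gelfand's formula: the spectral radius is below some `s < 1`, so some large power has norm less
-- than `s ^ n < 1/2`.
theorem exists_norm_restMatrix_pow_lt (hC : ∀ ω, C ω ∈ Matrix.unitaryGroup (CoinIdx d) ℂ)
    (hm : ∀ σ τ, Measurable fun ω => C ω σ τ) (hd : d ≠ 0) (hS : AssumptionS μ r C)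
    (v : Fin d → ℝ) : ∃ n : ℕ, ‖restMatrix μ r C v ^ n‖ < 1 / 2 := by
  have : Nonempty (CoinIdx d) := ⟨(⟨0, Nat.pos_of_ne_zero hd⟩, 1)⟩
  have : CompleteSpace (Matrix (CoinIdx d × CoinIdx d) (CoinIdx d × CoinIdx d) ℂ) :=
    FiniteDimensional.complete ℂ _
  set Q := restMatrix μ r C v
  have h1 : spectralRadius ℂ Q < ((1 : NNReal) : ENNReal) :=
    spectrum.spectralRadius_lt_of_forall_lt Q fun l hl => by
      rw [← NNReal.coe_lt_coe]
      exact norm_lt_one_of_mem_spectrum_restMatrix μ r hC hm hd hS v hl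
  obtain ⟨s, hs1, hs2⟩ := ENNReal.lt_iff_exists_nnreal_btwn.1 h1
  have h2 := (spectrum.pow_nnnorm_pow_one_div_tendsto_nhds_spectralRadius Q).eventually_lt_const hs1
  have hs3 : (s : ℝ) < 1 := by exact_mod_cast hs2
  have h3 := (tendsto_pow_atTop_nhds_zero_of_lt_one s.2 hs3).eventually_lt_const
    (by norm_num : (0 : ℝ) < 1 / 2)
  obtain ⟨n, hn2, hn3, hn0⟩ := (h2.and (h3.and (eventually_gt_atTop 0))).exists
  refine ⟨n, lt_trans ?_ hn3⟩
  have hn0' : (0 : ℝ) < n := by exact_mod_cast hn0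
  have h4 : (‖Q ^ n‖₊ : ENNReal) < (s : ENNReal) ^ n := by
    have := ENNReal.rpow_lt_rpow hn2 hn0'
    rwa [← ENNReal.rpow_mul, one_div, inv_mul_cancel₀ hn0'.ne', ENNReal.rpow_one,
      ENNReal.rpow_natCast] at this
  exact_mod_cast h4

variable {C} in
-- A Dini argument: since `‖Q‖ ≤ 1`, the norms `‖Q ^ n‖` decrease in `n`, so the open sets where
-- they fall below `1/2` form an increasing cover of the closed cube and one exponent suffices.
-- Passing to `N + 1` makes it nonzero.
theorem exists_forall_norm_restMatrix_pow_le (hC : ∀ ω, C ω ∈ Matrix.unitaryGroup (CoinIdx d) ℂ)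
    (hm : ∀ σ τ, Measurable fun ω => C ω σ τ) (hd : d ≠ 0) (hS : AssumptionS μ r C) :
    ∃ N : ℕ, N ≠ 0 ∧ ∀ v, ‖restMatrix μ r C v ^ N‖ ≤ 1 / 2 := by
  have hanti : ∀ v, Antitone fun n : ℕ => ‖restMatrix μ r C v ^ n‖ := fun v => by
    refine antitone_nat_of_succ_le fun n => ?_
    rw [pow_succ]
    exact (norm_mul_le_of_le le_rfl (norm_restMatrix_le μ r hC hm hd v)).trans_eq (mul_one _)
  have hK : IsCompact (Set.Icc (0 : Fin d → ℝ) fun _ => 2 * Real.pi) := isCompact_Icc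
  obtain ⟨N, hN⟩ := hK.elim_directed_cover (fun n : ℕ => {v | ‖restMatrix μ r C v ^ n‖ < 1 / 2})
    (fun n => isOpen_lt (((continuous_restMatrix μ r C).pow n).norm) continuous_const)
    (fun v _ => Set.mem_iUnion.2 (exists_norm_restMatrix_pow_lt μ r hC hm hd hS v))
    (Monotone.directed_le fun m n hmn v hv => (hanti v hmn).trans_lt hv)
  have hN' : ∀ v, ‖restMatrix μ r C v ^ N‖ < 1 / 2 := fun v => by
    rw [← restMatrix_torusRep]
    exact hN ⟨fun j => (torusRep_mem v j trivial).1, fun j => (torusRep_mem v j trivial).2.le⟩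
  exact ⟨N + 1, by omega, fun v => (hanti v (Nat.le_succ N)).trans (hN' v).le⟩

end Spectral

/-- The centered phase exponent `i z·(r(τ) - r̄)`. -/
noncomputable def centeredExponent (r : CoinIdx d → Fin d → ℤ) (z : Fin d → ℂ) (τ : CoinIdx d) :
    ℂ :=
  Complex.I * ∑ j, z j * ((r τ j : ℂ) - (meanJump r j : ℂ))

/-- The diagonal matrix with entries `i z·(r(τ) - r̄)` on `τ ⊗ τ'`. -/
noncomputable def centeredDiag (r : CoinIdx d → Fin d → ℤ) (z : Fin d → ℂ) :
    Matrix (CoinIdx d × CoinIdx d) (CoinIdx d × CoinIdx d) ℂ :=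
  Matrix.diagonal fun T => centeredExponent r z T.1

/-- The diagonal matrix with entries `exp (i z·(r(τ) - r̄))` on `τ ⊗ τ'`. -/
noncomputable def centeredPhase (r : CoinIdx d → Fin d → ℤ) (z : Fin d → ℂ) :
    Matrix (CoinIdx d × CoinIdx d) (CoinIdx d × CoinIdx d) ℂ :=
  Matrix.diagonal fun T => Complex.exp (centeredExponent r z T.1)

theorem sum_jump (hd : d ≠ 0) (r : CoinIdx d → Fin d → ℤ) (j : Fin d) :
    ∑ τ, (r τ j : ℂ) = 2 * d * (meanJump r j : ℂ) := by
  have h : (d : ℂ) ≠ 0 := by exact_mod_cast hd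
  rw [meanJump]
  push_cast
  field_simp

theorem centeredExponent_eq (r : CoinIdx d → Fin d → ℤ) (z : Fin d → ℂ) (τ : CoinIdx d) :
    centeredExponent r z τ = Complex.I *
      (∑ j, z j * (r τ j : ℂ) - ∑ j, z j * (meanJump r j : ℂ)) := by
  rw [centeredExponent, ← Finset.sum_sub_distrib]
  simp_rw [mul_sub]

theorem sum_mul_jump (hd : d ≠ 0) (r : CoinIdx d → Fin d → ℤ) (z : Fin d → ℂ) :
    ∑ τ, ∑ j, z j * (r τ j : ℂ) = 2 * d * ∑ j, z j * (meanJump r j : ℂ) := by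
  rw [Finset.sum_comm, Finset.mul_sum]
  refine Finset.sum_congr rfl fun j _ => ?_
  rw [← Finset.mul_sum, sum_jump hd]
  ring

theorem sum_centeredExponent (hd : d ≠ 0) (r : CoinIdx d → Fin d → ℤ) (z : Fin d → ℂ) :
    ∑ τ, centeredExponent r z τ = 0 := by
  simp_rw [centeredExponent_eq]
  rw [← Finset.mul_sum, Finset.sum_sub_distrib, sum_mul_jump hd, Finset.sum_const,
    Finset.card_univ, card_coinIdx]
  simp

/-! ### The diffusion matrix as the second order coefficient -/

section Diffusion

variable {Ω : Type*} [MeasurableSpace Ω] (μ : Measure Ω)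
    (r : CoinIdx d → Fin d → ℤ) (C : Ω → Matrix (CoinIdx d) (CoinIdx d) ℂ)

theorem diffusionMatrix_symm (v : Fin d → ℝ) (i j : Fin d) :
    diffusionMatrix μ r C v i j = diffusionMatrix μ r C v j i := by
  simp only [diffusionMatrix, Matrix.of_apply]
  congr 1
  · congr 1
    · ring
    · simp_rw [mul_comm]
  · simp_rw [add_comm]

theorem diffusionMatrix_torusRep (v : Fin d → ℝ) :
    diffusionMatrix μ r C (torusRep v) = diffusionMatrix μ r C v := by
  unfold diffusionMatrix
  rw [avgMatrix_torusRep]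

theorem quadForm_diffusionMatrix (v : Fin d → ℝ) (z : Fin d → ℂ) :
    quadForm (diffusionMatrix μ r C v) z
      = (∑ j, z j * (meanJump r j : ℂ)) ^ 2
        - (1 / (2 * d : ℂ)) * ∑ τ, (∑ j, z j * (r τ j : ℂ)) ^ 2
        - (1 / (d : ℂ)) * ∑ τ, ∑ τ', (∑ j, z j * (r τ j : ℂ)) *
          reducedResolvent (avgMatrix μ r C (-v) v) (projPsi d) 1 (τ, τ) (τ', τ')
          * (∑ j, z j * (r τ' j : ℂ)) := by
  set R := reducedResolvent (avgMatrix μ r C (-v) v) (projPsi d) 1 with hR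
  have e1 : quadForm (diffusionMatrix μ r C v) z
      = ∑ i, ∑ j, z i * z j * ((meanJump r i : ℂ) * (meanJump r j : ℂ))
        - (1 / (2 * d : ℂ)) * ∑ i, ∑ j, ∑ τ, z i * z j * ((r τ i : ℂ) * (r τ j : ℂ))
        - (1 / (d : ℂ)) * ∑ i, ∑ j, ∑ τ, ∑ τ', z i * z j *
          (((r τ i : ℂ) * (r τ' j : ℂ) + (r τ j : ℂ) * (r τ' i : ℂ)) / 2 * R (τ, τ) (τ', τ')) := by
    simp only [quadForm, dotProduct, Matrix.mulVec, diffusionMatrix, Matrix.of_apply, ← hR,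
      Finset.mul_sum, ← Finset.sum_sub_distrib]
    refine Finset.sum_congr rfl fun i _ => Finset.sum_congr rfl fun j _ => ?_
    simp only [sub_mul, mul_sub, Finset.mul_sum, Finset.sum_mul]
    congr 1
    · congr 1
      · ring
      · exact Finset.sum_congr rfl fun τ _ => by ring
    · exact Finset.sum_congr rfl fun τ _ => Finset.sum_congr rfl fun τ' _ => by ring
  have e2 : ∑ i, ∑ j, ∑ τ, z i * z j * ((r τ i : ℂ) * (r τ j : ℂ))
      = ∑ τ, (∑ j, z j * (r τ j : ℂ)) ^ 2 := by
    simp_rw [sq, Finset.sum_mul_sum]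
    rw [Finset.sum_congr rfl fun i _ => Finset.sum_comm, Finset.sum_comm]
    exact Finset.sum_congr rfl fun τ _ => Finset.sum_congr rfl fun i _ =>
      Finset.sum_congr rfl fun j _ => by ring
  have e3 : ∑ i, ∑ j, ∑ τ, ∑ τ', z i * z j *
      (((r τ i : ℂ) * (r τ' j : ℂ) + (r τ j : ℂ) * (r τ' i : ℂ)) / 2 * R (τ, τ) (τ', τ'))
      = ∑ τ, ∑ τ', (∑ j, z j * (r τ j : ℂ)) * R (τ, τ) (τ', τ') * (∑ j, z j * (r τ' j : ℂ)) := by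
    rw [Finset.sum_congr rfl fun i _ => Finset.sum_comm, Finset.sum_comm]
    refine Finset.sum_congr rfl fun τ _ => ?_
    rw [Finset.sum_congr rfl fun i _ => Finset.sum_comm, Finset.sum_comm]
    refine Finset.sum_congr rfl fun τ' _ => ?_
    have h1 : (∑ j, z j * (r τ j : ℂ)) * R (τ, τ) (τ', τ') * (∑ j, z j * (r τ' j : ℂ))
        = ∑ i, ∑ j, z i * z j * ((r τ i : ℂ) * (r τ' j : ℂ) * R (τ, τ) (τ', τ')) := by
      rw [mul_right_comm, Finset.sum_mul_sum, Finset.sum_mul]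
      refine Finset.sum_congr rfl fun i _ => ?_
      rw [Finset.sum_mul]
      exact Finset.sum_congr rfl fun j _ => by ring
    have h2 : (∑ j, z j * (r τ j : ℂ)) * R (τ, τ) (τ', τ') * (∑ j, z j * (r τ' j : ℂ))
        = ∑ i, ∑ j, z i * z j * ((r τ j : ℂ) * (r τ' i : ℂ) * R (τ, τ) (τ', τ')) := by
      rw [h1, Finset.sum_comm]
      exact Finset.sum_congr rfl fun j _ => Finset.sum_congr rfl fun i _ => by ring
    have h3 : ∀ X Y Z : ℂ, X = Y → X = Z → (Y + Z) / 2 = X := fun X Y Z h h' => by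
      rw [← h, ← h']; ring
    rw [← h3 _ _ _ h1 h2, ← Finset.sum_add_distrib, Finset.sum_div]
    refine Finset.sum_congr rfl fun i _ => ?_
    rw [← Finset.sum_add_distrib, Finset.sum_div]
    exact Finset.sum_congr rfl fun j _ => by ring
  rw [e1, e2, e3]
  congr 2
  simp_rw [sq, Finset.sum_mul_sum]
  exact Finset.sum_congr rfl fun i _ => Finset.sum_congr rfl fun j _ => by ring

variable [IsProbabilityMeasure μ]

variable {C} in
theorem isUnit_one_sub_restMatrix (hC : ∀ ω, C ω ∈ Matrix.unitaryGroup (CoinIdx d) ℂ)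
    (hm : ∀ σ τ, Measurable fun ω => C ω σ τ) (hd : d ≠ 0) (hS : AssumptionS μ r C)
    (v : Fin d → ℝ) : IsUnit (1 - restMatrix μ r C v).det := by
  rw [← Matrix.isUnit_iff_isUnit_det]
  have h : (1 : ℂ) ∉ spectrum ℂ (restMatrix μ r C v) := fun h => by
    have := norm_lt_one_of_mem_spectrum_restMatrix μ r hC hm hd hS v h
    simp at this
  simpa using spectrum.notMem_iff.1 h

variable {C} in
theorem continuous_inv_one_sub_restMatrix (hC : ∀ ω, C ω ∈ Matrix.unitaryGroup (CoinIdx d) ℂ)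
    (hm : ∀ σ τ, Measurable fun ω => C ω σ τ) (hd : d ≠ 0) (hS : AssumptionS μ r C) :
    Continuous fun v => (1 - restMatrix μ r C v)⁻¹ := by
  simp only [Matrix.inv_def, Ring.inverse_eq_inv']
  have h1 : Continuous fun v => 1 - restMatrix μ r C v :=
    continuous_const.sub (continuous_restMatrix μ r C)
  exact (h1.matrix_det.inv₀ fun v => (isUnit_one_sub_restMatrix μ r hC hm hd hS v).ne_zero).smul
    h1.matrix_adjugate

variable {C} in
theorem reducedResolvent_avgMatrix_one (hC : ∀ ω, C ω ∈ Matrix.unitaryGroup (CoinIdx d) ℂ)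
    (hm : ∀ σ τ, Measurable fun ω => C ω σ τ) (hd : d ≠ 0) (hS : AssumptionS μ r C)
    (v : Fin d → ℝ) :
    reducedResolvent (avgMatrix μ r C (-v) v) (projPsi d) 1
      = -((1 - restMatrix μ r C v)⁻¹ * (1 - projPsi d)) := by
  have hu := isUnit_one_sub_restMatrix μ r hC hm hd hS v
  rw [reducedResolvent, one_smul, ← restMatrix, ← neg_mul]
  congr 1
  refine Matrix.inv_eq_right_inv ?_
  rw [mul_neg, ← neg_mul, neg_sub, Matrix.mul_nonsing_inv _ hu]

variable {C} in
theorem continuous_diffusionMatrix (hC : ∀ ω, C ω ∈ Matrix.unitaryGroup (CoinIdx d) ℂ)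
    (hm : ∀ σ τ, Measurable fun ω => C ω σ τ) (hd : d ≠ 0) (hS : AssumptionS μ r C)
    (i j : Fin d) : Continuous fun v => diffusionMatrix μ r C v i j := by
  simp only [diffusionMatrix, Matrix.of_apply, reducedResolvent_avgMatrix_one μ r hC hm hd hS]
  have hcont := continuous_inv_one_sub_restMatrix μ r hC hm hd hS
  refine continuous_const.sub (continuous_const.mul (continuous_finsetSum _ fun τ _ =>
    continuous_finsetSum _ fun τ' _ => continuous_const.mul ?_))
  exact (hcont.matrix_mul continuous_const).neg.matrix_elem _ _

variable {C} in
theorem exists_norm_diffusionMatrix_le (hC : ∀ ω, C ω ∈ Matrix.unitaryGroup (CoinIdx d) ℂ)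
    (hm : ∀ σ τ, Measurable fun ω => C ω σ τ) (hd : d ≠ 0) (hS : AssumptionS μ r C) :
    ∃ K : ℝ, 0 ≤ K ∧ ∀ v i j, ‖diffusionMatrix μ r C v i j‖ ≤ K := by
  have hK : IsCompact (Set.Icc (0 : Fin d → ℝ) fun _ => 2 * Real.pi) := isCompact_Icc
  have h : ∀ i j, ∃ K : ℝ, ∀ v, ‖diffusionMatrix μ r C v i j‖ ≤ K := fun i j => by
    obtain ⟨K, hK⟩ := hK.exists_bound_of_continuousOn
      (continuous_diffusionMatrix μ r hC hm hd hS i j).continuousOn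
    refine ⟨K, fun v => ?_⟩
    rw [← diffusionMatrix_torusRep]
    exact hK _ ⟨fun j => (torusRep_mem v j trivial).1, fun j => (torusRep_mem v j trivial).2.le⟩
  choose K hK using h
  have hK0 : ∀ i j, 0 ≤ K i j := fun i j => (norm_nonneg _).trans (hK i j 0)
  refine ⟨∑ i, ∑ j, K i j, Finset.sum_nonneg fun i _ => Finset.sum_nonneg fun j _ => hK0 i j,
    fun v i j => (hK i j v).trans ?_⟩
  exact (Finset.single_le_sum (fun j _ => hK0 i j) (Finset.mem_univ j)).trans
    (Finset.single_le_sum (f := fun i => ∑ j, K i j)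
      (fun i _ => Finset.sum_nonneg fun j _ => hK0 i j) (Finset.mem_univ i))

variable {C} in
-- Here `Q (1 - Q)⁻¹ = -S_v(1) + P - 1`. The `P` term vanishes because the centered exponents sum to
-- zero, the `-1` changes the `W²/2` into `-W²/2`, and the resolvent term ignores the centering
-- because `S_v(1)` is annihilated by `P` on both sides.
theorem sum_second_order_eq_quadForm (hC : ∀ ω, C ω ∈ Matrix.unitaryGroup (CoinIdx d) ℂ)
    (hm : ∀ σ τ, Measurable fun ω => C ω σ τ) (hd : d ≠ 0) (hS : AssumptionS μ r C)
    (v : Fin d → ℝ) (z : Fin d → ℂ) :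
    (1 / (2 * d : ℂ)) * ∑ τ, ∑ τ', (centeredDiag r z * restMatrix μ r C v
        * (1 - restMatrix μ r C v)⁻¹ * centeredDiag r z
        + (1 / 2 : ℂ) • (centeredDiag r z * centeredDiag r z)) (τ, τ) (τ', τ')
      = -(1 / 2) * quadForm (diffusionMatrix μ r C v) z := by
  have hd' : (d : ℂ) ≠ 0 := by exact_mod_cast hd
  have hu := isUnit_one_sub_restMatrix μ r hC hm hd hS v
  have hRR := reducedResolvent_avgMatrix_one μ r hC hm hd hS v
  set Q := restMatrix μ r C v with hQ
  set G := (1 - Q)⁻¹ with hG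
  set R := reducedResolvent (avgMatrix μ r C (-v) v) (projPsi d) 1 with hR
  have hQP : Q * projPsi d = 0 := restMatrix_mul_projPsi μ r hC hm hd v
  have hPQ : projPsi d * Q = 0 := projPsi_mul_restMatrix μ r hC hm hd v
  have hG1 : G * (1 - Q) = 1 := Matrix.nonsing_inv_mul _ hu
  have hG2 : (1 - Q) * G = 1 := Matrix.mul_nonsing_inv _ hu
  have hGP : G * projPsi d = projPsi d := by
    calc G * projPsi d = G * ((1 - Q) * projPsi d) := by rw [sub_mul, hQP, one_mul, sub_zero]
      _ = projPsi d := by rw [← mul_assoc, hG1, one_mul]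
  have hPG : projPsi d * G = projPsi d := by
    calc projPsi d * G = (projPsi d * (1 - Q)) * G := by rw [mul_sub, hPQ, mul_one, sub_zero]
      _ = projPsi d := by rw [mul_assoc, hG2, mul_one]
  have hQG : Q * G = -R + projPsi d - 1 := by
    have h1 : Q * G = G - 1 := by
      rw [sub_mul, one_mul] at hG2
      rw [← hG2]; abel
    rw [h1, hRR, mul_sub, mul_one, hGP]
    abel
  have hRP : R * projPsi d = 0 := by
    rw [hRR, neg_mul, mul_assoc, sub_mul, one_mul, projPsi_mul_self hd, sub_self, mul_zero,
      neg_zero]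
  have hPR : projPsi d * R = 0 := by
    rw [hRR, mul_neg, ← mul_assoc, hPG, mul_sub, mul_one, projPsi_mul_self hd, sub_self, neg_zero]
  -- `R P = 0` and `P R = 0`, read on diagonal indices; these zero sums remove the mean `b` from the
  -- resolvent term.
  have hR1 : ∀ τ, ∑ τ', R (τ, τ) (τ', τ') = 0 := fun τ => by
    have h := congrFun (congrFun hRP (τ, τ)) (τ, τ)
    rw [mul_projPsi_apply] at h
    simpa [hd] using h
  have hR2 : ∀ τ', ∑ τ, R (τ, τ) (τ', τ') = 0 := fun τ => by
    have h := congrFun (congrFun hPR (τ, τ)) (τ, τ)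
    rw [projPsi_mul_apply] at h
    simpa [hd] using h
  set w := centeredExponent r z with hw
  have hw0 : ∑ τ, w τ = 0 := sum_centeredExponent hd r z
  set b := ∑ j, z j * (meanJump r j : ℂ) with hb
  set a : CoinIdx d → ℂ := fun τ => ∑ j, z j * (r τ j : ℂ) with ha
  have ha0 : ∑ τ, a τ = 2 * d * b := sum_mul_jump hd r z
  have hwa : ∀ τ, w τ = Complex.I * (a τ - b) := centeredExponent_eq r z
  have hentry : ∀ τ τ', (centeredDiag r z * Q * G * centeredDiag r z
        + (1 / 2 : ℂ) • (centeredDiag r z * centeredDiag r z)) (τ, τ) (τ', τ')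
      = -(w τ * R (τ, τ) (τ', τ') * w τ') + 1 / (2 * d) * w τ * w τ'
        - (1 / 2) * (if τ = τ' then w τ * w τ' else 0) := fun τ τ' => by
    rw [mul_assoc _ Q G, hQG, Matrix.add_apply, Matrix.smul_apply, centeredDiag,
      Matrix.mul_diagonal, Matrix.diagonal_mul, Matrix.diagonal_mul, Matrix.sub_apply,
      Matrix.add_apply, Matrix.neg_apply, projPsi_apply_diag, Matrix.one_apply,
      Matrix.diagonal_apply]
    simp only [Prod.mk.injEq, and_self, smul_eq_mul, ← hw]
    by_cases h : τ = τ'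
    · subst h; simp; ring
    · simp [h]; ring
  have hsum1 : ∑ τ, ∑ τ', w τ * R (τ, τ) (τ', τ') * w τ'
      = -∑ τ, ∑ τ', a τ * R (τ, τ) (τ', τ') * a τ' := by
    have e : ∀ τ τ', w τ * R (τ, τ) (τ', τ') * w τ' = -(a τ * R (τ, τ) (τ', τ') * a τ')
        + b * a τ * R (τ, τ) (τ', τ') + R (τ, τ) (τ', τ') * (b * (a τ' - b)) := fun τ τ' => by
      rw [hwa, hwa]
      linear_combination ((a τ - b) * (a τ' - b) * R (τ, τ) (τ', τ')) * Complex.I_sq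
    simp_rw [e, Finset.sum_add_distrib, ← Finset.mul_sum, hR1]
    rw [Finset.sum_comm (f := fun τ τ' => R (τ, τ) (τ', τ') * (b * (a τ' - b)))]
    simp_rw [← Finset.sum_mul, hR2]
    simp
  have hsum2 : ∑ τ, w τ * w τ = 2 * d * b ^ 2 - ∑ τ, a τ ^ 2 := by
    have e : ∀ τ, w τ * w τ = -a τ ^ 2 + 2 * b * a τ - b ^ 2 := fun τ => by
      rw [hwa]
      linear_combination ((a τ - b) * (a τ - b)) * Complex.I_sq
    simp_rw [e, Finset.sum_sub_distrib, Finset.sum_add_distrib, ← Finset.mul_sum, ha0,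
      Finset.sum_const, Finset.card_univ, card_coinIdx, Finset.sum_neg_distrib]
    simp
    ring
  simp_rw [hentry, Finset.sum_sub_distrib, Finset.sum_add_distrib, ← Finset.mul_sum, hw0,
    Finset.sum_ite_eq, Finset.mem_univ, if_true, Finset.sum_neg_distrib, hsum1, hsum2, mul_zero, Finset.sum_const_zero]
  have hqf : quadForm (diffusionMatrix μ r C v) z = b ^ 2 - (1 / (2 * d : ℂ)) * ∑ τ, a τ ^ 2
      - (1 / (d : ℂ)) * ∑ τ, ∑ τ', a τ * R (τ, τ) (τ', τ') * a τ' :=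
    quadForm_diffusionMatrix μ r C v z
  rw [hqf]
  field_simp
  ring

open scoped Matrix.Norms.L2Operator

variable {C} in
theorem exists_norm_inv_one_sub_restMatrix_le (hC : ∀ ω, C ω ∈ Matrix.unitaryGroup (CoinIdx d) ℂ)
    (hm : ∀ σ τ, Measurable fun ω => C ω σ τ) (hd : d ≠ 0) (hS : AssumptionS μ r C) :
    ∃ g : ℝ, 0 ≤ g ∧ ∀ v, ‖(1 - restMatrix μ r C v)⁻¹‖ ≤ g := by
  have hK : IsCompact (Set.Icc (0 : Fin d → ℝ) fun _ => 2 * Real.pi) := isCompact_Icc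
  have hcont := continuous_inv_one_sub_restMatrix μ r hC hm hd hS
  obtain ⟨K, hK⟩ := hK.exists_bound_of_continuousOn hcont.continuousOn
  have h : ∀ v, ‖(1 - restMatrix μ r C v)⁻¹‖ ≤ K := fun v => by
    rw [← restMatrix_torusRep]
    exact hK _ ⟨fun j => (torusRep_mem v j trivial).1, fun j => (torusRep_mem v j trivial).2.le⟩
  exact ⟨K, (norm_nonneg _).trans (h 0), h⟩

/-- Uniformly in `v`, the powers of `M(z - v, v)`, compensated by the mean drift, behave near
`z = 0` like the exponential of the quadratic form of the diffusion matrix. -/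
theorem exists_norm_projPsi_mul_pow_sub_le {C : Ω → Matrix (CoinIdx d) (CoinIdx d) ℂ}
    (hC : ∀ ω, C ω ∈ Matrix.unitaryGroup (CoinIdx d) ℂ)
    (hm : ∀ σ τ, Measurable fun ω => C ω σ τ) (hd : d ≠ 0) (hS : AssumptionS μ r C) :
    ∃ δ > 0, ∀ T : ℝ, 0 ≤ T → ∃ K : ℝ, 0 ≤ K ∧ ∀ (v : Fin d → ℝ) (z : Fin d → ℂ) (m : ℕ),
      ‖z‖ ≤ δ → m * ‖z‖ ^ 2 ≤ T →
      ‖projPsi d * (centeredPhase r z * avgMatrix μ r C (-v) v) ^ m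
        - Complex.exp (-(m / 2) * quadForm (diffusionMatrix μ r C v) z) • projPsi d‖
        ≤ K * ‖z‖ := by
  have : Nonempty (CoinIdx d) := ⟨(⟨0, Nat.pos_of_ne_zero hd⟩, 1)⟩
  obtain ⟨N, hN0, hN⟩ := exists_forall_norm_restMatrix_pow_le μ r hC hm hd hS
  obtain ⟨g, hg0, hg⟩ := exists_norm_inv_one_sub_restMatrix_le μ r hC hm hd hS
  obtain ⟨q, κ, hq0, hq1, hκ, hν⟩ := exists_adapted_norm
    (A := Matrix (CoinIdx d × CoinIdx d) (CoinIdx d × CoinIdx d) ℂ) N hN0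
  set s : ℝ := ∑ τ : CoinIdx d, ∑ j, ‖((r τ j : ℂ) - (meanJump r j : ℂ))‖ with hs
  have hs0 : 0 ≤ s := by positivity
  have hw : ∀ z τ, ‖centeredExponent r z τ‖ ≤ s * ‖z‖ := fun z τ => by
    rw [centeredExponent, norm_mul, Complex.norm_I, one_mul]
    calc _ ≤ ∑ j, ‖z‖ * ‖((r τ j : ℂ) - (meanJump r j : ℂ))‖ :=
          norm_sum_le_of_le _ fun j _ => by
            rw [norm_mul]; gcongr; exact norm_le_pi_norm z j
      _ = (∑ j, ‖((r τ j : ℂ) - (meanJump r j : ℂ))‖) * ‖z‖ := by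
          rw [← Finset.mul_sum, mul_comm]
      _ ≤ s * ‖z‖ := by
          gcongr
          exact Finset.single_le_sum (f := fun τ => ∑ j, ‖((r τ j : ℂ) - (meanJump r j : ℂ))‖)
            (fun τ _ => Finset.sum_nonneg fun j _ => norm_nonneg _) (Finset.mem_univ τ)
  obtain ⟨δ, hδ, H⟩ := exists_norm_proj_mul_pow_sub_exp_le
    (A := Matrix (CoinIdx d × CoinIdx d) (CoinIdx d × CoinIdx d) ℂ) hq0 hq1 hκ
    (r := s + s ^ 3) (by positivity) hg0
  -- The second bound makes all exponents at most `1` in norm, so the Taylor remainder of the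
  -- exponential is at most `s³ ‖z‖³`; this is the source of `r = s + s ^ 3`.
  refine ⟨min δ (1 / (s + 1)), by positivity, fun T hT => ?_⟩
  obtain ⟨K, hK, H⟩ := H T hT
  refine ⟨K, hK, fun v z m hz hmz => ?_⟩
  obtain ⟨ν, hν1, hν2, hν3, hν4⟩ := hν _ (norm_restMatrix_le μ r hC hm hd v) (hN v)
  have hsz : s * ‖z‖ ≤ 1 := by
    have h := hz.trans (min_le_right _ _)
    rw [le_div_iff₀ (by positivity)] at h
    nlinarith [norm_nonneg z]
  have hM : avgMatrix μ r C (-v) v = projPsi d + restMatrix μ r C v := by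
    rw [restMatrix]; abel
  have hu := isUnit_one_sub_restMatrix μ r hC hm hd hS v
  have key := H (projPsi d) (restMatrix μ r C v) (1 - restMatrix μ r C v)⁻¹ (centeredDiag r z)
    (centeredPhase r z) (-(1 / 2) * quadForm (diffusionMatrix μ r C v) z) ν ‖z‖ m hν1 hν2 hν3 hν4
    (projPsi_mul_self hd) (projPsi_mul_restMatrix μ r hC hm hd v)
    (restMatrix_mul_projPsi μ r hC hm hd v) (norm_projPsi hd) norm_one.le
    (norm_restMatrix_le μ r hC hm hd v) (Matrix.nonsing_inv_mul _ hu) (hg v) ?_ ?_ ?_ ?_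
    (norm_nonneg z) (hz.trans (min_le_left _ _)) hmz
  · rw [← hM] at key
    convert key using 4
    ring_nf
  · rw [projPsi_mul_mul_projPsi]
    have h : ∑ τ, ∑ τ', centeredDiag r z (τ, τ) (τ', τ') = 0 := by
      simp only [centeredDiag, Matrix.diagonal_apply, Prod.mk.injEq, and_self, Finset.sum_ite_eq,
        Finset.mem_univ, if_true]
      exact sum_centeredExponent hd r z
    rw [h, mul_zero, zero_smul]
  · rw [projPsi_mul_mul_projPsi, sum_second_order_eq_quadForm μ r hC hm hd hS]
  · rw [centeredDiag, Matrix.l2_opNorm_diagonal, pi_norm_le_iff_of_nonneg (by positivity)]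
    intro S
    refine (hw z S.1).trans ?_
    gcongr
    exact le_add_of_nonneg_right (by positivity)
  · have e : centeredPhase r z - (1 + centeredDiag r z
        + (1 / 2 : ℂ) • (centeredDiag r z * centeredDiag r z))
        = Matrix.diagonal fun S => Complex.exp (centeredExponent r z S.1)
          - ∑ k ∈ Finset.range 3, centeredExponent r z S.1 ^ k / (k.factorial : ℂ) := by
      rw [centeredPhase, centeredDiag, Matrix.diagonal_mul_diagonal, ← Matrix.diagonal_one,
        ← Matrix.diagonal_smul, Matrix.diagonal_add, Matrix.diagonal_add, Matrix.diagonal_sub]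
      congr 1
      ext S
      simp [Finset.sum_range_succ, Nat.factorial]
      ring
    rw [e, Matrix.l2_opNorm_diagonal, pi_norm_le_iff_of_nonneg (by positivity)]
    intro S
    have h1 := hw z S.1
    refine (Complex.exp_bound (h1.trans hsz) (by norm_num)).trans ?_
    calc _ ≤ (s * ‖z‖) ^ 3 * 1 := by
          gcongr
          norm_num [Nat.factorial]
      _ = s ^ 3 * ‖z‖ ^ 3 := by ring
      _ ≤ _ := by gcongr; linarith

end Diffusion

/-! ### Amplitudes and their Fourier transform -/

section Walk

variable (r : CoinIdx d → Fin d → ℤ) (φ₀ : CoinSpace d)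

/-- The amplitude at the site `k` and the coin state `τ` after `n` steps. -/
noncomputable def amplitude (C : ℕ → Matrix (CoinIdx d) (CoinIdx d) ℂ) (n : ℕ) (k : Fin d → ℤ)
    (τ : CoinIdx d) : ℂ :=
  evolution r C n (lp.single 2 (0 : Fin d → ℤ) φ₀) k τ

theorem amplitude_zero (C : ℕ → Matrix (CoinIdx d) (CoinIdx d) ℂ) (k : Fin d → ℤ)
    (τ : CoinIdx d) : amplitude r φ₀ C 0 k τ = if k = 0 then φ₀ τ else 0 := by
  by_cases hk : k = 0
  · subst hk; simp [amplitude, evolution]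
  · simp [amplitude, evolution, hk]

theorem amplitude_succ (C : ℕ → Matrix (CoinIdx d) (CoinIdx d) ℂ) (n : ℕ) (k : Fin d → ℤ)
    (τ : CoinIdx d) :
    amplitude r φ₀ C (n + 1) k τ = ∑ σ, C n τ σ * amplitude r φ₀ C n (k - r τ) σ := by
  simp [amplitude, evolution, shiftOp, coinOp, Matrix.toLpLin_apply, Matrix.mulVec, dotProduct]

theorem prob_eq_sum_amplitude (C : ℕ → Matrix (CoinIdx d) (CoinIdx d) ℂ) (n : ℕ)
    (k : Fin d → ℤ) : prob r C φ₀ n k = ∑ τ, ‖amplitude r φ₀ C n k τ‖ ^ 2 := by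
  rw [prob, EuclideanSpace.norm_sq_eq]
  rfl

theorem amplitude_eq_zero_of_prob_eq_zero (C : ℕ → Matrix (CoinIdx d) (CoinIdx d) ℂ) (n : ℕ)
    (k : Fin d → ℤ) (h : prob r C φ₀ n k = 0) (τ : CoinIdx d) : amplitude r φ₀ C n k τ = 0 := by
  rw [prob_eq_sum_amplitude, Finset.sum_eq_zero_iff_of_nonneg fun τ _ => by positivity] at h
  simpa using h τ (Finset.mem_univ τ)

theorem exists_norm_amplitude_le (n : ℕ) :
    ∃ B : ℝ, ∀ C : ℕ → Matrix (CoinIdx d) (CoinIdx d) ℂ, (∀ i σ τ, ‖C i σ τ‖ ≤ 1) →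
      ∀ k τ, ‖amplitude r φ₀ C n k τ‖ ≤ B := by
  induction n with
  | zero =>
    refine ⟨‖φ₀‖, fun C _ k τ => ?_⟩
    rw [amplitude_zero]
    split_ifs
    · exact PiLp.norm_apply_le φ₀ τ
    · simp
  | succ n ih =>
    obtain ⟨B, hB⟩ := ih
    refine ⟨∑ _σ : CoinIdx d, 1 * B, fun C hC k τ => ?_⟩
    rw [amplitude_succ]
    exact norm_sum_le_of_le _ fun σ _ => norm_mul_le_of_le (hC n τ σ) (hB C hC _ σ)

/-- The σ-algebra is left free and only the first `n` coins are required to be measurable, so that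
the statement also applies to the σ-algebra of the past in `avgFourier_succ`. -/
theorem measurable_amplitude {Ω' : Type*} {m' : MeasurableSpace Ω'}
    (C : Ω' → ℕ → Matrix (CoinIdx d) (CoinIdx d) ℂ) (n : ℕ)
    (hC : ∀ i < n, ∀ σ τ, Measurable fun ω => C ω i σ τ) (k : Fin d → ℤ) (τ : CoinIdx d) :
    Measurable fun ω => amplitude r φ₀ (C ω) n k τ := by
  induction n generalizing k τ with
  | zero => simp only [amplitude_zero]; exact measurable_const
  | succ n ih =>
    simp only [amplitude_succ]
    exact Finset.measurable_fun_sum _ fun σ _ => (hC n (Nat.lt_succ_self n) τ σ).mul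
      (ih (fun i hi => hC i (hi.trans (Nat.lt_succ_self n))) _ σ)

/-- The phase `e^{i a·k}`. -/
noncomputable def character (a : Fin d → ℂ) (k : Fin d → ℤ) : ℂ :=
  Complex.exp (Complex.I * ∑ j, a j * (k j : ℂ))

theorem character_add (a : Fin d → ℂ) (k l : Fin d → ℤ) :
    character a (k + l) = character a k * character a l := by
  rw [character, character, character, ← Complex.exp_add, ← mul_add, ← Finset.sum_add_distrib]
  congr 2
  exact Finset.sum_congr rfl fun j _ => by simp [mul_add]

theorem character_add_left (a b : Fin d → ℂ) (k : Fin d → ℤ) :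
    character (a + b) k = character a k * character b k := by
  rw [character, character, character, ← Complex.exp_add, ← mul_add, ← Finset.sum_add_distrib]
  congr 2
  exact Finset.sum_congr rfl fun j _ => by simp [add_mul]

/-- The Fourier transform of the state after `n` steps. -/
noncomputable def fourierState (C : ℕ → Matrix (CoinIdx d) (CoinIdx d) ℂ) (a : Fin d → ℂ) :
    ℕ → CoinIdx d → ℂ
  | 0 => φ₀
  | n + 1 => fun τ => character a (r τ) * ∑ σ, C n τ σ * fourierState C a n σ

theorem fourierState_succ (C : ℕ → Matrix (CoinIdx d) (CoinIdx d) ℂ) (a : Fin d → ℂ) (n : ℕ)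
    (τ : CoinIdx d) : fourierState r φ₀ C a (n + 1) τ
      = character a (r τ) * ∑ σ, C n τ σ * fourierState r φ₀ C a n σ :=
  rfl

/-- The shift by `r τ` becomes multiplication by a character. The momentum `a` may be complex, since
only finitely many sites are occupied. -/
theorem hasSum_fourierState (C : ℕ → Matrix (CoinIdx d) (CoinIdx d) ℂ) (a : Fin d → ℂ) (n : ℕ)
    (τ : CoinIdx d) :
    HasSum (fun k => character a k * amplitude r φ₀ C n k τ) (fourierState r φ₀ C a n τ) := by
  induction n generalizing τ with
  | zero =>
    have h := hasSum_single (f := fun k => character a k * amplitude r φ₀ C 0 k τ) 0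
      fun k hk => by simp [amplitude_zero, hk]
    simpa [amplitude_zero, character, fourierState] using h
  | succ n ih =>
    have h1 : HasSum (fun k => character a (r τ) *
        ∑ σ, C n τ σ * (character a k * amplitude r φ₀ C n k σ)) (fourierState r φ₀ C a (n + 1) τ) :=
      (hasSum_sum fun σ _ => (ih σ).mul_left (C n τ σ)).mul_left _
    rw [← (Equiv.subRight (r τ)).hasSum_iff] at h1
    convert h1 using 1
    ext k
    simp only [Function.comp_apply, Equiv.subRight_apply, amplitude_succ, Finset.mul_sum]
    refine Finset.sum_congr rfl fun σ _ => ?_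
    have h2 : character a k = character a (r τ) * character a (k - r τ) := by
      rw [← character_add, add_sub_cancel]
    rw [h2]
    ring

theorem fourierState_eq_sum (C : ℕ → Matrix (CoinIdx d) (CoinIdx d) ℂ) (a : Fin d → ℂ) (n : ℕ)
    (F : Finset (Fin d → ℤ)) (hF : ∀ k ∉ F, prob r C φ₀ n k = 0) (τ : CoinIdx d) :
    fourierState r φ₀ C a n τ = ∑ k ∈ F, character a k * amplitude r φ₀ C n k τ :=
  (hasSum_fourierState r φ₀ C a n τ).unique (hasSum_sum_of_ne_finset_zero fun k hk => by
    rw [amplitude_eq_zero_of_prob_eq_zero r φ₀ C n k (hF k hk), mul_zero])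

end Walk

/-! ### Independence and the averaged evolution -/

section Average

variable {Ω : Type*} [MeasurableSpace Ω] (μ : Measure Ω) [IsProbabilityMeasure μ]
    (r : CoinIdx d → Fin d → ℤ) (φ₀ : CoinSpace d) (C : Ω → Matrix (CoinIdx d) (CoinIdx d) ℂ)

/-- The averaged product `𝔼 (ψ̂ₙ(y - v) ⊗ conj ψ̂ₙ(-v))`. -/
noncomputable def avgFourier (y : Fin d → ℂ) (v : Fin d → ℝ) (n : ℕ)
    (S : CoinIdx d × CoinIdx d) : ℂ :=
  ∫ ω : ℕ → Ω, fourierState r φ₀ (fun s => C (ω s)) (y - fun j => (v j : ℂ)) n S.1 *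
    star (fourierState r φ₀ (fun s => C (ω s)) (-fun j => (v j : ℂ)) n S.2)
    ∂(Measure.infinitePi fun _ : ℕ => μ)

/-- The diagonal matrix with entries `e^{i y·r(τ)}` on `τ ⊗ τ'`. -/
noncomputable def leftPhase (y : Fin d → ℂ) :
    Matrix (CoinIdx d × CoinIdx d) (CoinIdx d × CoinIdx d) ℂ :=
  Matrix.diagonal fun S => character y (r S.1)

theorem measurable_fourierState {Ω' : Type*} {m' : MeasurableSpace Ω'}
    (C : Ω' → ℕ → Matrix (CoinIdx d) (CoinIdx d) ℂ) (n : ℕ)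
    (hC : ∀ i < n, ∀ σ τ, Measurable fun ω => C ω i σ τ) (a : Fin d → ℂ) (τ : CoinIdx d) :
    Measurable fun ω => fourierState r φ₀ (C ω) a n τ := by
  obtain ⟨F, hF⟩ := exists_finset_prob_eq_zero r φ₀ n
  simp only [fun ω => fourierState_eq_sum r φ₀ (C ω) a n F (hF _)]
  exact Finset.measurable_fun_sum _ fun k _ => (measurable_amplitude r φ₀ C n hC k τ).const_mul _

variable {C} in
theorem integrable_amplitude_mul (hC : ∀ ω, C ω ∈ Matrix.unitaryGroup (CoinIdx d) ℂ)
    (hm : ∀ σ τ, Measurable fun ω => C ω σ τ) (n : ℕ) (k k' : Fin d → ℤ) (τ τ' : CoinIdx d) :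
    Integrable (fun ω : ℕ → Ω => amplitude r φ₀ (fun s => C (ω s)) n k τ *
      star (amplitude r φ₀ (fun s => C (ω s)) n k' τ')) (Measure.infinitePi fun _ : ℕ => μ) := by
  obtain ⟨B, hB⟩ := exists_norm_amplitude_le r φ₀ n
  have hmeas : ∀ k τ, Measurable fun ω : ℕ → Ω => amplitude r φ₀ (fun s => C (ω s)) n k τ :=
    measurable_amplitude r φ₀ _ n fun i _ σ τ => (hm σ τ).comp (measurable_pi_apply i)
  have hb : ∀ (ω : ℕ → Ω) k τ, ‖amplitude r φ₀ (fun s => C (ω s)) n k τ‖ ≤ B := fun ω =>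
    hB _ fun i => norm_coin_apply_le hC (ω i)
  refine Integrable.of_bound (C := B * B)
    ((hmeas k τ).mul (continuous_star.measurable.comp (hmeas k' τ'))).aestronglyMeasurable
    (ae_of_all _ fun ω => norm_mul_le_of_le (hb ω k τ) ?_)
  rw [norm_star]
  exact hb ω k' τ'

variable {C} in
theorem avgFourier_eq_sum (hC : ∀ ω, C ω ∈ Matrix.unitaryGroup (CoinIdx d) ℂ)
    (hm : ∀ σ τ, Measurable fun ω => C ω σ τ) (n : ℕ) (F : Finset (Fin d → ℤ))
    (hF : ∀ (C : ℕ → Matrix (CoinIdx d) (CoinIdx d) ℂ), ∀ k ∉ F, prob r C φ₀ n k = 0)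
    (y : Fin d → ℂ) (v : Fin d → ℝ) (S : CoinIdx d × CoinIdx d) :
    avgFourier μ r φ₀ C y v n S = ∑ k ∈ F, ∑ k' ∈ F,
      character (y - fun j => (v j : ℂ)) k * star (character (-fun j => (v j : ℂ)) k') *
        ∫ ω : ℕ → Ω, amplitude r φ₀ (fun s => C (ω s)) n k S.1 *
          star (amplitude r φ₀ (fun s => C (ω s)) n k' S.2)
          ∂(Measure.infinitePi fun _ : ℕ => μ) := by
  simp only [avgFourier, fun (ω : ℕ → Ω) (a : Fin d → ℂ) =>
    fourierState_eq_sum r φ₀ (fun s => C (ω s)) a n F (hF _),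
    star_sum, Finset.sum_mul_sum, star_mul]
  rw [integral_finsetSum]
  · refine Finset.sum_congr rfl fun k _ => ?_
    rw [integral_finsetSum]
    · refine Finset.sum_congr rfl fun k' _ => ?_
      rw [← integral_const_mul]
      congr 1
      ext ω
      ring
    · intro k' _
      refine ((integrable_amplitude_mul μ r φ₀ hC hm n k k' S.1 S.2).const_mul
        (character (y - fun j => (v j : ℂ)) k * star (character (-fun j => (v j : ℂ)) k'))).congr
        (ae_of_all _ fun ω => ?_)
      simp only
      ring
  · intro k _
    refine integrable_finsetSum _ fun k' _ => ?_
    refine ((integrable_amplitude_mul μ r φ₀ hC hm n k k' S.1 S.2).const_mul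
      (character (y - fun j => (v j : ℂ)) k * star (character (-fun j => (v j : ℂ)) k'))).congr
      (ae_of_all _ fun ω => ?_)
    simp only
    ring

/-- A step of the walk is independent of the preceding ones. -/
theorem integral_mul_of_past {f : Ω → ℂ} (hf : Measurable f) (n : ℕ) {g : (ℕ → Ω) → ℂ}
    (hg : Measurable[⨆ i ∈ Set.Iio n, MeasurableSpace.comap (fun ω : ℕ → Ω => ω i) inferInstance] g) :
    ∫ ω : ℕ → Ω, f (ω n) * g ω ∂(Measure.infinitePi fun _ : ℕ => μ)
      = (∫ ω, f ω ∂μ) * ∫ ω : ℕ → Ω, g ω ∂(Measure.infinitePi fun _ : ℕ => μ) := by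
  have hle : ∀ i : ℕ, MeasurableSpace.comap (fun ω : ℕ → Ω => ω i) inferInstance
      ≤ (inferInstance : MeasurableSpace (ℕ → Ω)) := fun i => (measurable_pi_apply i).comap_le
  have hind : ProbabilityTheory.iIndepFun (fun (i : ℕ) (ω : ℕ → Ω) => ω i)
      (Measure.infinitePi fun _ : ℕ => μ) :=
    ProbabilityTheory.iIndepFun_infinitePi (X := fun _ ω => ω) fun _ => measurable_id
  have h := ProbabilityTheory.indep_iSup_of_disjoint hle hind
    (S := {n}) (T := Set.Iio n) (by simp)
  have hfn : Measurable fun ω : ℕ → Ω => f (ω n) := hf.comp (measurable_pi_apply n)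
  have hg' : Measurable g := hg.mono (iSup₂_le fun i _ => hle i) le_rfl
  have hXY : ProbabilityTheory.IndepFun (fun ω : ℕ → Ω => f (ω n)) g
      (Measure.infinitePi fun _ : ℕ => μ) := by
    rw [ProbabilityTheory.IndepFun_iff_Indep]
    refine ProbabilityTheory.indep_of_indep_of_le_left
      (ProbabilityTheory.indep_of_indep_of_le_right h hg.comap_le) ?_
    refine Measurable.comap_le ?_
    refine hf.comp (Measurable.mono (comap_measurable _) ?_ le_rfl)
    exact le_iSup₂_of_le n rfl le_rfl
  rw [hXY.integral_fun_mul_eq_mul_integral hfn.aestronglyMeasurable hg'.aestronglyMeasurable]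
  congr 1
  have hmp := measurePreserving_eval_infinitePi (fun _ : ℕ => μ) n
  calc ∫ ω : ℕ → Ω, f (ω n) ∂(Measure.infinitePi fun _ : ℕ => μ)
      = ∫ x, f x ∂(Measure.map (Function.eval n) (Measure.infinitePi fun _ : ℕ => μ)) :=
        (integral_map hmp.measurable.aemeasurable
          (by rw [hmp.map_eq]; exact hf.aestronglyMeasurable)).symm
    _ = ∫ x, f x ∂μ := by rw [hmp.map_eq]

variable {C} in
theorem integrable_fourierState_mul (hC : ∀ ω, C ω ∈ Matrix.unitaryGroup (CoinIdx d) ℂ)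
    (hm : ∀ σ τ, Measurable fun ω => C ω σ τ) (n : ℕ) (a b : Fin d → ℂ) (τ τ' : CoinIdx d) :
    Integrable (fun ω : ℕ → Ω => fourierState r φ₀ (fun s => C (ω s)) a n τ *
      star (fourierState r φ₀ (fun s => C (ω s)) b n τ')) (Measure.infinitePi fun _ : ℕ => μ) := by
  obtain ⟨F, hF⟩ := exists_finset_prob_eq_zero r φ₀ n
  simp only [fun (ω : ℕ → Ω) (a : Fin d → ℂ) =>
    fourierState_eq_sum r φ₀ (fun s => C (ω s)) a n F (hF _), star_sum,
    Finset.sum_mul_sum, star_mul]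
  refine integrable_finsetSum _ fun k _ => integrable_finsetSum _ fun k' _ => ?_
  refine ((integrable_amplitude_mul μ r φ₀ hC hm n k k' τ τ').const_mul
    (character a k * star (character b k'))).congr (ae_of_all _ fun ω => ?_)
  simp only
  ring

theorem phase_eq_character (v : Fin d → ℝ) (τ τ' : CoinIdx d) :
    phase r (-v) v (τ, τ') (τ, τ') = character (-fun j => (v j : ℂ)) (r τ) *
      star (character (-fun j => (v j : ℂ)) (r τ')) := by
  rw [phase, Matrix.diagonal_apply_eq, character, character, Complex.star_def, ← Complex.exp_conj,
    ← Complex.exp_add]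
  congr 1
  simp only [map_mul, Complex.conj_I, map_sum, Pi.neg_apply, map_neg, Complex.conj_ofReal,
    map_intCast]
  push_cast
  rw [neg_mul, ← mul_neg, ← Finset.sum_neg_distrib, ← mul_add, ← Finset.sum_add_distrib]
  congr 1
  exact Finset.sum_congr rfl fun j _ => by ring

variable {C} in
-- Step `n + 1` uses the coin of index `n`, while the states after `n` steps depend on the coins of
-- index below `n`; the expectation factors and the new coin enters only through `𝔼 (C ⊗ C̄)`. The
-- complex `y` sits in the left factor only, so the conjugated factor keeps a real momentum.
theorem avgFourier_succ (hC : ∀ ω, C ω ∈ Matrix.unitaryGroup (CoinIdx d) ℂ)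
    (hm : ∀ σ τ, Measurable fun ω => C ω σ τ) (y : Fin d → ℂ) (v : Fin d → ℝ) (n : ℕ) :
    avgFourier μ r φ₀ C y v (n + 1)
      = (leftPhase r y * avgMatrix μ r C (-v) v) *ᵥ avgFourier μ r φ₀ C y v n := by
  ext ⟨τ, τ'⟩
  set a : Fin d → ℂ := y - fun j => (v j : ℂ) with ha
  set b : Fin d → ℂ := -fun j => (v j : ℂ) with hb
  have hab : a = y + b := by rw [ha, hb, sub_eq_add_neg]
  set ψ : (Fin d → ℂ) → (ℕ → Ω) → CoinIdx d → ℂ := fun a ω =>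
    fourierState r φ₀ (fun s => C (ω s)) a n with hψ
  have hint : ∀ σ σ', Integrable (fun ω : ℕ → Ω => (C (ω n) τ σ * star (C (ω n) τ' σ')) *
      (ψ a ω σ * star (ψ b ω σ'))) (Measure.infinitePi fun _ : ℕ => μ) := fun σ σ' => by
    refine (integrable_fourierState_mul μ r φ₀ hC hm n a b σ σ').bdd_mul (c := 1)
      (f := fun ω : ℕ → Ω => C (ω n) τ σ * star (C (ω n) τ' σ')) ?_ (ae_of_all _ fun ω => ?_)
    · exact (((hm τ σ).mul (continuous_star.measurable.comp (hm τ' σ'))).comp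
        (measurable_pi_apply n)).aestronglyMeasurable
    · refine (norm_mul_le_of_le (norm_coin_apply_le hC (ω n) τ σ) ?_).trans_eq (mul_one 1)
      rw [norm_star]
      exact norm_coin_apply_le hC (ω n) τ' σ'
  have hpast : ∀ σ σ', Measurable[⨆ i ∈ Set.Iio n,
      MeasurableSpace.comap (fun ω : ℕ → Ω => ω i) inferInstance]
      fun ω => ψ a ω σ * star (ψ b ω σ') := fun σ σ' => by
    have hcoin : ∀ i < n, ∀ σ τ, Measurable[⨆ i ∈ Set.Iio n,
        MeasurableSpace.comap (fun ω : ℕ → Ω => ω i) inferInstance] fun ω : ℕ → Ω => C (ω i) σ τ :=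
      fun i hi σ τ => (hm σ τ).comp
        (Measurable.mono (comap_measurable _) (le_iSup₂_of_le i hi le_rfl) le_rfl)
    exact (measurable_fourierState r φ₀ _ n hcoin a σ).mul (continuous_star.measurable.comp
      (measurable_fourierState r φ₀ _ n hcoin b σ'))
  have hstep : ∀ ω : ℕ → Ω, fourierState r φ₀ (fun s => C (ω s)) a (n + 1) τ *
      star (fourierState r φ₀ (fun s => C (ω s)) b (n + 1) τ')
      = character y (r τ) * phase r (-v) v (τ, τ') (τ, τ') *
        ∑ σ, ∑ σ', (C (ω n) τ σ * star (C (ω n) τ' σ')) * (ψ a ω σ * star (ψ b ω σ')) :=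
    fun ω => by
    have h0 : character a (r τ) = character y (r τ) * character b (r τ) := by
      rw [hab, character_add_left]
    rw [phase_eq_character, fourierState_succ, fourierState_succ, star_mul, star_sum, h0, ← hb]
    have h1 : ∑ σ, ∑ σ', (C (ω n) τ σ * star (C (ω n) τ' σ')) * (ψ a ω σ * star (ψ b ω σ'))
        = (∑ σ, C (ω n) τ σ * ψ a ω σ) * ∑ σ', star (C (ω n) τ' σ' * ψ b ω σ') := by
      rw [Finset.sum_mul_sum]
      refine Finset.sum_congr rfl fun σ _ => Finset.sum_congr rfl fun σ' _ => ?_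
      rw [star_mul]
      ring
    rw [h1]
    ring
  rw [avgFourier, ← ha, ← hb]
  simp only [hstep]
  rw [integral_const_mul, integral_finsetSum _ fun σ _ => integrable_finsetSum _ fun σ' _ =>
    hint σ σ', ← Matrix.mulVec_mulVec, leftPhase, Matrix.mulVec_diagonal, avgMatrix, phase,
    ← Matrix.mulVec_mulVec, Matrix.mulVec_diagonal, Matrix.diagonal_apply_eq, mul_assoc]
  congr 2
  simp only [Matrix.mulVec, dotProduct]
  conv_rhs => rw [Fintype.sum_prod_type]
  refine Finset.sum_congr rfl fun σ _ => ?_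
  rw [integral_finsetSum _ fun σ' _ => hint σ σ']
  refine Finset.sum_congr rfl fun σ' _ => ?_
  rw [avgCoin_apply, avgFourier, ← ha, ← hb]
  exact integral_mul_of_past μ (f := fun ω => C ω τ σ * star (C ω τ' σ'))
    ((hm τ σ).mul (continuous_star.measurable.comp (hm τ' σ'))) n (hpast σ σ')

variable {C} in
theorem avgFourier_eq_pow (hC : ∀ ω, C ω ∈ Matrix.unitaryGroup (CoinIdx d) ℂ)
    (hm : ∀ σ τ, Measurable fun ω => C ω σ τ) (y : Fin d → ℂ) (v : Fin d → ℝ) (n : ℕ) :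
    avgFourier μ r φ₀ C y v n
      = ((leftPhase r y * avgMatrix μ r C (-v) v) ^ n) *ᵥ fun S => φ₀ S.1 * star (φ₀ S.2) := by
  induction n with
  | zero =>
    ext S
    simp [avgFourier, fourierState]
  | succ n ih => rw [avgFourier_succ μ r φ₀ hC hm, ih, Matrix.mulVec_mulVec, pow_succ']

end Average

/-! ### Integration over the torus -/

section Torus

theorem torus_subset_Icc : torus d ⊆ Set.Icc (0 : Fin d → ℝ) fun _ => 2 * Real.pi :=
  fun _ hv => ⟨fun j => (hv j trivial).1, fun j => (hv j trivial).2.le⟩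

theorem volume_torus : volume.real (torus d) = (2 * Real.pi) ^ d := by
  rw [Measure.real, torus, Real.volume_pi_Ico, ENNReal.toReal_prod]
  simp [Real.pi_pos.le]

theorem volume_torus_lt_top : volume (torus d) < ⊤ :=
  (measure_mono torus_subset_Icc).trans_lt isCompact_Icc.measure_lt_top

theorem integrableOn_torus {f : (Fin d → ℝ) → ℂ} (hf : Continuous f) :
    IntegrableOn f (torus d) :=
  (hf.continuousOn.integrableOn_compact isCompact_Icc).mono_set torus_subset_Icc

theorem torusInt_const (c : ℂ) : torusInt (fun _ : Fin d → ℝ => c) = c := by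
  have h : (((2 * Real.pi) ^ d : ℝ) : ℂ) ≠ 0 := by
    exact_mod_cast (pow_pos Real.two_pi_pos d).ne'
  rw [torusInt, setIntegral_const, volume_torus, Complex.real_smul, inv_mul_cancel_left₀ h]

theorem torusInt_sub {f g : (Fin d → ℝ) → ℂ} (hf : Continuous f) (hg : Continuous g) :
    torusInt (fun v => f v - g v) = torusInt f - torusInt g := by
  rw [torusInt, integral_sub (integrableOn_torus hf) (integrableOn_torus hg), mul_sub]
  rfl

theorem torusInt_const_mul (c : ℂ) (f : (Fin d → ℝ) → ℂ) :
    torusInt (fun v => c * f v) = c * torusInt f := by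
  rw [torusInt, integral_const_mul, torusInt]
  ring

theorem torusInt_finset_sum {ι : Type*} (s : Finset ι) {f : ι → (Fin d → ℝ) → ℂ}
    (hf : ∀ i ∈ s, Continuous (f i)) :
    torusInt (fun v => ∑ i ∈ s, f i v) = ∑ i ∈ s, torusInt (f i) := by
  rw [torusInt, integral_finsetSum _ fun i hi => integrableOn_torus (hf i hi), Finset.mul_sum]
  rfl

theorem norm_torusInt_le {f : (Fin d → ℝ) → ℂ} {K : ℝ} (hf : ∀ v, ‖f v‖ ≤ K) :
    ‖torusInt f‖ ≤ K := by
  have h := norm_setIntegral_le_of_norm_le_const volume_torus_lt_top fun v (_ : v ∈ torus d) => hf v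
  have hpos : 0 < (2 * Real.pi) ^ d := pow_pos Real.two_pi_pos d
  rw [torusInt, norm_mul, norm_inv, Complex.norm_real, Real.norm_of_nonneg hpos.le]
  rw [volume_torus] at h
  rw [inv_mul_le_iff₀ hpos, mul_comm]
  exact h

theorem integral_exp_int_mul (m : ℤ) :
    ∫ x in Set.Ico (0 : ℝ) (2 * Real.pi), Complex.exp (Complex.I * ((m : ℂ) * x))
      = if m = 0 then 2 * Real.pi else 0 := by
  rw [integral_Ico_eq_integral_Ioc, ← intervalIntegral.integral_of_le Real.two_pi_pos.le]
  split_ifs with hm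
  · simp [hm]
  · have hc : Complex.I * (m : ℂ) ≠ 0 := mul_ne_zero Complex.I_ne_zero (by exact_mod_cast hm)
    simp_rw [← mul_assoc]
    rw [integral_exp_mul_complex hc]
    have h : Complex.exp (Complex.I * m * ((2 * Real.pi : ℝ) : ℂ)) = 1 := by
      rw [Complex.exp_eq_one_iff]
      exact ⟨m, by push_cast; ring⟩
    rw [h]
    simp

/-- Fubini reduces orthogonality of characters to the one-dimensional integrals of
`integral_exp_int_mul`. -/
theorem torusInt_character_mul_star (k k' : Fin d → ℤ) :
    torusInt (fun v => character (-fun j => (v j : ℂ)) k * star (character (-fun j => (v j : ℂ)) k'))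
      = if k = k' then 1 else 0 := by
  have h1 : ∀ v : Fin d → ℝ,
      character (-fun j => (v j : ℂ)) k * star (character (-fun j => (v j : ℂ)) k')
      = ∏ j, Complex.exp (Complex.I * (((k' j - k j : ℤ) : ℂ) * v j)) := fun v => by
    rw [character, character, Complex.star_def, ← Complex.exp_conj, ← Complex.exp_add,
      ← Complex.exp_sum, ← Finset.mul_sum]
    congr 1
    simp only [map_mul, Complex.conj_I, map_sum, Pi.neg_apply, map_neg, Complex.conj_ofReal,
      map_intCast]
    rw [neg_mul, ← mul_neg, ← Finset.sum_neg_distrib, ← mul_add, ← Finset.sum_add_distrib]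
    congr 1
    exact Finset.sum_congr rfl fun j _ => by push_cast; ring
  simp only [torusInt, h1]
  rw [torus, volume_pi, Measure.restrict_pi_pi, integral_fintype_prod_eq_prod
    (f := fun j (x : ℝ) => Complex.exp (Complex.I * (((k' j - k j : ℤ) : ℂ) * x)))]
  simp_rw [integral_exp_int_mul]
  split_ifs with hk
  · subst hk
    simp only [sub_self, if_true, Finset.prod_const, Finset.card_univ, Fintype.card_fin]
    push_cast
    exact inv_mul_cancel₀ (pow_ne_zero _ (mul_ne_zero two_ne_zero
      (by exact_mod_cast Real.pi_ne_zero)))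
  · obtain ⟨j, hj⟩ := Function.ne_iff.1 hk
    rw [Finset.prod_eq_zero (Finset.mem_univ j), mul_zero]
    rw [if_neg (fun h => hj (sub_eq_zero.1 h).symm), Complex.ofReal_zero]

end Torus

/-! ### The characteristic function as a torus average of matrix powers -/

section CharFn

theorem continuous_avgMatrix {Ω : Type*} [MeasurableSpace Ω] (μ : Measure Ω)
    (r : CoinIdx d → Fin d → ℤ) (C : Ω → Matrix (CoinIdx d) (CoinIdx d) ℂ) :
    Continuous fun v : Fin d → ℝ => avgMatrix μ r C (-v) v := by
  have h : (fun v : Fin d → ℝ => avgMatrix μ r C (-v) v)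
      = fun v => restMatrix μ r C v + projPsi d := by
    ext1 v; rw [restMatrix, sub_add_cancel]
  rw [h]
  exact (continuous_restMatrix μ r C).add continuous_const

variable {Ω : Type*} [MeasurableSpace Ω] (μ : Measure Ω) [IsProbabilityMeasure μ]
    (r : CoinIdx d → Fin d → ℤ) (φ₀ : CoinSpace d) {C : Ω → Matrix (CoinIdx d) (CoinIdx d) ℂ}

theorem avgProb_eq_sum (hC : ∀ ω, C ω ∈ Matrix.unitaryGroup (CoinIdx d) ℂ)
    (hm : ∀ σ τ, Measurable fun ω => C ω σ τ) (n : ℕ) (k : Fin d → ℤ) :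
    (avgProb μ r C φ₀ n k : ℂ) = ∑ τ, ∫ ω : ℕ → Ω, amplitude r φ₀ (fun s => C (ω s)) n k τ *
      star (amplitude r φ₀ (fun s => C (ω s)) n k τ) ∂(Measure.infinitePi fun _ : ℕ => μ) := by
  rw [avgProb, ← integral_complex_ofReal, ← integral_finsetSum _ fun τ _ =>
    integrable_amplitude_mul μ r φ₀ hC hm n k k τ τ]
  congr 1
  ext ω
  rw [prob_eq_sum_amplitude]
  push_cast
  refine Finset.sum_congr rfl fun τ _ => ?_
  rw [Complex.star_def, Complex.mul_conj']

theorem avgProb_eq_zero {n : ℕ} {k : Fin d → ℤ}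
    (h : ∀ C : ℕ → Matrix (CoinIdx d) (CoinIdx d) ℂ, prob r C φ₀ n k = 0) :
    avgProb μ r C φ₀ n k = 0 := by
  simp [avgProb, h]

theorem charFn_eq_sum {n : ℕ} {F : Finset (Fin d → ℤ)}
    (hF : ∀ C : ℕ → Matrix (CoinIdx d) (CoinIdx d) ℂ, ∀ k ∉ F, prob r C φ₀ n k = 0)
    (y : Fin d → ℂ) : charFn μ r C φ₀ n y
      = ∑ k ∈ F, (avgProb μ r C φ₀ n k : ℂ) * character y k :=
  tsum_eq_sum fun k hk => by rw [avgProb_eq_zero μ r φ₀ fun C => hF C k hk]; simp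

theorem continuous_character_neg (k : Fin d → ℤ) :
    Continuous fun v : Fin d → ℝ => character (-fun j => (v j : ℂ)) k := by
  simp only [character, Pi.neg_apply]
  fun_prop

/-- The product of the two Fourier sums is a double sum over sites `k`, `k'`; integrating over `v`
keeps the diagonal `k = k'`, which carries the weight `e^{i y·k}`. -/
theorem charFn_eq_torusInt (hC : ∀ ω, C ω ∈ Matrix.unitaryGroup (CoinIdx d) ℂ)
    (hm : ∀ σ τ, Measurable fun ω => C ω σ τ) (n : ℕ) (y : Fin d → ℂ) :
    charFn μ r C φ₀ n y = torusInt fun v => ∑ τ, avgFourier μ r φ₀ C y v n (τ, τ) := by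
  obtain ⟨F, hF⟩ := exists_finset_prob_eq_zero r φ₀ n
  rw [charFn_eq_sum μ r φ₀ hF]
  have h1 : ∀ v τ, avgFourier μ r φ₀ C y v n (τ, τ) = ∑ k ∈ F, ∑ k' ∈ F,
      (character y k * ∫ ω : ℕ → Ω, amplitude r φ₀ (fun s => C (ω s)) n k τ *
          star (amplitude r φ₀ (fun s => C (ω s)) n k' τ) ∂(Measure.infinitePi fun _ : ℕ => μ)) *
      (character (-fun j => (v j : ℂ)) k * star (character (-fun j => (v j : ℂ)) k')) :=
    fun v τ => by
    rw [avgFourier_eq_sum μ r φ₀ hC hm n F hF]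
    refine Finset.sum_congr rfl fun k _ => Finset.sum_congr rfl fun k' _ => ?_
    rw [sub_eq_add_neg, character_add_left]
    ring
  simp only [h1]
  have hcont : ∀ (c : ℂ) (k k' : Fin d → ℤ), Continuous fun v : Fin d → ℝ =>
      c * (character (-fun j => (v j : ℂ)) k * star (character (-fun j => (v j : ℂ)) k')) :=
    fun c k k' => continuous_const.mul ((continuous_character_neg k).mul
      (continuous_star.comp (continuous_character_neg k')))
  rw [torusInt_finset_sum _ fun τ _ => continuous_finsetSum _ fun k _ =>
    continuous_finsetSum _ fun k' _ => hcont _ k k']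
  simp_rw [avgProb_eq_sum μ r φ₀ hC hm, Finset.sum_mul]
  rw [Finset.sum_comm]
  refine Finset.sum_congr rfl fun τ _ => ?_
  rw [torusInt_finset_sum _ fun k _ => continuous_finsetSum _ fun k' _ => hcont _ k k']
  refine Finset.sum_congr rfl fun k hk => ?_
  rw [torusInt_finset_sum _ fun k' _ => hcont _ k k']
  simp_rw [torusInt_const_mul, torusInt_character_mul_star]
  simp [hk, mul_comm]

theorem centeredPhase_eq_smul (z : Fin d → ℂ) :
    centeredPhase r z
      = Complex.exp (-(Complex.I * ∑ j, z j * (meanJump r j : ℂ))) • leftPhase r z := by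
  rw [centeredPhase, leftPhase, ← Matrix.diagonal_smul]
  congr 1
  ext S
  rw [Pi.smul_apply, smul_eq_mul, character, ← Complex.exp_add, centeredExponent_eq]
  ring_nf

/-- The linear form `X ↦ ∑_τ ⟨τ ⊗ τ, X (φ₀ ⊗ conj φ₀)⟩`. -/
noncomputable def traceForm :
    Matrix (CoinIdx d × CoinIdx d) (CoinIdx d × CoinIdx d) ℂ →ₗ[ℂ] ℂ where
  toFun X := ∑ τ, (X *ᵥ fun S => φ₀ S.1 * star (φ₀ S.2)) (τ, τ)
  map_add' X Y := by simp [Matrix.add_mulVec, Finset.sum_add_distrib]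
  map_smul' c X := by simp [Matrix.smul_mulVec, Finset.mul_sum]

/-- Summing over `τ ⊗ τ` is pairing with a multiple of `Ψ₀`, and `P` is the orthogonal projection on
`Ψ₀`. This inserts the factor `P` that the perturbation estimate needs. -/
theorem traceForm_projPsi_mul (hd : d ≠ 0)
    (X : Matrix (CoinIdx d × CoinIdx d) (CoinIdx d × CoinIdx d) ℂ) :
    traceForm φ₀ (projPsi d * X) = traceForm φ₀ X := by
  have hd' : (d : ℂ) ≠ 0 := by exact_mod_cast hd
  simp only [traceForm, LinearMap.coe_mk, AddHom.coe_mk, Matrix.mulVec, dotProduct]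
  rw [Finset.sum_comm, Finset.sum_comm (f := fun τ S => X (τ, τ) S * _)]
  refine Finset.sum_congr rfl fun S _ => ?_
  simp_rw [projPsi_mul_apply, if_true, ← Finset.sum_mul]
  rw [Finset.sum_const, Finset.card_univ, card_coinIdx, nsmul_eq_mul]
  push_cast
  field_simp

theorem traceForm_one (hφ₀ : ‖φ₀‖ = 1) : traceForm φ₀ 1 = 1 := by
  have h : ((‖φ₀‖ ^ 2 : ℝ) : ℂ) = 1 := by rw [hφ₀]; simp
  rw [EuclideanSpace.norm_sq_eq] at h
  push_cast at h
  simp only [traceForm, LinearMap.coe_mk, AddHom.coe_mk, Matrix.one_mulVec]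
  rw [← h]
  refine Finset.sum_congr rfl fun τ _ => ?_
  rw [Complex.star_def, Complex.mul_conj']

theorem exp_mul_charFn_eq_torusInt (hC : ∀ ω, C ω ∈ Matrix.unitaryGroup (CoinIdx d) ℂ)
    (hm : ∀ σ τ, Measurable fun ω => C ω σ τ) (n : ℕ) (z : Fin d → ℂ) :
    Complex.exp (-(Complex.I * n * ∑ j, z j * (meanJump r j : ℂ))) * charFn μ r C φ₀ n z
      = torusInt fun v => traceForm φ₀ ((centeredPhase r z * avgMatrix μ r C (-v) v) ^ n) := by
  rw [charFn_eq_torusInt μ r φ₀ hC hm, ← torusInt_const_mul]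
  congr 1
  ext v
  rw [centeredPhase_eq_smul, smul_mul_assoc, smul_pow, map_smul, smul_eq_mul, ← Complex.exp_nat_mul]
  congr 1
  · ring_nf
  · simp only [avgFourier_eq_pow μ r φ₀ hC hm]
    rfl

theorem continuous_quadForm_diffusionMatrix
    (hC : ∀ ω, C ω ∈ Matrix.unitaryGroup (CoinIdx d) ℂ)
    (hm : ∀ σ τ, Measurable fun ω => C ω σ τ) (hd : d ≠ 0) (hS : AssumptionS μ r C)
    (z : Fin d → ℂ) : Continuous fun v => quadForm (diffusionMatrix μ r C v) z := by
  simp only [quadForm, dotProduct, Matrix.mulVec]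
  exact continuous_finsetSum _ fun i _ => continuous_const.mul (continuous_finsetSum _ fun j _ =>
    (continuous_diffusionMatrix μ r hC hm hd hS i j).mul continuous_const)

open scoped Matrix.Norms.L2Operator in
/-- Near `y = 0` the compensated characteristic function is the average over the torus of
Gaussian characteristic functions. -/
theorem exists_norm_exp_mul_charFn_sub_le (hC : ∀ ω, C ω ∈ Matrix.unitaryGroup (CoinIdx d) ℂ)
    (hm : ∀ σ τ, Measurable fun ω => C ω σ τ) (hd : d ≠ 0) (hS : AssumptionS μ r C)
    (hφ₀ : ‖φ₀‖ = 1) :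
    ∃ δ > 0, ∀ T : ℝ, 0 ≤ T → ∃ K : ℝ, 0 ≤ K ∧ ∀ (z : Fin d → ℂ) (m : ℕ),
      ‖z‖ ≤ δ → m * ‖z‖ ^ 2 ≤ T →
      ‖Complex.exp (-(Complex.I * m * ∑ j, z j * (meanJump r j : ℂ))) * charFn μ r C φ₀ m z
        - torusInt fun v => Complex.exp (-(m / 2) * quadForm (diffusionMatrix μ r C v) z)‖
        ≤ K * ‖z‖ := by
  obtain ⟨δ, hδ, H⟩ := exists_norm_projPsi_mul_pow_sub_le μ r hC hm hd hS
  refine ⟨δ, hδ, fun T hT => ?_⟩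
  obtain ⟨K, hK, H⟩ := H T hT
  set L := LinearMap.toContinuousLinearMap (traceForm φ₀) with hL
  have hLX : ∀ X, L X = traceForm φ₀ X := fun X => rfl
  refine ⟨‖L‖ * K, by positivity, fun z m hz hmz => ?_⟩
  rw [exp_mul_charFn_eq_torusInt μ r φ₀ hC hm, ← torusInt_sub]
  · refine norm_torusInt_le fun v => ?_
    have h1 : traceForm φ₀ ((centeredPhase r z * avgMatrix μ r C (-v) v) ^ m)
        - Complex.exp (-(m / 2) * quadForm (diffusionMatrix μ r C v) z)
        = L (projPsi d * (centeredPhase r z * avgMatrix μ r C (-v) v) ^ m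
          - Complex.exp (-(m / 2) * quadForm (diffusionMatrix μ r C v) z) • projPsi d) := by
      have h2 : traceForm φ₀ (projPsi d) = 1 := by
        have h := traceForm_projPsi_mul φ₀ hd 1
        rwa [mul_one, traceForm_one φ₀ hφ₀] at h
      rw [hLX, map_sub, map_smul, traceForm_projPsi_mul φ₀ hd, h2, smul_eq_mul, mul_one]
    rw [h1, mul_assoc]
    exact (L.le_opNorm _).trans (mul_le_mul_of_nonneg_left (H v z m hz hmz) (norm_nonneg _))
  · exact L.continuous.comp ((continuous_const.matrix_mul (continuous_avgMatrix μ r C)).pow m)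
  · exact Complex.continuous_exp.comp (continuous_const.mul
      (continuous_quadForm_diffusionMatrix μ r hC hm hd hS z))

end CharFn

/-! ### Mixed derivatives of entire functions and their limits -/

section MixedDerivatives

variable {V : Type*} [NormedAddCommGroup V] [NormedSpace ℂ V]

/-- The partial derivative `∂g/∂y_j` of a function with values in a normed space. -/
noncomputable def vecPartialDeriv (j : Fin d) (g : (Fin d → ℂ) → V) : (Fin d → ℂ) → V :=
  fun y => fderiv ℂ g y (Pi.single j 1)

/-- The mixed partial derivative of a function with values in a normed space. -/
noncomputable def vecMixedDeriv (s : Fin d → ℕ) (g : (Fin d → ℂ) → V) : (Fin d → ℂ) → V :=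
  (List.finRange d).foldr (fun j h => (vecPartialDeriv j)^[s j] h) g

/-- Reduces every statement on mixed derivatives to a single partial derivative: a relation
preserved by each operator is preserved by their iterated composition. -/
theorem foldr_iterate_rel {α β ι : Type*} (A : ι → α → α) (B : ι → β → β) (P : α → β → Prop)
    (h : ∀ j a b, P a b → P (A j a) (B j b)) (s : ι → ℕ) (l : List ι) {a : α} {b : β}
    (hab : P a b) :
    P (l.foldr (fun j x => (A j)^[s j] x) a) (l.foldr (fun j x => (B j)^[s j] x) b) := by
  have hit : ∀ j n a b, P a b → P ((A j)^[n] a) ((B j)^[n] b) := by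
    intro j n
    induction n with
    | zero => exact fun a b hab => hab
    | succ n ih => exact fun a b hab => ih _ _ (h j a b hab)
  induction l with
  | nil => exact hab
  | cons j l ih => exact hit j (s j) _ _ ih

/-- The exponent `⊤` is the analytic one, so `ContDiff ℂ ⊤` says entire, and it is stable under
derivatives without loss. -/
theorem contDiff_vecPartialDeriv {g : (Fin d → ℂ) → V} (hg : ContDiff ℂ ⊤ g) (j : Fin d) :
    ContDiff ℂ ⊤ (vecPartialDeriv j g) :=
  (hg.fderiv_right (m := ⊤) le_top).clm_apply contDiff_const

theorem contDiff_top_differentiable {g : (Fin d → ℂ) → V} (hg : ContDiff ℂ ⊤ g) :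
    Differentiable ℂ g :=
  hg.differentiable (by simp)

theorem vecPartialDeriv_clm_comp {V' : Type*} [NormedAddCommGroup V'] [NormedSpace ℂ V']
    (L : V →L[ℂ] V') {g : (Fin d → ℂ) → V} (hg : ContDiff ℂ ⊤ g) (j : Fin d) :
    vecPartialDeriv j (fun y => L (g y)) = fun y => L (vecPartialDeriv j g y) := by
  ext y
  have := (L.hasFDerivAt.comp y (contDiff_top_differentiable hg y).hasFDerivAt).fderiv
  exact congrArg (fun T : (Fin d → ℂ) →L[ℂ] V' => T (Pi.single j 1)) this

theorem vecMixedDeriv_clm_comp {V' : Type*} [NormedAddCommGroup V'] [NormedSpace ℂ V']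
    (L : V →L[ℂ] V') {g : (Fin d → ℂ) → V} (hg : ContDiff ℂ ⊤ g) (s : Fin d → ℕ)
    (y : Fin d → ℂ) : vecMixedDeriv s (fun y => L (g y)) y = L (vecMixedDeriv s g y) := by
  have h := foldr_iterate_rel (vecPartialDeriv (V := V') (d := d)) (vecPartialDeriv (V := V))
    (fun g' g => ContDiff ℂ ⊤ g ∧ g' = fun y => L (g y)) ?_ s (List.finRange d)
    (a := fun y => L (g y)) (b := g) ⟨hg, rfl⟩
  · exact congrFun h.2 y
  · rintro j g' g ⟨hg, rfl⟩
    exact ⟨contDiff_vecPartialDeriv hg j, vecPartialDeriv_clm_comp L hg j⟩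

theorem hasDerivAt_line {g : (Fin d → ℂ) → V} (hg : ContDiff ℂ ⊤ g) (j : Fin d)
    (y : Fin d → ℂ) (w : ℂ) :
    HasDerivAt (fun w : ℂ => g (y + w • Pi.single j 1))
      (vecPartialDeriv j g (y + w • Pi.single j 1)) w := by
  have hline : HasDerivAt (fun w : ℂ => y + w • (Pi.single j 1 : Fin d → ℂ))
      (Pi.single j 1) w := by
    simpa using ((hasDerivAt_id w).smul_const (Pi.single j 1 : Fin d → ℂ)).const_add y
  exact (contDiff_top_differentiable hg _).hasFDerivAt.comp_hasDerivAt w hline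

/-- Cauchy's estimate on the unit circle in the complex line through `y` in direction `j`. -/
theorem norm_vecPartialDeriv_le {g : (Fin d → ℂ) → V} (hg : ContDiff ℂ ⊤ g) (j : Fin d)
    (y : Fin d → ℂ) {K : ℝ} (h : ∀ w : ℂ, ‖w‖ = 1 → ‖g (y + w • Pi.single j 1)‖ ≤ K) :
    ‖vecPartialDeriv j g y‖ ≤ K := by
  have h1 := hasDerivAt_line hg j y
  have h2 : deriv (fun w : ℂ => g (y + w • Pi.single j 1)) 0 = vecPartialDeriv j g y := by
    rw [(h1 0).deriv, zero_smul, add_zero]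
  have h3 : Differentiable ℂ fun w : ℂ => g (y + w • Pi.single j 1) :=
    fun w => (h1 w).differentiableAt
  rw [← h2, ← div_one K]
  exact Complex.norm_deriv_le_of_forall_mem_sphere_norm_le one_pos h3.diffContOnCl
    fun w hw => h w (by simpa using hw)

theorem vecPartialDeriv_sub {g h : (Fin d → ℂ) → V} (hg : ContDiff ℂ ⊤ g) (hh : ContDiff ℂ ⊤ h)
    (j : Fin d) (y : Fin d → ℂ) :
    vecPartialDeriv j (fun y => g y - h y) y = vecPartialDeriv j g y - vecPartialDeriv j h y := by
  rw [vecPartialDeriv, fderiv_fun_sub (contDiff_top_differentiable hg y)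
    (contDiff_top_differentiable hh y)]
  rfl

/-- Locally uniform convergence of entire functions, together with analyticity. -/
def EntireTendsto (G : ℕ → (Fin d → ℂ) → ℂ) (g : (Fin d → ℂ) → ℂ) : Prop :=
  (∀ n, ContDiff ℂ ⊤ (G n)) ∧ ContDiff ℂ ⊤ g ∧
    ∀ K : Set (Fin d → ℂ), IsCompact K → TendstoUniformlyOn G g atTop K

theorem EntireTendsto.partialDeriv {G : ℕ → (Fin d → ℂ) → ℂ} {g : (Fin d → ℂ) → ℂ}
    (h : EntireTendsto G g) (j : Fin d) :
    EntireTendsto (fun n => partialDeriv j (G n)) (partialDeriv j g) := by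
  obtain ⟨hG, hg, hGg⟩ := h
  refine ⟨fun n => contDiff_vecPartialDeriv (hG n) j, contDiff_vecPartialDeriv hg j,
    fun K hK => ?_⟩
  -- `K` is thickened by the unit disc in direction `j`, so that it contains the circles used in
  -- Cauchy's estimate.
  have hK' : IsCompact ((fun p : ℂ × (Fin d → ℂ) => p.2 + p.1 • (Pi.single j 1 : Fin d → ℂ)) ''
      (Metric.closedBall 0 1 ×ˢ K)) :=
    ((isCompact_closedBall 0 1).prod hK).image (by fun_prop)
  rw [Metric.tendstoUniformlyOn_iff]
  intro ε hε
  filter_upwards [Metric.tendstoUniformlyOn_iff.1 (hGg _ hK') (ε / 2) (by positivity)] with n hn y hy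
  rw [dist_eq_norm]
  refine lt_of_le_of_lt ?_ (half_lt_self hε)
  have h1 := vecPartialDeriv_sub hg (hG n) j y
  refine (congrArg norm h1.symm).trans_le
    (norm_vecPartialDeriv_le (hg.sub (hG n)) j y fun w hw => ?_)
  rw [← dist_eq_norm]
  exact (hn _ ⟨(w, y), ⟨by simp [hw], hy⟩, rfl⟩).le

theorem EntireTendsto.tendsto {G : ℕ → (Fin d → ℂ) → ℂ} {g : (Fin d → ℂ) → ℂ}
    (h : EntireTendsto G g) (y : Fin d → ℂ) : Tendsto (fun n => G n y) atTop (𝓝 (g y)) :=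
  (h.2.2 {y} isCompact_singleton).tendsto_at (Set.mem_singleton y)

theorem EntireTendsto.tendsto_mixedDeriv {G : ℕ → (Fin d → ℂ) → ℂ} {g : (Fin d → ℂ) → ℂ}
    (h : EntireTendsto G g) (s : Fin d → ℕ) (y : Fin d → ℂ) :
    Tendsto (fun n => mixedDeriv s (G n) y) atTop (𝓝 (mixedDeriv s g y)) := by
  have h1 := foldr_iterate_rel
    (fun (j : Fin d) (p : (ℕ → (Fin d → ℂ) → ℂ) × (ℕ → (Fin d → ℂ) → ℂ)) =>
      (fun n => RandomQW.partialDeriv j (p.1 n), fun n => RandomQW.partialDeriv j (p.2 n)))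
    RandomQW.partialDeriv (fun p g => EntireTendsto p.1 g) (fun j p g h => h.partialDeriv j) s
    (List.finRange d) (a := (G, G)) (b := g) h
  -- The derivatives were folded over whole sequences; this identifies the `n`-th term of the
  -- result.
  have h2 : ∀ n, (fun (H : ℕ → (Fin d → ℂ) → ℂ) h => H n = h)
      ((List.finRange d).foldr (fun j x =>
        (fun p : (ℕ → (Fin d → ℂ) → ℂ) × (ℕ → (Fin d → ℂ) → ℂ) =>
          (fun n => RandomQW.partialDeriv j (p.1 n), fun n => RandomQW.partialDeriv j (p.2 n)))^[s j]
          x) (G, G)).1 (mixedDeriv s (G n)) := fun n =>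
    foldr_iterate_rel
      (fun (j : Fin d) (p : (ℕ → (Fin d → ℂ) → ℂ) × (ℕ → (Fin d → ℂ) → ℂ)) =>
        (fun n => RandomQW.partialDeriv j (p.1 n), fun n => RandomQW.partialDeriv j (p.2 n)))
      RandomQW.partialDeriv (fun p h => p.1 n = h)
      (fun j p h hp => by subst hp; rfl) s (List.finRange d) (a := (G, G)) (b := G n) rfl
  refine (h1.tendsto y).congr fun n => ?_
  exact congrFun (h2 n) y

/-- The exponential sum `∑ₖ cₖ exp (aₖ·y)`. -/
noncomputable def expSum {ι : Type*} (F : Finset ι) (a : ι → Fin d → ℂ) (c : ι → ℂ)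
    (y : Fin d → ℂ) : ℂ :=
  ∑ k ∈ F, c k * Complex.exp (∑ j, y j * a k j)

theorem contDiff_expSum {ι : Type*} (F : Finset ι) (a : ι → Fin d → ℂ) (c : ι → ℂ) :
    ContDiff ℂ ⊤ (expSum F a c) := by
  unfold expSum
  fun_prop

theorem partialDeriv_expSum {ι : Type*} (F : Finset ι) (a : ι → Fin d → ℂ) (c : ι → ℂ)
    (j : Fin d) : partialDeriv j (expSum F a c) = expSum F a fun k => c k * a k j := by
  ext y
  have hlin : ∀ k, HasFDerivAt (fun y : Fin d → ℂ => ∑ j, y j * a k j)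
      (∑ j, a k j • ContinuousLinearMap.proj (R := ℂ) (φ := fun _ : Fin d => ℂ) j) y := fun k =>
    HasFDerivAt.fun_sum fun i _ => (hasFDerivAt_apply i y).mul_const (a k i)
  have h : HasFDerivAt (expSum F a c) (∑ k ∈ F, c k • (Complex.exp (∑ j, y j * a k j) •
      ∑ j, a k j • ContinuousLinearMap.proj (R := ℂ) (φ := fun _ : Fin d => ℂ) j)) y :=
    HasFDerivAt.fun_sum fun k _ => ((hlin k).cexp).const_mul (c k)
  rw [partialDeriv, h.fderiv, expSum, sum_apply]
  refine Finset.sum_congr rfl fun k _ => ?_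
  simp [Pi.single_apply]
  ring

theorem mixedDeriv_expSum {ι : Type*} (F : Finset ι) (a : ι → Fin d → ℂ) (c : ι → ℂ)
    (s : Fin d → ℕ) :
    mixedDeriv s (expSum F a c) = expSum F a fun k => c k * ∏ j, a k j ^ s j := by
  have h := foldr_iterate_rel RandomQW.partialDeriv
    (fun (j : Fin d) (c : ι → ℂ) => fun k => c k * a k j)
    (fun g c => g = expSum F a c) (fun j g c hg => by rw [hg, partialDeriv_expSum]) s
    (List.finRange d) (a := expSum F a c) (b := c) rfl
  rw [mixedDeriv, h]
  congr 1
  ext k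
  rw [Fin.prod_univ_def]
  have hit : ∀ j n (c : ι → ℂ), ((fun c : ι → ℂ => fun k => c k * a k j)^[n] c) k
      = c k * a k j ^ n := by
    intro j n
    induction n with
    | zero => simp
    | succ n ih => intro c; rw [Function.iterate_succ_apply, ih, pow_succ']; ring
  induction List.finRange d with
  | nil => simp
  | cons j l ih => rw [List.foldr_cons, hit, ih, List.map_cons, List.prod_cons]; ring

end MixedDerivatives

/-! ### The Gaussian family in the algebra of bounded continuous functions -/

section GaussianAverage

open BoundedContinuousFunction in
-- Evaluation at `v` is a continuous linear map, so it passes through the exponential series.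
theorem exp_boundedContinuousFunction_apply (f : (Fin d → ℝ) →ᵇ ℂ) (v : Fin d → ℝ) :
    NormedSpace.exp f v = Complex.exp (f v) := by
  have h1 := (NormedSpace.exp_series_hasSum_exp' (𝕂 := ℂ) f).mapL
    (BoundedContinuousFunction.evalCLM ℂ v)
  have h2 := NormedSpace.exp_series_hasSum_exp' (𝕂 := ℂ) (f v)
  rw [← Complex.exp_eq_exp_ℂ] at h2
  refine h1.unique ?_
  convert h2 using 1
  ext n
  simp

/-- The continuous linear form `f ↦ ∫ f dṽ` on bounded continuous functions. -/
noncomputable def torusIntCLM : BoundedContinuousFunction (Fin d → ℝ) ℂ →L[ℂ] ℂ :=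
  LinearMap.mkContinuous
    { toFun := fun f => torusInt f
      map_add' := fun f g => by
        have h := torusInt_finset_sum (d := d) Finset.univ (f := ![f, g])
          (fun i _ => by fin_cases i; exacts [f.continuous, g.continuous])
        simp only [Fin.sum_univ_two] at h
        exact h
      map_smul' := fun c f => torusInt_const_mul c f } 1
    fun f => by
      rw [one_mul]
      exact norm_torusInt_le fun v => f.norm_coe_le_norm v

theorem torusIntCLM_apply (f : BoundedContinuousFunction (Fin d → ℝ) ℂ) :
    torusIntCLM f = torusInt f :=
  rfl

variable (D : Fin d → Fin d → BoundedContinuousFunction (Fin d → ℝ) ℂ)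

/-- The family `(t, y) ↦ exp (-t ⟨y, D y⟩ / 2)` with values in the bounded continuous functions. -/
noncomputable def gaussFamily (p : ℂ × (Fin d → ℂ)) : BoundedContinuousFunction (Fin d → ℝ) ℂ :=
  NormedSpace.exp (∑ i, ∑ j, (-(p.1 / 2) * (p.2 i * p.2 j)) • D i j)

theorem gaussFamily_apply (p : ℂ × (Fin d → ℂ)) (v : Fin d → ℝ) :
    gaussFamily D p v
      = Complex.exp (-(p.1 / 2) * quadForm (Matrix.of fun i j => D i j v) p.2) := by
  rw [gaussFamily, exp_boundedContinuousFunction_apply]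
  congr 1
  simp only [BoundedContinuousFunction.coe_sum, Finset.sum_apply, BoundedContinuousFunction.coe_smul,
    quadForm, dotProduct, Matrix.mulVec, Matrix.of_apply, Finset.mul_sum, smul_eq_mul]
  exact Finset.sum_congr rfl fun i _ => Finset.sum_congr rfl fun j _ => by ring

/-- The exponential of a Banach algebra is analytic, and its argument here is polynomial in `(t,
y)`. -/
theorem contDiff_gaussFamily : ContDiff ℂ ⊤ (gaussFamily D) := by
  have h : ContDiff ℂ ⊤ (NormedSpace.exp : BoundedContinuousFunction (Fin d → ℝ) ℂ → _) :=
    contDiff_omega_iff_analyticOnNhd.2 fun x _ => NormedSpace.exp_analytic x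
  unfold gaussFamily
  refine h.comp ?_
  fun_prop

end GaussianAverage

/-! ### Derivatives of Gaussian exponentials -/

section Quadratic

theorem quadForm_smul (A : Matrix (Fin d) (Fin d) ℂ) (c : ℂ) (y : Fin d → ℂ) :
    quadForm A (c • y) = c ^ 2 * quadForm A y := by
  simp only [quadForm, Matrix.mulVec_smul, smul_dotProduct, dotProduct_smul, smul_eq_mul]
  ring

theorem quadForm_add_smul_single (A : Matrix (Fin d) (Fin d) ℂ) (y : Fin d → ℂ) (w : ℂ)
    (j : Fin d) : quadForm A (y + w • Pi.single j 1)
      = quadForm A y + w * ∑ k, (A j k + A k j) * y k + w ^ 2 * A j j := by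
  simp only [quadForm, Matrix.mulVec_add, Matrix.mulVec_smul, add_dotProduct, dotProduct_add,
    smul_dotProduct, dotProduct_smul, single_dotProduct, Matrix.mulVec_single_one, smul_eq_mul,
    Matrix.col_apply]
  simp only [dotProduct, Matrix.mulVec, Matrix.col_apply, add_mul, Finset.sum_add_distrib, one_mul,
    mul_comm (y _) (A _ j)]
  ring

theorem contDiff_exp_quadForm (A : Matrix (Fin d) (Fin d) ℂ) :
    ContDiff ℂ ⊤ fun y : Fin d → ℂ => Complex.exp (-(1 / 2) * quadForm A y) := by
  simp only [quadForm, dotProduct, Matrix.mulVec]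
  fun_prop

theorem partialDeriv_exp_quadForm (A : Matrix (Fin d) (Fin d) ℂ) (j : Fin d) (y : Fin d → ℂ) :
    partialDeriv j (fun y => Complex.exp (-(1 / 2) * quadForm A y)) y
      = -(1 / 2) * (∑ k, (A j k + A k j) * y k) * Complex.exp (-(1 / 2) * quadForm A y) := by
  have h1 := hasDerivAt_line (contDiff_exp_quadForm A) j y 0
  rw [zero_smul, add_zero] at h1
  refine h1.unique ?_
  simp only [quadForm_add_smul_single]
  set c := ∑ k, (A j k + A k j) * y k
  have h2 : HasDerivAt (fun w : ℂ => -(1 / 2) * (quadForm A y + w * c + w ^ 2 * A j j))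
      (-(1 / 2) * c) 0 := by
    have h3 := ((((hasDerivAt_id (0 : ℂ)).mul_const c).const_add (quadForm A y)).add
      (((hasDerivAt_id (0 : ℂ)).pow 2).mul_const (A j j))).const_mul (-(1 / 2))
    exact h3.congr_deriv (by simp)
  exact h2.cexp.congr_deriv (by simp; ring)

theorem partialDeriv_partialDeriv_exp_quadForm (A : Matrix (Fin d) (Fin d) ℂ)
    (hA : ∀ i j, A i j = A j i) (i j : Fin d) :
    partialDeriv i (partialDeriv j fun y => Complex.exp (-(1 / 2) * quadForm A y)) 0 = -A i j := by
  have h1 := hasDerivAt_line (contDiff_vecPartialDeriv (contDiff_exp_quadForm A) j) i 0 0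
  rw [zero_smul, add_zero] at h1
  refine h1.unique ?_
  have h0 : ∀ y, vecPartialDeriv j (fun y => Complex.exp (-(1 / 2) * quadForm A y)) y
      = -(1 / 2) * (∑ k, (A j k + A k j) * y k) * Complex.exp (-(1 / 2) * quadForm A y) :=
    partialDeriv_exp_quadForm A j
  simp only [h0, zero_add, quadForm_smul]
  have h2 : ∀ w : ℂ, ∑ k, (A j k + A k j) * (w • (Pi.single i 1 : Fin d → ℂ)) k
      = w * (2 * A i j) := fun w => by
    simp [Pi.single_apply, hA j i]
    ring
  simp only [h2]
  have h3 : HasDerivAt (fun w : ℂ => -(1 / 2) * (w * (2 * A i j))) (-A i j) 0 := by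
    exact (((hasDerivAt_id (0 : ℂ)).mul_const (2 * A i j)).const_mul (-(1 / 2))).congr_deriv (by ring)
  have h4 : HasDerivAt (fun w : ℂ => -(1 / 2) * (w ^ 2 * quadForm A (Pi.single i 1))) 0 0 := by
    exact ((((hasDerivAt_id (0 : ℂ)).pow 2).mul_const (quadForm A (Pi.single i 1))).const_mul
      (-(1 / 2))).congr_deriv (by simp)
  exact (h3.mul h4.cexp).congr_deriv (by simp)

end Quadratic

/-! ### Scaling limits of the characteristic function -/

section Limits

variable {Ω : Type*} [MeasurableSpace Ω] (μ : Measure Ω) [IsProbabilityMeasure μ]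
    (r : CoinIdx d → Fin d → ℤ) (φ₀ : CoinSpace d) (C : Ω → Matrix (CoinIdx d) (CoinIdx d) ℂ)

/-- The average over the torus of the Gaussian characteristic functions with covariance
`t 𝔻(v)`. -/
noncomputable def gaussAverage (p : ℂ × (Fin d → ℂ)) : ℂ :=
  torusInt fun v => Complex.exp (-(p.1 / 2) * quadForm (diffusionMatrix μ r C v) p.2)

variable {C}

theorem exists_gaussFamily (hC : ∀ ω, C ω ∈ Matrix.unitaryGroup (CoinIdx d) ℂ)
    (hm : ∀ σ τ, Measurable fun ω => C ω σ τ) (hd : d ≠ 0) (hS : AssumptionS μ r C) :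
    ∃ D : Fin d → Fin d → BoundedContinuousFunction (Fin d → ℝ) ℂ, ∀ p v,
      gaussFamily D p v = Complex.exp (-(p.1 / 2) * quadForm (diffusionMatrix μ r C v) p.2) := by
  obtain ⟨K, -, hK⟩ := exists_norm_diffusionMatrix_le μ r hC hm hd hS
  refine ⟨fun i j => BoundedContinuousFunction.ofNormedAddCommGroup
    (fun v => diffusionMatrix μ r C v i j) (continuous_diffusionMatrix μ r hC hm hd hS i j) K
    fun v => hK v i j, fun p v => ?_⟩
  rw [gaussFamily_apply]
  rfl

theorem contDiff_gaussAverage (hC : ∀ ω, C ω ∈ Matrix.unitaryGroup (CoinIdx d) ℂ)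
    (hm : ∀ σ τ, Measurable fun ω => C ω σ τ) (hd : d ≠ 0) (hS : AssumptionS μ r C) :
    ContDiff ℂ ⊤ (gaussAverage μ r C) := by
  obtain ⟨D, hD⟩ := exists_gaussFamily μ r hC hm hd hS
  have h : gaussAverage μ r C = fun p => torusIntCLM (gaussFamily D p) := by
    ext p
    rw [torusIntCLM_apply, gaussAverage]
    congr 1
    ext v
    rw [hD]
  rw [h]
  exact torusIntCLM.contDiff.comp (contDiff_gaussFamily D)

/-- Both integration over the torus and evaluation at `v` are continuous linear forms on the
function-valued family, so both commute with its derivatives; no dominated convergence is needed. -/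
theorem mixedDeriv_gaussAverage (hC : ∀ ω, C ω ∈ Matrix.unitaryGroup (CoinIdx d) ℂ)
    (hm : ∀ σ τ, Measurable fun ω => C ω σ τ) (hd : d ≠ 0) (hS : AssumptionS μ r C)
    (s : Fin d → ℕ) (y : Fin d → ℂ) :
    mixedDeriv s (fun y => gaussAverage μ r C (1, y)) y = torusInt fun v =>
      mixedDeriv s (fun y => Complex.exp (-(1 / 2) * quadForm (diffusionMatrix μ r C v) y)) y := by
  obtain ⟨D, hD⟩ := exists_gaussFamily μ r hC hm hd hS
  have hg : ContDiff ℂ ⊤ fun y : Fin d → ℂ => gaussFamily D (1, y) :=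
    (contDiff_gaussFamily D).comp (contDiff_const.prodMk contDiff_id)
  have h1 : (fun y => gaussAverage μ r C (1, y)) = fun y => torusIntCLM (gaussFamily D (1, y)) := by
    ext y
    rw [torusIntCLM_apply, gaussAverage]
    congr 1
    ext v
    rw [hD]
  rw [h1]
  refine (vecMixedDeriv_clm_comp torusIntCLM hg s y).trans ?_
  rw [torusIntCLM_apply]
  congr 1
  ext v
  have h2 := vecMixedDeriv_clm_comp (BoundedContinuousFunction.evalCLM ℂ v) hg s y
  simp only [BoundedContinuousFunction.evalCLM_apply, hD] at h2
  exact h2.symm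

theorem partialDeriv_partialDeriv_gaussAverage
    (hC : ∀ ω, C ω ∈ Matrix.unitaryGroup (CoinIdx d) ℂ)
    (hm : ∀ σ τ, Measurable fun ω => C ω σ τ) (hd : d ≠ 0) (hS : AssumptionS μ r C)
    (i j : Fin d) :
    partialDeriv i (partialDeriv j fun y => gaussAverage μ r C (1, y)) 0
      = -torusInt fun v => diffusionMatrix μ r C v i j := by
  obtain ⟨D, hD⟩ := exists_gaussFamily μ r hC hm hd hS
  have hg : ContDiff ℂ ⊤ fun y : Fin d → ℂ => gaussFamily D (1, y) :=
    (contDiff_gaussFamily D).comp (contDiff_const.prodMk contDiff_id)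
  have h1 : (fun y => gaussAverage μ r C (1, y)) = fun y => torusIntCLM (gaussFamily D (1, y)) := by
    ext y
    rw [torusIntCLM_apply, gaussAverage]
    congr 1
    ext v
    rw [hD]
  have hcomp : ∀ L : BoundedContinuousFunction (Fin d → ℝ) ℂ →L[ℂ] ℂ,
      partialDeriv i (partialDeriv j fun y => L (gaussFamily D (1, y))) 0
      = L (vecPartialDeriv i (vecPartialDeriv j fun y => gaussFamily D (1, y)) 0) := fun L => by
    have h2 : partialDeriv j (fun y => L (gaussFamily D (1, y)))
        = fun y => L (vecPartialDeriv j (fun y => gaussFamily D (1, y)) y) :=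
      vecPartialDeriv_clm_comp L hg j
    rw [h2]
    exact congrFun (vecPartialDeriv_clm_comp L (contDiff_vecPartialDeriv hg j) i) 0
  rw [h1, hcomp, torusIntCLM_apply, ← neg_one_mul, ← torusInt_const_mul]
  congr 1
  ext v
  have h3 := hcomp (BoundedContinuousFunction.evalCLM ℂ v)
  simp only [BoundedContinuousFunction.evalCLM_apply, hD] at h3
  rw [← h3, neg_one_mul]
  exact partialDeriv_partialDeriv_exp_quadForm _ (diffusionMatrix_symm μ r C v) i j

/-- Uniform continuity of `H` on a compact product; the time radius `t₁ + 1` leaves room for the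
approximating times `a n t`. It serves to replace the rounded time by its limit. -/
theorem eventually_forall_norm_sub_lt {E : Type*} [NormedAddCommGroup E] [ProperSpace E]
    {H : ℂ × E → ℂ} (hH : Continuous H) {t₁ R : ℝ} {a : ℕ → ℝ → ℂ} {a' : ℝ → ℂ} {η : ℕ → ℝ}
    (hη : Tendsto η atTop (𝓝 0))
    (ha : ∀ᶠ n in atTop, ∀ t ∈ Set.Icc 0 t₁, ‖a n t - a' t‖ ≤ η n)
    (ha' : ∀ t ∈ Set.Icc 0 t₁, ‖a' t‖ ≤ t₁) {ε : ℝ} (hε : 0 < ε) :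
    ∀ᶠ n in atTop, ∀ t ∈ Set.Icc 0 t₁, ∀ y : E, ‖y‖ ≤ R → ‖H (a n t, y) - H (a' t, y)‖ < ε := by
  have hK : IsCompact (Metric.closedBall (0 : ℂ) (t₁ + 1) ×ˢ Metric.closedBall (0 : E) R) :=
    (isCompact_closedBall _ _).prod (isCompact_closedBall _ _)
  obtain ⟨δ, hδ, hHδ⟩ := Metric.uniformContinuousOn_iff.1
    (hK.uniformContinuousOn_of_continuous hH.continuousOn) ε hε
  filter_upwards [ha, hη.eventually_lt_const hδ, hη.eventually_lt_const one_pos] with n h1 h2 h3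
    t ht y hy
  have h4 := h1 t ht
  have h5 := ha' t ht
  have h6 : ‖a n t‖ ≤ t₁ + 1 := by
    calc ‖a n t‖ = ‖a' t + (a n t - a' t)‖ := by rw [add_sub_cancel]
      _ ≤ t₁ + 1 := (norm_add_le _ _).trans (by linarith)
  rw [← dist_eq_norm]
  refine hHδ _ ⟨by simpa using h6, by simpa using hy⟩ _ ⟨by simp; linarith, by simpa using hy⟩ ?_
  rw [Prod.dist_eq, dist_self, max_eq_left dist_nonneg, dist_eq_norm]
  linarith

theorem norm_floor_div_sub_le {n : ℕ} (hn : 0 < n) {t : ℝ} (ht : 0 ≤ t) :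
    ‖(⌊t * n⌋₊ : ℂ) / n - (t : ℂ)‖ ≤ 1 / n := by
  have hn' : (0 : ℝ) < n := by exact_mod_cast hn
  have h1 := Nat.floor_le (mul_nonneg ht hn'.le)
  have h2 := Nat.lt_floor_add_one (t * n)
  have e : (⌊t * n⌋₊ : ℂ) / n - (t : ℂ) = (((⌊t * n⌋₊ - t * n) / n : ℝ) : ℂ) := by
    have : (n : ℂ) ≠ 0 := by exact_mod_cast hn.ne'
    push_cast
    field_simp
  rw [e, Complex.norm_real, Real.norm_eq_abs, abs_div, abs_of_pos hn']
  gcongr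
  rw [abs_le]
  constructor <;> linarith

/-- Treats `b n = √n` and `b n = n` together: with `z = y / b n`, the condition `n ≤ b n ^ 2` bounds
`m ‖z‖²` by `t₁ R²`, and the error `K ‖z‖` tends to zero. -/
theorem eventually_compensated_charFn (hC : ∀ ω, C ω ∈ Matrix.unitaryGroup (CoinIdx d) ℂ)
    (hm : ∀ σ τ, Measurable fun ω => C ω σ τ) (hd : d ≠ 0) (hS : AssumptionS μ r C)
    (hφ₀ : ‖φ₀‖ = 1) {b : ℕ → ℝ} (hb : Tendsto b atTop atTop) (hbn : ∀ n : ℕ, (n : ℝ) ≤ b n ^ 2)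
    {t₁ R : ℝ} (ht₁ : 0 ≤ t₁) {ε : ℝ} (hε : 0 < ε) :
    ∀ᶠ n : ℕ in atTop, ∀ t ∈ Set.Icc 0 t₁, ∀ y : Fin d → ℂ, ‖y‖ ≤ R →
      ‖Complex.exp (-(Complex.I * ⌊t * n⌋₊ * ∑ j, y j / (b n : ℂ) * (meanJump r j : ℂ)))
          * charFn μ r C φ₀ ⌊t * n⌋₊ (fun j => y j / (b n : ℂ))
        - gaussAverage μ r C (⌊t * n⌋₊ / (b n : ℂ) ^ 2, y)‖ < ε := by
  obtain ⟨δ, hδ, H⟩ := exists_norm_exp_mul_charFn_sub_le μ r φ₀ hC hm hd hS hφ₀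
  obtain ⟨K, hK, H⟩ := H (t₁ * R ^ 2) (by positivity)
  have hlim : Tendsto (fun n => (K + 1) * (R * (b n)⁻¹)) atTop (𝓝 0) := by
    simpa using (hb.inv_tendsto_atTop.const_mul R).const_mul (K + 1)
  have hlim' : Tendsto (fun n => R * (b n)⁻¹) atTop (𝓝 0) := by
    simpa using hb.inv_tendsto_atTop.const_mul R
  filter_upwards [hlim.eventually_lt_const hε, hlim'.eventually_lt_const hδ,
    hb.eventually_gt_atTop 0] with n h1 h2 h3 t ht y hy
  have hz : (fun j => y j / (b n : ℂ)) = (b n : ℂ)⁻¹ • y := by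
    ext j
    simp [div_eq_inv_mul]
  have hzn : ‖fun j => y j / (b n : ℂ)‖ ≤ R * (b n)⁻¹ := by
    rw [hz, norm_smul, norm_inv, Complex.norm_real, Real.norm_of_nonneg h3.le, mul_comm]
    gcongr
  have hgauss : gaussAverage μ r C (⌊t * n⌋₊ / (b n : ℂ) ^ 2, y) = torusInt fun v =>
      Complex.exp (-(⌊t * n⌋₊ / 2) *
        quadForm (diffusionMatrix μ r C v) (fun j => y j / (b n : ℂ))) := by
    rw [gaussAverage]
    congr 1
    ext v
    rw [hz, quadForm_smul]
    congr 1
    simp only [div_eq_mul_inv, inv_pow]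
    ring
  rw [hgauss]
  refine lt_of_le_of_lt (H (fun j => y j / (b n : ℂ)) ⌊t * n⌋₊ (hzn.trans h2.le) ?_) ?_
  · calc (⌊t * n⌋₊ : ℝ) * ‖fun j => y j / (b n : ℂ)‖ ^ 2
        ≤ (t₁ * b n ^ 2) * (R * (b n)⁻¹) ^ 2 := by
          gcongr
          calc (⌊t * n⌋₊ : ℝ) ≤ t * n := Nat.floor_le (mul_nonneg ht.1 (Nat.cast_nonneg n))
            _ ≤ t₁ * b n ^ 2 := mul_le_mul ht.2 (hbn n) (Nat.cast_nonneg n) ht₁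
      _ = t₁ * R ^ 2 := by field_simp
  · refine lt_of_le_of_lt ?_ h1
    have : 0 ≤ R * (b n)⁻¹ := (norm_nonneg _).trans hzn
    nlinarith

theorem exists_bounds {G : Set ℝ} {K : Set (Fin d → ℂ)} (hG : IsCompact G) (hG0 : G ⊆ Set.Ioi 0)
    (hK : IsCompact K) : ∃ t₁ R : ℝ, 0 ≤ t₁ ∧ 0 ≤ R ∧ G ⊆ Set.Icc 0 t₁ ∧ ∀ y ∈ K, ‖y‖ ≤ R := by
  obtain ⟨t₁, ht₁⟩ := hG.isBounded.exists_norm_le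
  obtain ⟨R, hR⟩ := hK.isBounded.exists_norm_le
  exact ⟨max t₁ 0, max R 0, le_max_right _ _, le_max_right _ _,
    fun t ht => ⟨(hG0 ht).le, (le_abs_self t).trans ((ht₁ t ht).trans (le_max_left _ _))⟩,
    fun y hy => (hR y hy).trans (le_max_left _ _)⟩

theorem tendstoUniformlyOn_charFn_diffusive (hC : ∀ ω, C ω ∈ Matrix.unitaryGroup (CoinIdx d) ℂ)
    (hm : ∀ σ τ, Measurable fun ω => C ω σ τ) (hd : d ≠ 0) (hS : AssumptionS μ r C)
    (hφ₀ : ‖φ₀‖ = 1) {G : Set ℝ} {K : Set (Fin d → ℂ)} (hG : IsCompact G) (hG0 : G ⊆ Set.Ioi 0)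
    (hK : IsCompact K) :
    TendstoUniformlyOn
      (fun (n : ℕ) (p : ℝ × (Fin d → ℂ)) =>
        Complex.exp (-(Complex.I * (⌊p.1 * n⌋₊ : ℂ) *
            ((∑ j, (meanJump r j : ℂ) * p.2 j) / (Real.sqrt n : ℂ)))) *
          charFn μ r C φ₀ ⌊p.1 * n⌋₊ (fun j => p.2 j / (Real.sqrt n : ℂ)))
      (fun p => gaussAverage μ r C ((p.1 : ℂ), p.2)) atTop (G ×ˢ K) := by
  obtain ⟨t₁, R, ht₁, hR, hGt, hKR⟩ := exists_bounds hG hG0 hK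
  rw [Metric.tendstoUniformlyOn_iff]
  intro ε hε
  have hsqrt : Tendsto (fun n : ℕ => Real.sqrt n) atTop atTop :=
    Real.tendsto_sqrt_atTop.comp tendsto_natCast_atTop_atTop
  have hcont := (contDiff_gaussAverage μ r hC hm hd hS).continuous
  filter_upwards [eventually_compensated_charFn μ r φ₀ hC hm hd hS hφ₀ hsqrt
      (fun n => (Real.sq_sqrt (Nat.cast_nonneg n)).ge) ht₁ (half_pos hε),
    eventually_forall_norm_sub_lt hcont (t₁ := t₁) (R := R)
      (a := fun n t => (⌊t * n⌋₊ : ℂ) / n) (a' := fun t => (t : ℂ)) (η := fun n => 1 / (n : ℝ))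
      tendsto_one_div_atTop_nhds_zero_nat
      ((eventually_gt_atTop 0).mono fun n hn t ht => norm_floor_div_sub_le hn ht.1)
      (fun t ht => by rw [Complex.norm_real, Real.norm_of_nonneg ht.1]; exact ht.2)
      (half_pos hε)] with n h1 h2 p hp
  have h3 := h1 p.1 (hGt hp.1) p.2 (hKR _ hp.2)
  have h4 := h2 p.1 (hGt hp.1) p.2 (hKR _ hp.2)
  have h5 : ((Real.sqrt n : ℝ) : ℂ) ^ 2 = n := by
    rw [← Complex.ofReal_pow, Real.sq_sqrt (Nat.cast_nonneg n), Complex.ofReal_natCast]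
  rw [h5] at h3
  have h6 : (∑ j, (meanJump r j : ℂ) * p.2 j) / (Real.sqrt n : ℂ)
      = ∑ j, p.2 j / (Real.sqrt n : ℂ) * (meanJump r j : ℂ) := by
    rw [Finset.sum_div]
    exact Finset.sum_congr rfl fun j _ => by ring
  rw [dist_comm, dist_eq_norm, h6]
  refine (norm_sub_le_norm_sub_add_norm_sub _ _ _).trans_lt ((add_lt_add h3 h4).trans_eq ?_)
  ring

theorem tendstoUniformlyOn_charFn_ballistic (hC : ∀ ω, C ω ∈ Matrix.unitaryGroup (CoinIdx d) ℂ)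
    (hm : ∀ σ τ, Measurable fun ω => C ω σ τ) (hd : d ≠ 0) (hS : AssumptionS μ r C)
    (hφ₀ : ‖φ₀‖ = 1) {G : Set ℝ} {K : Set (Fin d → ℂ)} (hG : IsCompact G) (hG0 : G ⊆ Set.Ioi 0)
    (hK : IsCompact K) :
    TendstoUniformlyOn
      (fun (n : ℕ) (p : ℝ × (Fin d → ℂ)) =>
        charFn μ r C φ₀ ⌊p.1 * n⌋₊ (fun j => p.2 j / (n : ℂ)))
      (fun p => Complex.exp (Complex.I * (p.1 : ℂ) * ∑ j, p.2 j * (meanJump r j : ℂ)))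
      atTop (G ×ˢ K) := by
  obtain ⟨t₁, R, ht₁, hR, hGt, hKR⟩ := exists_bounds hG hG0 hK
  set E : ℂ × (Fin d → ℂ) → ℂ := fun p =>
    Complex.exp (Complex.I * p.1 * ∑ j, p.2 j * (meanJump r j : ℂ)) with hE
  have hEc : Continuous E := by rw [hE]; fun_prop
  have hKc : IsCompact (Metric.closedBall (0 : ℂ) t₁ ×ˢ Metric.closedBall (0 : Fin d → ℂ) R) :=
    (isCompact_closedBall _ _).prod (isCompact_closedBall _ _)
  -- For complex `y` the drift factor is not unimodular; undoing the compensation costs a factor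
  -- `B`, whence `ε' = ε / (2 B + 2)`.
  obtain ⟨B, hB⟩ := hKc.exists_bound_of_continuousOn hEc.continuousOn
  have hB0 : 0 ≤ B := (norm_nonneg _).trans (hB (0, 0) ⟨by simpa using ht₁, by simpa using hR⟩)
  have hcont := (contDiff_gaussAverage μ r hC hm hd hS).continuous
  -- In ballistic scaling the Gaussian time is `m / n² → 0`, so the Gaussian factor disappears.
  have hgauss0 : ∀ y, gaussAverage μ r C (0, y) = 1 := fun y => by
    simp [gaussAverage, torusInt_const]
  rw [Metric.tendstoUniformlyOn_iff]
  intro ε hε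
  set ε' := ε / (2 * B + 2) with hε'
  have hε'0 : 0 < ε' := by positivity
  have hfloor : ∀ n : ℕ, 0 < n → ∀ t ∈ Set.Icc 0 t₁, (⌊t * n⌋₊ : ℝ) / n ≤ t₁ := fun n hn t ht => by
    have hn' : (0 : ℝ) < n := by exact_mod_cast hn
    rw [div_le_iff₀ hn']
    exact (Nat.floor_le (mul_nonneg ht.1 hn'.le)).trans (by gcongr; exact ht.2)
  filter_upwards [eventually_compensated_charFn μ r φ₀ hC hm hd hS hφ₀ (b := fun n => (n : ℝ))
      tendsto_natCast_atTop_atTop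
      (fun n => by exact_mod_cast Nat.le_self_pow two_ne_zero n) ht₁ hε'0,
    eventually_forall_norm_sub_lt hcont (t₁ := t₁) (R := R)
      (a := fun n t => (⌊t * n⌋₊ : ℂ) / (((n : ℝ) : ℂ)) ^ 2) (a' := fun _ => 0)
      (η := fun n => t₁ * (1 / (n : ℝ)))
      (by simpa using tendsto_one_div_atTop_nhds_zero_nat.const_mul t₁)
      ((eventually_gt_atTop 0).mono fun n hn t ht => by
        have h := hfloor n hn t ht
        have e : (⌊t * n⌋₊ : ℂ) / ((n : ℝ) : ℂ) ^ 2 = (((⌊t * n⌋₊ / n : ℝ) * (1 / n) : ℝ) : ℂ) := by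
          push_cast
          rw [sq, div_mul_div_comm, mul_one]
        rw [sub_zero, e, Complex.norm_real, Real.norm_of_nonneg (by positivity)]
        gcongr)
      (fun t _ => by simpa using ht₁) hε'0,
    eventually_forall_norm_sub_lt hEc (t₁ := t₁) (R := R)
      (a := fun n t => (⌊t * n⌋₊ : ℂ) / n) (a' := fun t => (t : ℂ)) (η := fun n => 1 / (n : ℝ))
      tendsto_one_div_atTop_nhds_zero_nat
      ((eventually_gt_atTop 0).mono fun n hn t ht => norm_floor_div_sub_le hn ht.1)
      (fun t ht => by rw [Complex.norm_real, Real.norm_of_nonneg ht.1]; exact ht.2)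
      hε'0, eventually_gt_atTop 0] with n h1 h2 h3 hn p hp
  have h1' := h1 p.1 (hGt hp.1) p.2 (hKR _ hp.2)
  have h2' := h2 p.1 (hGt hp.1) p.2 (hKR _ hp.2)
  have h3' := h3 p.1 (hGt hp.1) p.2 (hKR _ hp.2)
  rw [hgauss0] at h2'
  simp only [Complex.ofReal_natCast] at h1' h2'
  set m := ⌊p.1 * n⌋₊
  set Φ := charFn μ r C φ₀ m (fun j => p.2 j / (n : ℂ))
  have hEm : E ((m : ℂ) / n, p.2)
      = Complex.exp (Complex.I * m * ∑ j, p.2 j / (n : ℂ) * (meanJump r j : ℂ)) := by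
    simp only [hE, Finset.mul_sum]
    congr 1
    exact Finset.sum_congr rfl fun j _ => by ring
  have hEB : ‖E ((m : ℂ) / n, p.2)‖ ≤ B := by
    refine hB _ ⟨?_, by simpa using hKR _ hp.2⟩
    have e : (m : ℂ) / n = ((m / n : ℝ) : ℂ) := by push_cast; rfl
    rw [mem_closedBall_zero_iff, e, Complex.norm_real, Real.norm_of_nonneg (by positivity)]
    exact hfloor n hn _ (hGt hp.1)
  rw [Complex.exp_neg, ← hEm] at h1'
  have hE0 : E ((m : ℂ) / n, p.2) ≠ 0 := Complex.exp_ne_zero _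
  have e : Φ - E ((p.1 : ℂ), p.2)
      = E ((m : ℂ) / n, p.2) * (((E ((m : ℂ) / n, p.2))⁻¹ * Φ
          - gaussAverage μ r C (m / (n : ℂ) ^ 2, p.2))
        + (gaussAverage μ r C (m / (n : ℂ) ^ 2, p.2) - 1))
        + (E ((m : ℂ) / n, p.2) - E ((p.1 : ℂ), p.2)) := by
    rw [sub_add_sub_cancel, mul_sub, mul_inv_cancel_left₀ hE0, mul_one]
    ring
  rw [dist_comm, dist_eq_norm]
  change ‖Φ - E ((p.1 : ℂ), p.2)‖ < ε
  rw [e]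
  calc _ ≤ B * (ε' + ε') + ‖E ((m : ℂ) / n, p.2) - E ((p.1 : ℂ), p.2)‖ := by
        refine (norm_add_le _ _).trans ?_
        gcongr
        refine norm_mul_le_of_le hEB ((norm_add_le _ _).trans ?_)
        exact add_le_add h1'.le h2'.le
    _ < B * (ε' + ε') + ε' := by gcongr
    _ ≤ (2 * B + 2) * ε' := by nlinarith
    _ = ε := by rw [hε']; field_simp

end Limits

/-! ### Convergence of moments -/

section Moments

variable {Ω : Type*} [MeasurableSpace Ω] (μ : Measure Ω) [IsProbabilityMeasure μ]
    (r : CoinIdx d → Fin d → ℤ) (φ₀ : CoinSpace d) {C : Ω → Matrix (CoinIdx d) (CoinIdx d) ℂ}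

theorem avgExp_eq_sum {n : ℕ} {F : Finset (Fin d → ℤ)}
    (hF : ∀ C : ℕ → Matrix (CoinIdx d) (CoinIdx d) ℂ, ∀ k ∉ F, prob r C φ₀ n k = 0)
    (f : (Fin d → ℤ) → ℝ) :
    avgExp μ r C φ₀ n f = ∑ k ∈ F, f k * avgProb μ r C φ₀ n k :=
  tsum_eq_sum fun k hk => by rw [avgProb_eq_zero μ r φ₀ fun C => hF C k hk, mul_zero]

variable (C) in
/-- The characteristic function of `(X - n c) / b`. -/
noncomputable def scaledCharFn (n : ℕ) (b : ℝ) (c : Fin d → ℝ) (y : Fin d → ℂ) : ℂ :=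
  Complex.exp (-(Complex.I * n * ((∑ j, (c j : ℂ) * y j) / (b : ℂ))))
    * charFn μ r C φ₀ n (fun j => y j / (b : ℂ))

/-- The support is finite, so the rescaled characteristic function is a finite exponential sum: it
is entire, and its derivatives at `0` are moments times powers of `i`. -/
theorem scaledCharFn_eq_expSum {n : ℕ} {F : Finset (Fin d → ℤ)}
    (hF : ∀ C : ℕ → Matrix (CoinIdx d) (CoinIdx d) ℂ, ∀ k ∉ F, prob r C φ₀ n k = 0)
    (b : ℝ) (c : Fin d → ℝ) :
    scaledCharFn μ r φ₀ C n b c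
      = expSum F (fun k j => Complex.I * (((((k j : ℝ) - n * c j) / b : ℝ)) : ℂ))
          fun k => (avgProb μ r C φ₀ n k : ℂ) := by
  ext y
  rw [scaledCharFn, charFn_eq_sum μ r φ₀ hF, expSum, Finset.mul_sum]
  refine Finset.sum_congr rfl fun k _ => ?_
  rw [mul_left_comm, character, ← Complex.exp_add, Finset.sum_div, Finset.mul_sum, Finset.mul_sum,
    ← Finset.sum_neg_distrib, ← Finset.sum_add_distrib]
  congr 2
  refine Finset.sum_congr rfl fun j _ => ?_
  push_cast
  ring

variable (C) in
theorem contDiff_scaledCharFn (n : ℕ) (b : ℝ) (c : Fin d → ℝ) :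
    ContDiff ℂ ⊤ (scaledCharFn μ r φ₀ C n b c) := by
  obtain ⟨F, hF⟩ := exists_finset_prob_eq_zero r φ₀ n
  rw [scaledCharFn_eq_expSum μ r φ₀ hF]
  exact contDiff_expSum _ _ _

variable (C) in
theorem mixedDeriv_scaledCharFn (n : ℕ) (b : ℝ) (c : Fin d → ℝ) (s : Fin d → ℕ) :
    mixedDeriv s (scaledCharFn μ r φ₀ C n b c) 0
      = Complex.I ^ (∑ j, s j) * ((avgExp μ r C φ₀ n (fun k =>
          ∏ j, ((k j : ℝ) - n * c j) ^ s j) / b ^ (∑ j, s j) : ℝ) : ℂ) := by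
  obtain ⟨F, hF⟩ := exists_finset_prob_eq_zero r φ₀ n
  rw [scaledCharFn_eq_expSum μ r φ₀ hF, mixedDeriv_expSum, avgExp_eq_sum μ r φ₀ hF, expSum,
    Finset.sum_div, Complex.ofReal_sum, Finset.mul_sum]
  refine Finset.sum_congr rfl fun k _ => ?_
  simp only [mul_pow, Finset.prod_mul_distrib, Finset.prod_pow_eq_pow_sum, Complex.ofReal_div,
    div_pow, Finset.prod_div_distrib, Pi.zero_apply, zero_mul, Finset.sum_const_zero,
    Complex.exp_zero, mul_one]
  push_cast
  ring

variable (C) in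
theorem partialDeriv_partialDeriv_scaledCharFn (n : ℕ) (b : ℝ) (c : Fin d → ℝ) (i j : Fin d) :
    partialDeriv i (partialDeriv j (scaledCharFn μ r φ₀ C n b c)) 0
      = -((avgExp μ r C φ₀ n (fun k =>
          ((k i : ℝ) - n * c i) * ((k j : ℝ) - n * c j)) / b ^ 2 : ℝ) : ℂ) := by
  obtain ⟨F, hF⟩ := exists_finset_prob_eq_zero r φ₀ n
  rw [scaledCharFn_eq_expSum μ r φ₀ hF, partialDeriv_expSum, partialDeriv_expSum,
    avgExp_eq_sum μ r φ₀ hF, expSum, Finset.sum_div, Complex.ofReal_sum, ← Finset.sum_neg_distrib]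
  refine Finset.sum_congr rfl fun k _ => ?_
  simp only [Pi.zero_apply, zero_mul, Finset.sum_const_zero, Complex.exp_zero, mul_one]
  push_cast
  linear_combination ((avgProb μ r C φ₀ n k : ℂ) * (((k j : ℂ) - n * c j) / b)
    * (((k i : ℂ) - n * c i) / b)) * Complex.I_sq

/-- The ballistic limit restricted to `t = 1`, where the integer part is `n` itself. The limit is a
one-term `expSum`, so its derivatives are given by `mixedDeriv_expSum`. -/
theorem entireTendsto_ballistic (hC : ∀ ω, C ω ∈ Matrix.unitaryGroup (CoinIdx d) ℂ)
    (hm : ∀ σ τ, Measurable fun ω => C ω σ τ) (hd : d ≠ 0) (hS : AssumptionS μ r C)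
    (hφ₀ : ‖φ₀‖ = 1) :
    EntireTendsto (fun n : ℕ => scaledCharFn μ r φ₀ C n n 0)
      (expSum {()} (fun _ j => Complex.I * (meanJump r j : ℂ)) fun _ => 1) := by
  refine ⟨fun n => contDiff_scaledCharFn μ r φ₀ C n n 0, contDiff_expSum _ _ _, fun K hK => ?_⟩
  have h := tendstoUniformlyOn_charFn_ballistic μ r φ₀ hC hm hd hS hφ₀ (G := {1})
    isCompact_singleton (by simp) hK
  have h2 := h.comp fun y : Fin d → ℂ => ((1 : ℝ), y)
  have h3 : (fun y : Fin d → ℂ => ((1 : ℝ), y)) ⁻¹' ({1} ×ˢ K) = K := by ext; simp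
  rw [h3] at h2
  refine (h2.congr (Eventually.of_forall fun n y _ => ?_)).congr_right fun y _ => ?_
  · simp [scaledCharFn]
  · simp only [Function.comp_apply, expSum, Finset.sum_singleton, one_mul, Complex.ofReal_one,
      mul_one, Finset.mul_sum]
    congr 1
    exact Finset.sum_congr rfl fun j _ => by ring

theorem entireTendsto_diffusive (hC : ∀ ω, C ω ∈ Matrix.unitaryGroup (CoinIdx d) ℂ)
    (hm : ∀ σ τ, Measurable fun ω => C ω σ τ) (hd : d ≠ 0) (hS : AssumptionS μ r C)
    (hφ₀ : ‖φ₀‖ = 1) :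
    EntireTendsto (fun n : ℕ => scaledCharFn μ r φ₀ C n (Real.sqrt n) (meanJump r))
      fun y => gaussAverage μ r C (1, y) := by
  refine ⟨fun n => contDiff_scaledCharFn μ r φ₀ C n _ _,
    (contDiff_gaussAverage μ r hC hm hd hS).comp (contDiff_const.prodMk contDiff_id),
    fun K hK => ?_⟩
  have h := tendstoUniformlyOn_charFn_diffusive μ r φ₀ hC hm hd hS hφ₀ (G := {1})
    isCompact_singleton (by simp) hK
  have h2 := h.comp fun y : Fin d → ℂ => ((1 : ℝ), y)
  have h3 : (fun y : Fin d → ℂ => ((1 : ℝ), y)) ⁻¹' ({1} ×ˢ K) = K := by ext; simp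
  rw [h3] at h2
  refine (h2.congr (Eventually.of_forall fun n y _ => ?_)).congr_right fun y _ => ?_
  · simp [scaledCharFn]
  · simp

theorem tendsto_moments (hC : ∀ ω, C ω ∈ Matrix.unitaryGroup (CoinIdx d) ℂ)
    (hm : ∀ σ τ, Measurable fun ω => C ω σ τ) (hd : d ≠ 0) (hS : AssumptionS μ r C)
    (hφ₀ : ‖φ₀‖ = 1) (s : Fin d → ℕ) :
    Tendsto (fun n : ℕ => avgExp μ r C φ₀ n (fun k => ∏ j, (k j : ℝ) ^ s j)
        / (n : ℝ) ^ (∑ j, s j)) atTop (𝓝 (∏ j, meanJump r j ^ s j)) := by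
  have h := (entireTendsto_ballistic μ r φ₀ hC hm hd hS hφ₀).tendsto_mixedDeriv s 0
  simp only [mixedDeriv_scaledCharFn, mixedDeriv_expSum, expSum, Finset.sum_singleton,
    Pi.zero_apply, zero_mul, Finset.sum_const_zero, Complex.exp_zero, mul_one, mul_zero, sub_zero,
    one_mul, mul_pow, Finset.prod_mul_distrib, Finset.prod_pow_eq_pow_sum] at h
  have h2 := h.const_mul (Complex.I ^ (∑ j, s j))⁻¹
  simp only [inv_mul_cancel_left₀ (pow_ne_zero _ Complex.I_ne_zero)] at h2
  have h3 := (Complex.continuous_re.tendsto _).comp h2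
  simp only [Function.comp_def, Complex.ofReal_re] at h3
  convert h3 using 2
  rw [← Complex.ofReal_re (∏ j, meanJump r j ^ s j)]
  push_cast
  rfl

theorem tendsto_first_moment (hC : ∀ ω, C ω ∈ Matrix.unitaryGroup (CoinIdx d) ℂ)
    (hm : ∀ σ τ, Measurable fun ω => C ω σ τ) (hd : d ≠ 0) (hS : AssumptionS μ r C)
    (hφ₀ : ‖φ₀‖ = 1) (i : Fin d) :
    Tendsto (fun n : ℕ => avgExp μ r C φ₀ n (fun k => (k i : ℝ)) / n) atTop
      (𝓝 (meanJump r i)) := by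
  have h := tendsto_moments μ r φ₀ hC hm hd hS hφ₀ (Pi.single i 1)
  have hprod : ∀ f : Fin d → ℝ, ∏ j, f j ^ (Pi.single i 1 : Fin d → ℕ) j = f i := fun f => by
    rw [Finset.prod_eq_single i (fun j _ hj => by simp [hj]) (by simp)]
    simp
  simpa only [hprod, Finset.sum_pi_single', Finset.mem_univ, if_true, pow_one] using h

theorem tendsto_centered_second_moment (hC : ∀ ω, C ω ∈ Matrix.unitaryGroup (CoinIdx d) ℂ)
    (hm : ∀ σ τ, Measurable fun ω => C ω σ τ) (hd : d ≠ 0) (hS : AssumptionS μ r C)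
    (hφ₀ : ‖φ₀‖ = 1) (i j : Fin d) :
    Tendsto (fun n : ℕ => ((avgExp μ r C φ₀ n (fun k =>
        ((k i : ℝ) - n * meanJump r i) * ((k j : ℝ) - n * meanJump r j)) / n : ℝ) : ℂ))
      atTop (𝓝 (torusInt fun v => diffusionMatrix μ r C v i j)) := by
  have h := (((entireTendsto_diffusive μ r φ₀ hC hm hd hS hφ₀).partialDeriv j).partialDeriv
    i).tendsto 0
  simp only [partialDeriv_partialDeriv_scaledCharFn,
    partialDeriv_partialDeriv_gaussAverage μ r hC hm hd hS] at h
  simpa only [neg_neg, Real.sq_sqrt (Nat.cast_nonneg _)] using h.neg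

theorem tendsto_centered_moments (hC : ∀ ω, C ω ∈ Matrix.unitaryGroup (CoinIdx d) ℂ)
    (hm : ∀ σ τ, Measurable fun ω => C ω σ τ) (hd : d ≠ 0) (hS : AssumptionS μ r C)
    (hφ₀ : ‖φ₀‖ = 1) (s : Fin d → ℕ) :
    Tendsto (fun n : ℕ => ((avgExp μ r C φ₀ n (fun k =>
        ∏ j, ((k j : ℝ) - n * meanJump r j) ^ s j) / (Real.sqrt n) ^ (∑ j, s j) : ℝ) : ℂ))
      atTop (𝓝 ((-Complex.I) ^ (∑ j, s j) * torusInt fun v =>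
        mixedDeriv s (fun y => Complex.exp (-(1 / 2) *
          quadForm (diffusionMatrix μ r C v) y)) 0)) := by
  have h := (entireTendsto_diffusive μ r φ₀ hC hm hd hS hφ₀).tendsto_mixedDeriv s 0
  simp only [mixedDeriv_scaledCharFn, mixedDeriv_gaussAverage μ r hC hm hd hS] at h
  have h2 := h.const_mul ((-Complex.I) ^ (∑ j, s j))
  have hI : (-Complex.I) ^ (∑ j, s j) * Complex.I ^ (∑ j, s j) = 1 := by
    rw [← mul_pow, neg_mul, Complex.I_mul_I, neg_neg, one_pow]
  simpa only [← mul_assoc, hI, one_mul] using h2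

/-- The condition `d ≥ 1` is implied by the existence of a unit vector, since the coin space is
trivial for `d = 0`. -/
theorem dim_ne_zero_of_norm_eq_one (hφ₀ : ‖φ₀‖ = 1) : d ≠ 0 := by
  rintro rfl
  have : φ₀ = 0 := Subsingleton.elim _ _
  rw [this, norm_zero] at hφ₀
  exact zero_ne_one hφ₀

end Moments

end RandomQW

theorem mainTheorem1 {d : ℕ} {Ω : Type*} [MeasurableSpace Ω]
    (μ : Measure Ω) [IsProbabilityMeasure μ]
    (r : RandomQW.CoinIdx d → Fin d → ℤ)
    (C : Ω → Matrix (RandomQW.CoinIdx d) (RandomQW.CoinIdx d) ℂ)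
    (hC_unitary : ∀ ω, C ω ∈ Matrix.unitaryGroup (RandomQW.CoinIdx d) ℂ)
    (hC_meas : ∀ σ τ, Measurable fun ω => C ω σ τ)
    (φ₀ : RandomQW.CoinSpace d) (hφ₀ : ‖φ₀‖ = 1)
    (hS : RandomQW.AssumptionS μ r C) :
    -- ballistic scaling of the characteristic function
    (∀ (G : Set ℝ) (K : Set (Fin d → ℂ)), IsCompact G → G ⊆ Set.Ioi 0 → IsCompact K →
      TendstoUniformlyOn
        (fun (n : ℕ) (p : ℝ × (Fin d → ℂ)) =>
          RandomQW.charFn μ r C φ₀ ⌊p.1 * n⌋₊ (fun j => p.2 j / (n : ℂ)))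
        (fun p => Complex.exp
          (Complex.I * (p.1 : ℂ) * ∑ j, p.2 j * (RandomQW.meanJump r j : ℂ)))
        atTop (G ×ˢ K)) ∧
    -- diffusive scaling of the characteristic function
    (∀ (G : Set ℝ) (K : Set (Fin d → ℂ)), IsCompact G → G ⊆ Set.Ioi 0 → IsCompact K →
      TendstoUniformlyOn
        (fun (n : ℕ) (p : ℝ × (Fin d → ℂ)) =>
          Complex.exp (-(Complex.I * (⌊p.1 * n⌋₊ : ℂ) *
              ((∑ j, (RandomQW.meanJump r j : ℂ) * p.2 j) / (Real.sqrt n : ℂ)))) *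
            RandomQW.charFn μ r C φ₀ ⌊p.1 * n⌋₊ (fun j => p.2 j / (Real.sqrt n : ℂ)))
        (fun p => RandomQW.torusInt fun v =>
          Complex.exp (-((p.1 : ℂ) / 2) *
            RandomQW.quadForm (RandomQW.diffusionMatrix μ r C v) p.2))
        atTop (G ×ˢ K)) ∧
    -- the right-hand side is analytic in `(t, y)`
    AnalyticOnNhd ℂ
      (fun p : ℂ × (Fin d → ℂ) => RandomQW.torusInt fun v =>
        Complex.exp (-(p.1 / 2) *
          RandomQW.quadForm (RandomQW.diffusionMatrix μ r C v) p.2)) Set.univ ∧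
    -- first moments
    (∀ i : Fin d, Tendsto
      (fun n : ℕ => RandomQW.avgExp μ r C φ₀ n (fun k => (k i : ℝ)) / n)
      atTop (𝓝 (RandomQW.meanJump r i))) ∧
    -- centered second moments
    (∀ i j : Fin d, Tendsto
      (fun n : ℕ => ((RandomQW.avgExp μ r C φ₀ n (fun k =>
        ((k i : ℝ) - n * RandomQW.meanJump r i) * ((k j : ℝ) - n * RandomQW.meanJump r j)) / n
          : ℝ) : ℂ))
      atTop (𝓝 (RandomQW.torusInt fun v => RandomQW.diffusionMatrix μ r C v i j))) ∧
    -- all moments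
    (∀ s : Fin d → ℕ, Tendsto
      (fun n : ℕ => RandomQW.avgExp μ r C φ₀ n (fun k => ∏ j, (k j : ℝ) ^ s j)
        / (n : ℝ) ^ (∑ j, s j))
      atTop (𝓝 (∏ j, RandomQW.meanJump r j ^ s j))) ∧
    -- all centered moments
    (∀ s : Fin d → ℕ, Tendsto
      (fun n : ℕ => ((RandomQW.avgExp μ r C φ₀ n (fun k =>
        ∏ j, ((k j : ℝ) - n * RandomQW.meanJump r j) ^ s j)
          / (Real.sqrt n) ^ (∑ j, s j) : ℝ) : ℂ))
      atTop (𝓝 ((-Complex.I) ^ (∑ j, s j) * RandomQW.torusInt fun v =>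
        RandomQW.mixedDeriv s (fun y => Complex.exp (-(1 / 2) *
          RandomQW.quadForm (RandomQW.diffusionMatrix μ r C v) y)) 0))) := by
  have hd := RandomQW.dim_ne_zero_of_norm_eq_one φ₀ hφ₀
  exact ⟨fun G K hG hG0 hK =>
      RandomQW.tendstoUniformlyOn_charFn_ballistic μ r φ₀ hC_unitary hC_meas hd hS hφ₀ hG hG0 hK,
    fun G K hG hG0 hK =>
      RandomQW.tendstoUniformlyOn_charFn_diffusive μ r φ₀ hC_unitary hC_meas hd hS hφ₀ hG hG0 hK,
    contDiff_omega_iff_analyticOnNhd.1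
      (RandomQW.contDiff_gaussAverage μ r hC_unitary hC_meas hd hS),
    RandomQW.tendsto_first_moment μ r φ₀ hC_unitary hC_meas hd hS hφ₀,
    RandomQW.tendsto_centered_second_moment μ r φ₀ hC_unitary hC_meas hd hS hφ₀,
    RandomQW.tendsto_moments μ r φ₀ hC_unitary hC_meas hd hS hφ₀,
    RandomQW.tendsto_centered_moments μ r φ₀ hC_unitary hC_meas hd hS hφ₀⟩
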